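/- Let $L=L_0\oplus L_1$ be a ($\mathbb Z/2$-graded) Lie superalgebra over $\mathbb C$, of arbitrary dimension, and let $U=U(L)$ be its universal enveloping algebra, i.e. the tensor algebra of $L$ modulo the relations $[x,y]=xy-(-1)^{ab}yx$ for $x\in L_a$, $y\in L_b$. For $k\ge 0$ put $$C_k=\bigoplus_{p+q=k}\Lambda^p(L_0)\otimes S^q(L_1),\qquad M_k=U\otimes_{\mathbb C}C_k ,$$ where $M_k$ is a left $U$-module through the factor $U$. For $k\ge 1$ there is a well-defined $U$-linear map $\partial_k:M_k\to M_{k-1}$ given, for $u\in U$, $x_i\in L_0$, $y_j\in L_1$, $p+q=k$, by $$\begin{aligned} \partial_k\big(u\otimes(x_1\wedge\cdots\wedge x_p)\otimes(y_1\cdots y_q)\big) &=\sum_{1\le s<t\le p}(-1)^{s+t}\,u\otimes([x_s,x_t]\wedge x_1\wedge\cdots\widehat{x_s}\cdots\widehat{x_t}\cdots\wedge x_p)\otimes(y_1\cdots y_q)\\ &+\sum_{s=1}^p\sum_{t=1}^q(-1)^s\,u\otimes(x_1\wedge\cdots\widehat{x_s}\cdots\wedge x_p)\otimes([x_s,y_t]\,y_1\cdots\widehat{y_t}\cdots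 y_q)\\ &-\sum_{1\le s<t\le q}u\otimes([y_s,y_t]\wedge x_1\wedge\cdots\wedge x_p)\otimes(y_1\cdots\widehat{y_s}\cdots\widehat{y_t}\cdots y_q)\\ &+\sum_{s=1}^p(-1)^{s+1}(u\,x_s)\otimes(x_1\wedge\cdots\widehat{x_s}\cdots\wedge x_p)\otimes(y_1\cdots y_q)\\ &+(-1)^p\sum_{t=1}^q(u\,y_t)\otimes(x_1\wedge\cdots\wedge x_p)\otimes(y_1\cdots\widehat{y_t}\cdots y_q), \end{aligned}$$ and let $\partial_0:M_0=U\to\mathbb C$ be the augmentation (the algebra homomorphism that kills $L$). Then every $M_k$ is a free $U$-module, $\partial_k\circ\partial_{k+1}=0$ for all $k\ge 1$, and $$\cdots\to M_2\xrightarrow{\partial_2}M_1\xrightarrow{\partial_1}M_0\xrightarrow{\partial_0}\mathbb C\to 0$$ is exact; that is, $M=(M_k,\partial_k)$ is a free resolution of the trivial one-dimensional left $U$-module $\mathbb C$. Consequently, let $V$ be a right $U$-module and define $H_k(L,V)=\operatorname{Tor}^U_k(V,\mathbb C)$. Let $d_k:V\otimes_{\mathbb C}C_k\to V\otimes_{\mathbb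 C}C_{k-1}$ ($k\ge1$) be the maps given by the same formula as $\partial_k$ with $u\in U$ replaced by $v\in V$. Then $d_k\circ d_{k+1}=0$ for $k\ge 1$; the assignments $v\otimes(u\otimes c)\mapsto vu\otimes c$ define linear isomorphisms $V\otimes_U M_k\cong V\otimes_{\mathbb C}C_k$ that carry $1_V\otimes\partial_k$ to $d_k$; and for every $k\ge 0$ the space $H_k(L,V)$ is isomorphic to the $k$-th homology space of the standard complex $$\cdots\to V\otimes_{\mathbb C}C_2\xrightarrow{d_2}V\otimes_{\mathbb C}C_1\xrightarrow{d_1}V\otimes_{\mathbb C}C_0\to 0 .$$ -/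

import Mathlib

open TensorProduct

universe u v w

noncomputable section

/-! ## Lie superalgebras over the complex numbers -/

/-- The sign `(-1)^(ab)` for parities `a`, `b` in `ℤ/2`. -/
def superSign (a b : ZMod 2) : ℂ := (-1) ^ (a.val * b.val)

/-- A Lie superalgebra `L = L₀ ⊕ L₁` over `ℂ`: a `ℤ/2`-graded vector space with an even bilinear
bracket which is super-antisymmetric and satisfies the super Jacobi identity. -/
class LieSuperalgebra (L : Type u) [AddCommGroup L] [Module ℂ L] where
  /-- the homogeneous components: `part 0` is the even part `L₀`, `part 1` the odd part `L₁` -/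
  part : ZMod 2 → Submodule ℂ L
  isInternal : DirectSum.IsInternal part
  /-- the superbracket -/
  sbracket : L →ₗ[ℂ] L →ₗ[ℂ] L
  sbracket_mem : ∀ a b : ZMod 2, ∀ x ∈ part a, ∀ y ∈ part b, sbracket x y ∈ part (a + b)
  sbracket_antisymm : ∀ a b : ZMod 2, ∀ x ∈ part a, ∀ y ∈ part b,
    sbracket x y = -(superSign a b • sbracket y x)
  sbracket_jacobi : ∀ a b : ZMod 2, ∀ x ∈ part a, ∀ y ∈ part b, ∀ z : L,
    sbracket x (sbracket y z) =
      sbracket (sbracket x y) z + superSign a b • sbracket y (sbracket x z)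

namespace LieSuperalgebra

section Brackets

variable (L : Type u) [AddCommGroup L] [Module ℂ L] [LieSuperalgebra L]

/-- The even part `L₀`. -/
abbrev L0 : Type u := ↥(part (L := L) 0)

/-- The odd part `L₁`. -/
abbrev L1 : Type u := ↥(part (L := L) 1)

variable {L}

/-- The bracket `L₀ × L₀ → L₀`. -/
def br00 : L0 L →ₗ[ℂ] L0 L →ₗ[ℂ] L0 L :=
  LinearMap.mk₂ ℂ (fun x y => ⟨sbracket (x : L) (y : L), sbracket_mem 0 0 _ x.2 _ y.2⟩)
    (fun _ _ _ => Subtype.ext (by simp)) (fun _ _ _ => Subtype.ext (by simp))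
    (fun _ _ _ => Subtype.ext (by simp)) (fun _ _ _ => Subtype.ext (by simp))

/-- The bracket `L₀ × L₁ → L₁`. -/
def br01 : L0 L →ₗ[ℂ] L1 L →ₗ[ℂ] L1 L :=
  LinearMap.mk₂ ℂ (fun x y => ⟨sbracket (x : L) (y : L), sbracket_mem 0 1 _ x.2 _ y.2⟩)
    (fun _ _ _ => Subtype.ext (by simp)) (fun _ _ _ => Subtype.ext (by simp))
    (fun _ _ _ => Subtype.ext (by simp)) (fun _ _ _ => Subtype.ext (by simp))

/-- The bracket `L₁ × L₁ → L₀`. -/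
def br11 : L1 L →ₗ[ℂ] L1 L →ₗ[ℂ] L0 L :=
  LinearMap.mk₂ ℂ (fun x y => ⟨sbracket (x : L) (y : L), sbracket_mem 1 1 _ x.2 _ y.2⟩)
    (fun _ _ _ => Subtype.ext (by simp)) (fun _ _ _ => Subtype.ext (by simp))
    (fun _ _ _ => Subtype.ext (by simp)) (fun _ _ _ => Subtype.ext (by simp))

theorem br00_antisymm (x y : L0 L) : br00 x y = -br00 y x :=
  Subtype.ext (by simpa [superSign, br00] using sbracket_antisymm 0 0 _ x.2 _ y.2)

theorem br11_symm (x y : L1 L) : br11 x y = br11 y x :=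
  Subtype.ext (by
    have h := sbracket_antisymm 1 1 _ x.2 _ y.2
    simpa [superSign, br11, ZMod.val_one] using h)

end Brackets

/-! ## The universal enveloping algebra -/

section Enveloping

variable (L : Type u) [AddCommGroup L] [Module ℂ L] [LieSuperalgebra L]

/-- The relations `[x, y] = x y - (-1)^(ab) y x` for homogeneous `x ∈ L_a`, `y ∈ L_b`. -/
inductive EnvRel : TensorAlgebra ℂ L → TensorAlgebra ℂ L → Prop
  | super_comm (a b : ZMod 2) (x y : L) (hx : x ∈ part a) (hy : y ∈ part b) :
      EnvRel (TensorAlgebra.ι ℂ (sbracket x y))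
        (TensorAlgebra.ι ℂ x * TensorAlgebra.ι ℂ y -
          superSign a b • (TensorAlgebra.ι ℂ y * TensorAlgebra.ι ℂ x))

/-- The universal enveloping algebra `U(L)`: the tensor algebra modulo the two-sided ideal
generated by the relations `EnvRel`. -/
def Env : Type u := RingQuot (EnvRel L)

instance : Ring (Env L) := inferInstanceAs (Ring (RingQuot (EnvRel L)))

instance : Algebra ℂ (Env L) := inferInstanceAs (Algebra ℂ (RingQuot (EnvRel L)))

/-- The canonical map `L → U(L)`. -/
def envι : L →ₗ[ℂ] Env L :=
  (RingQuot.mkAlgHom ℂ (EnvRel L)).toLinearMap ∘ₗ TensorAlgebra.ι ℂ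

/-- The augmentation `U(L) → ℂ`, the unital algebra map that kills `L` ("constant term"). -/
def envAug : Env L →ₐ[ℂ] ℂ :=
  RingQuot.liftAlgHom ℂ ⟨TensorAlgebra.lift ℂ (0 : L →ₗ[ℂ] ℂ), by
    intro a b h
    induction h with
    | super_comm a b x y hx hy => simp⟩

/-- The trivial one-dimensional left `U(L)`-module `ℂ` (in an arbitrary universe). -/
def TrivialModule : Type w := ULift.{w} ℂ

instance : AddCommGroup (TrivialModule.{w}) := inferInstanceAs (AddCommGroup (ULift.{w} ℂ))

instance : Module ℂ (TrivialModule.{w}) := inferInstanceAs (Module ℂ (ULift.{w} ℂ))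

/-- `U(L)` acts on the trivial module through the augmentation. -/
instance : Module (Env L) (TrivialModule.{w}) :=
  Module.compHom (TrivialModule.{w}) (envAug L).toRingHom

instance : IsScalarTower ℂ (Env L) (TrivialModule.{w}) where
  smul_assoc r a z := by
    change envAug L (r • a) • z = r • (envAug L a • z)
    rw [map_smul, smul_assoc]

end Enveloping

/-! ## Multilinear algebra: exterior and symmetric powers -/

section Powers

variable {W : Type u} [AddCommGroup W] [Module ℂ W] {N : Type v} [AddCommGroup N] [Module ℂ N]

/-- The linear map on `S^n(W)` induced by a symmetric multilinear map. -/
def symLift {n : ℕ} (f : MultilinearMap ℂ (fun _ : Fin n => W) N)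
    (hf : ∀ (e : Equiv.Perm (Fin n)) (y : Fin n → W), f (fun i => y (e i)) = f y) :
    Sym[ℂ]^n W →ₗ[ℂ] N where
  toFun := AddCon.lift _ (PiTensorProduct.lift f).toAddMonoidHom (by
    rw [AddCon.addConGen_le]
    intro a b h
    induction h with
    | perm e g => simp [AddCon.ker_rel, hf])
  map_add' a b := map_add _ a b
  map_smul' r a := AddCon.induction_on a fun z => (PiTensorProduct.lift f).map_smul r z

theorem symLift_tprod {n : ℕ} (f : MultilinearMap ℂ (fun _ : Fin n => W) N)
    (hf : ∀ (e : Equiv.Perm (Fin n)) (y : Fin n → W), f (fun i => y (e i)) = f y)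
    (y : Fin n → W) : symLift f hf (SymmetricPower.tprod ℂ y) = f y :=
  PiTensorProduct.lift.tprod (φ := f) y

variable (W)

/-- The map `Λ^(p+1)(W) → W ⊗ Λ^p(W)`,
`x_0 ∧ ⋯ ∧ x_p ↦ ∑ s, (-1)^s x_s ⊗ (x_0 ∧ ⋯ x̂_s ⋯ ∧ x_p)` (indices start at `0`). -/
def extCo (p : ℕ) : ⋀[ℂ]^(p + 1) W →ₗ[ℂ] W ⊗[ℂ] ⋀[ℂ]^p W :=
  exteriorPower.alternatingMapLinearEquiv
    (AlternatingMap.alternatizeUncurryFin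
      (exteriorPower.alternatingMapLinearEquiv.symm.toLinearMap ∘ₗ
        TensorProduct.mk ℂ W (⋀[ℂ]^p W)))

theorem extCo_ιMulti (p : ℕ) (x : Fin (p + 1) → W) :
    extCo W p (exteriorPower.ιMulti ℂ (p + 1) x) =
      ∑ s : Fin (p + 1), ((-1 : ℂ) ^ (s : ℕ)) • (x s ⊗ₜ[ℂ] exteriorPower.ιMulti ℂ p (s.removeNth x)) := by
  simp only [extCo, exteriorPower.alternatingMapLinearEquiv_apply_ιMulti,
    AlternatingMap.alternatizeUncurryFin_apply]
  refine Finset.sum_congr rfl fun s _ => ?_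
  rw [← Int.cast_smul_eq_zsmul ℂ]
  simp [exteriorPower.alternatingMapLinearEquiv_symm_apply]

/-- The map `W ⊗ Λ^p(W) → Λ^(p+1)(W)`, `z ⊗ ω ↦ z ∧ ω`. -/
def extMul (p : ℕ) : W ⊗[ℂ] ⋀[ℂ]^p W →ₗ[ℂ] ⋀[ℂ]^(p + 1) W :=
  TensorProduct.lift
    (exteriorPower.alternatingMapLinearEquiv.toLinearMap ∘ₗ
      (exteriorPower.ιMulti ℂ (p + 1) (M := W)).curryLeft)

theorem extMul_ιMulti (p : ℕ) (z : W) (x : Fin p → W) :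
    extMul W p (z ⊗ₜ exteriorPower.ιMulti ℂ p x) =
      exteriorPower.ιMulti ℂ (p + 1) (Fin.cons z x : Fin (p + 1) → W) := by
  simp [extMul]
  rfl

/-- The multilinear map `(y_0, …, y_q) ↦ ∑ t, y_t ⊗ (y_0 ⋯ ŷ_t ⋯ y_q)`. -/
def symCoAux (q : ℕ) : MultilinearMap ℂ (fun _ : Fin (q + 1) => W) (W ⊗[ℂ] Sym[ℂ]^q W) :=
  ∑ t : Fin (q + 1), LinearMap.uncurryMid (M := fun _ => W) t
    { toFun := fun z => (TensorProduct.mk ℂ W (Sym[ℂ]^q W) z).compMultilinearMap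
        (SymmetricPower.tprod ℂ)
      map_add' := fun a b => by ext; simp
      map_smul' := fun a b => by ext; simp [TensorProduct.smul_tmul'] }

theorem symCoAux_apply (q : ℕ) (y : Fin (q + 1) → W) :
    symCoAux W q y =
      ∑ t : Fin (q + 1), y t ⊗ₜ[ℂ] SymmetricPower.tprod ℂ (t.removeNth y) := by
  simp [symCoAux]

theorem symCoAux_perm (q : ℕ) (e : Equiv.Perm (Fin (q + 1))) (y : Fin (q + 1) → W) :
    symCoAux W q (fun i => y (e i)) = symCoAux W q y := by
  rw [symCoAux_apply, symCoAux_apply]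
  refine Eq.trans ?_ (Equiv.sum_comp e _)
  refine Finset.sum_congr rfl fun t _ => ?_
  congr 1
  let σ : Equiv.Perm (Fin q) :=
    (finSuccAboveEquiv t).trans
      ((e.subtypeEquiv (p := fun a => a ≠ t) (q := fun a => a ≠ e t)
        (fun a => by simp)).trans (finSuccAboveEquiv (e t)).symm)
  have hσ : ∀ i, (e t).succAbove (σ i) = e (t.succAbove i) := by
    intro i
    have h := (finSuccAboveEquiv (e t)).apply_symm_apply
      ((e.subtypeEquiv (p := fun a => a ≠ t) (q := fun a => a ≠ e t)
        (fun a => by simp)) (finSuccAboveEquiv t i))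
    exact congrArg Subtype.val h
  rw [← SymmetricPower.tprod_equiv σ ((e t).removeNth y)]
  congr 1
  funext i
  simp [Fin.removeNth_apply, hσ]

/-- The map `S^(q+1)(W) → W ⊗ S^q(W)`, `y_0 ⋯ y_q ↦ ∑ t, y_t ⊗ (y_0 ⋯ ŷ_t ⋯ y_q)`. -/
def symCo (q : ℕ) : Sym[ℂ]^(q + 1) W →ₗ[ℂ] W ⊗[ℂ] Sym[ℂ]^q W :=
  symLift (symCoAux W q) (symCoAux_perm W q)

theorem symCo_tprod (q : ℕ) (y : Fin (q + 1) → W) :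
    symCo W q (SymmetricPower.tprod ℂ y) =
      ∑ t : Fin (q + 1), y t ⊗ₜ[ℂ] SymmetricPower.tprod ℂ (t.removeNth y) := by
  rw [symCo, symLift_tprod, symCoAux_apply]

/-- The map `W ⊗ S^q(W) → S^(q+1)(W)`, `z ⊗ σ ↦ z σ`. -/
def symMul (q : ℕ) : W ⊗[ℂ] Sym[ℂ]^q W →ₗ[ℂ] Sym[ℂ]^(q + 1) W :=
  TensorProduct.lift
    { toFun := fun z => symLift ((SymmetricPower.tprod ℂ (ι := Fin (q + 1)) (M := W)).curryLeft z)
        (fun e y => by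
          have h := SymmetricPower.tprod_equiv (R := ℂ) (Equiv.Perm.decomposeFin.symm (0, e))
            (Fin.cons z y : Fin (q + 1) → W)
          simp only [MultilinearMap.curryLeft_apply]
          rw [← h]
          congr 1
          funext i
          refine Fin.cases ?_ (fun j => ?_) i <;> simp)
      map_add' := fun a b => LinearMap.ext_on (SymmetricPower.span_tprod_eq_top ℂ (Fin q) W) (by
        rintro _ ⟨y, rfl⟩
        simp [symLift_tprod])
      map_smul' := fun r a => LinearMap.ext_on (SymmetricPower.span_tprod_eq_top ℂ (Fin q) W) (by
        rintro _ ⟨y, rfl⟩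
        simp [symLift_tprod]) }

theorem symMul_tprod (q : ℕ) (z : W) (y : Fin q → W) :
    symMul W q (z ⊗ₜ SymmetricPower.tprod ℂ y) =
      SymmetricPower.tprod ℂ (Fin.cons z y : Fin (q + 1) → W) := by
  simp [symMul, symLift_tprod]

end Powers

/-! ## The spaces `C_k(L)` and the differentials -/

section Chains

variable (L : Type u) [AddCommGroup L] [Module ℂ L] [LieSuperalgebra L]

/-- `C_k(L) = ⨁_{p + q = k} Λ^p(L₀) ⊗ S^q(L₁)`. -/
abbrev Chains (k : ℕ) : Type u :=
  DirectSum (Finset.HasAntidiagonal.antidiagonal k) fun pq =>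
    (⋀[ℂ]^pq.1.1 (L0 L)) ⊗[ℂ] (Sym[ℂ]^pq.1.2 (L1 L))

variable {L}

/-- The inclusion of the summand `Λ^p(L₀) ⊗ S^q(L₁)` into `C_k(L)`, `p + q = k`. -/
def incl (p q k : ℕ) (h : p + q = k) :
    (⋀[ℂ]^p (L0 L)) ⊗[ℂ] (Sym[ℂ]^q (L1 L)) →ₗ[ℂ] Chains L k :=
  DirectSum.lof ℂ (Finset.HasAntidiagonal.antidiagonal k)
    (fun pq => (⋀[ℂ]^pq.1.1 (L0 L)) ⊗[ℂ] (Sym[ℂ]^pq.1.2 (L1 L)))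
    ⟨(p, q), Finset.HasAntidiagonal.mem_antidiagonal.2 h⟩

/-- The element `(x_1 ∧ ⋯ ∧ x_p) ⊗ (y_1 ⋯ y_q)` of `C_k(L)`, `p + q = k`, for the lists
`X = [x_1, …, x_p]` and `Y = [y_1, …, y_q]` (and `0` if the lengths do not add up to `k`). -/
def gen (k : ℕ) (X : List (L0 L)) (Y : List (L1 L)) : Chains L k :=
  if h : X.length + Y.length = k then
    incl X.length Y.length k h
      (exteriorPower.ιMulti ℂ X.length X.get ⊗ₜ SymmetricPower.tprod ℂ Y.get)
  else 0

/-- The action `L₀ ⊗ S^q(L₁) → S^q(L₁)` by derivations,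
`x ⊗ y_1 ⋯ y_q ↦ ∑ t, [x, y_t] y_1 ⋯ ŷ_t ⋯ y_q`, for `q ≥ 1`. -/
def symAct (q : ℕ) : L0 L ⊗[ℂ] Sym[ℂ]^(q + 1) (L1 L) →ₗ[ℂ] Sym[ℂ]^(q + 1) (L1 L) :=
  symMul (L1 L) q ∘ₗ LinearMap.rTensor _ (TensorProduct.lift br01) ∘ₗ
    (TensorProduct.assoc ℂ (L0 L) (L1 L) (Sym[ℂ]^q (L1 L))).symm.toLinearMap ∘ₗ
      LinearMap.lTensor _ (symCo (L1 L) q)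

/-- First sum: `∑_{s<t} (-1)^(s+t) [x_s, x_t] ∧ x_1 ∧ ⋯ x̂_s ⋯ x̂_t ⋯ ∧ x_p ⊗ y_1 ⋯ y_q`. -/
def diffXX : ∀ p q k : ℕ, p + q = k + 1 →
    (⋀[ℂ]^p (L0 L)) ⊗[ℂ] (Sym[ℂ]^q (L1 L)) →ₗ[ℂ] Chains L k
  | 0, _, _, _ => 0
  | 1, _, _, _ => 0
  | p + 2, q, k, h =>
      incl (p + 1) q k (by omega) ∘ₗ LinearMap.rTensor _
        ((-(1 / 2 : ℂ)) • (extMul (L0 L) p ∘ₗ LinearMap.rTensor _ (TensorProduct.lift br00) ∘ₗ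
          (TensorProduct.assoc ℂ (L0 L) (L0 L) (⋀[ℂ]^p (L0 L))).symm.toLinearMap ∘ₗ
            LinearMap.lTensor _ (extCo (L0 L) p) ∘ₗ extCo (L0 L) (p + 1)))

/-- Second sum:
`∑_s ∑_t (-1)^s (x_1 ∧ ⋯ x̂_s ⋯ ∧ x_p) ⊗ ([x_s, y_t] y_1 ⋯ ŷ_t ⋯ y_q)` (`s` starts at `1`). -/
def diffXY : ∀ p q k : ℕ, p + q = k + 1 →
    (⋀[ℂ]^p (L0 L)) ⊗[ℂ] (Sym[ℂ]^q (L1 L)) →ₗ[ℂ] Chains L k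
  | 0, _, _, _ => 0
  | _ + 1, 0, _, _ => 0
  | p + 1, q + 1, k, h =>
      (-1 : ℂ) • (incl p (q + 1) k (by omega) ∘ₗ LinearMap.lTensor _ (symAct q) ∘ₗ
        (TensorProduct.leftComm ℂ (L0 L) (⋀[ℂ]^p (L0 L))
          (Sym[ℂ]^(q + 1) (L1 L))).toLinearMap ∘ₗ
        (TensorProduct.assoc ℂ (L0 L) (⋀[ℂ]^p (L0 L))
          (Sym[ℂ]^(q + 1) (L1 L))).toLinearMap ∘ₗ
        LinearMap.rTensor _ (extCo (L0 L) p))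

/-- Third sum:
`-∑_{s<t} ([y_s, y_t] ∧ x_1 ∧ ⋯ ∧ x_p) ⊗ (y_1 ⋯ ŷ_s ⋯ ŷ_t ⋯ y_q)`. -/
def diffYY : ∀ p q k : ℕ, p + q = k + 1 →
    (⋀[ℂ]^p (L0 L)) ⊗[ℂ] (Sym[ℂ]^q (L1 L)) →ₗ[ℂ] Chains L k
  | _, 0, _, _ => 0
  | _, 1, _, _ => 0
  | p, q + 2, k, h =>
      incl (p + 1) q k (by omega) ∘ₗ LinearMap.rTensor _ (extMul (L0 L) p) ∘ₗ
        (TensorProduct.assoc ℂ (L0 L) (⋀[ℂ]^p (L0 L)) (Sym[ℂ]^q (L1 L))).symm.toLinearMap ∘ₗ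
        (TensorProduct.leftComm ℂ (⋀[ℂ]^p (L0 L)) (L0 L) (Sym[ℂ]^q (L1 L))).toLinearMap ∘ₗ
        LinearMap.lTensor _ ((-(1 / 2 : ℂ)) • (LinearMap.rTensor _ (TensorProduct.lift br11) ∘ₗ
          (TensorProduct.assoc ℂ (L1 L) (L1 L) (Sym[ℂ]^q (L1 L))).symm.toLinearMap ∘ₗ
            LinearMap.lTensor _ (symCo (L1 L) q) ∘ₗ symCo (L1 L) (q + 1)))

/-- Fourth sum, before acting:
`∑_s (-1)^(s+1) x_s ⊗ (x_1 ∧ ⋯ x̂_s ⋯ ∧ x_p) ⊗ (y_1 ⋯ y_q)` in `L ⊗ C_k(L)` (`s` starts at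
`1`). -/
def diffX : ∀ p q k : ℕ, p + q = k + 1 →
    (⋀[ℂ]^p (L0 L)) ⊗[ℂ] (Sym[ℂ]^q (L1 L)) →ₗ[ℂ] L ⊗[ℂ] Chains L k
  | 0, _, _, _ => 0
  | p + 1, q, k, h =>
      TensorProduct.map (part (L := L) 0).subtype (incl p q k (by omega)) ∘ₗ
        (TensorProduct.assoc ℂ (L0 L) (⋀[ℂ]^p (L0 L)) (Sym[ℂ]^q (L1 L))).toLinearMap ∘ₗ
        LinearMap.rTensor _ (extCo (L0 L) p)

/-- Fifth sum, before acting: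
`(-1)^p ∑_t y_t ⊗ (x_1 ∧ ⋯ ∧ x_p) ⊗ (y_1 ⋯ ŷ_t ⋯ y_q)` in `L ⊗ C_k(L)`. -/
def diffY : ∀ p q k : ℕ, p + q = k + 1 →
    (⋀[ℂ]^p (L0 L)) ⊗[ℂ] (Sym[ℂ]^q (L1 L)) →ₗ[ℂ] L ⊗[ℂ] Chains L k
  | _, 0, _, _ => 0
  | p, q + 1, k, h =>
      ((-1 : ℂ) ^ p) • (TensorProduct.map (part (L := L) 1).subtype (incl p q k (by omega)) ∘ₗ
        (TensorProduct.leftComm ℂ (⋀[ℂ]^p (L0 L)) (L1 L) (Sym[ℂ]^q (L1 L))).toLinearMap ∘ₗ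
        LinearMap.lTensor _ (symCo (L1 L) q))

variable (L)

/-- The part `C_{k+1}(L) → C_k(L)` of the differential made of the three sums with brackets. -/
def chainsD (k : ℕ) : Chains L (k + 1) →ₗ[ℂ] Chains L k :=
  DirectSum.toModule ℂ _ _ fun pq =>
    diffXX pq.1.1 pq.1.2 k (Finset.HasAntidiagonal.mem_antidiagonal.1 pq.2) +
    diffXY pq.1.1 pq.1.2 k (Finset.HasAntidiagonal.mem_antidiagonal.1 pq.2) +
    diffYY pq.1.1 pq.1.2 k (Finset.HasAntidiagonal.mem_antidiagonal.1 pq.2)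

/-- The part `C_{k+1}(L) → L ⊗ C_k(L)` of the differential made of the two sums in which an element
of `L` is split off. -/
def chainsCo (k : ℕ) : Chains L (k + 1) →ₗ[ℂ] L ⊗[ℂ] Chains L k :=
  DirectSum.toModule ℂ _ _ fun pq =>
    diffX pq.1.1 pq.1.2 k (Finset.HasAntidiagonal.mem_antidiagonal.1 pq.2) +
    diffY pq.1.1 pq.1.2 k (Finset.HasAntidiagonal.mem_antidiagonal.1 pq.2)

end Chains

/-! ## The standard complex and the Koszul complex -/

section Complex

variable (L : Type u) [AddCommGroup L] [Module ℂ L] [LieSuperalgebra L]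
variable (V : Type v) [AddCommGroup V] [Module ℂ V] [Module (Env L)ᵐᵒᵖ V]
  [IsScalarTower ℂ (Env L)ᵐᵒᵖ V]

/-- The right action `V ⊗ L → V`, `v ⊗ z ↦ v · z`, of `L` on a right `U(L)`-module. -/
def rightAct : V ⊗[ℂ] L →ₗ[ℂ] V :=
  TensorProduct.lift (LinearMap.mk₂ ℂ (fun v z => MulOpposite.op (envι L z) • v)
    (fun _ _ _ => by simp) (fun r v z => smul_comm _ _ _)
    (fun _ _ _ => by simp [add_smul]) (fun r v z => by simp))

/-- The differential `d_{k+1} : V ⊗ C_{k+1}(L) → V ⊗ C_k(L)` of the standard complex; its value on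
generators is `stdD_gen` below. -/
def stdD (k : ℕ) : V ⊗[ℂ] Chains L (k + 1) →ₗ[ℂ] V ⊗[ℂ] Chains L k :=
  LinearMap.lTensor V (chainsD L k) +
    LinearMap.rTensor _ (rightAct L V) ∘ₗ
      (TensorProduct.assoc ℂ V L (Chains L k)).symm.toLinearMap ∘ₗ
        LinearMap.lTensor V (chainsCo L k)

/-- The Koszul module `M_k = U(L) ⊗ C_k(L)`, a left `U(L)`-module through the left factor. -/
abbrev Koszul (k : ℕ) : Type u := Env L ⊗[ℂ] Chains L k

/-- The Koszul differential `∂_{k+1} : M_{k+1} → M_k`: the differential `stdD` for the right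
`U(L)`-module `U(L)`, which is linear for the left `U(L)`-module structures. -/
def koszulD (k : ℕ) : Koszul L (k + 1) →ₗ[Env L] Koszul L k :=
  { stdD L (Env L) k with
    map_smul' := by
      intro a m
      change stdD L (Env L) k (a • m) = a • stdD L (Env L) k m
      have hact : ∀ z : Env L ⊗[ℂ] (L ⊗[ℂ] Chains L k),
          LinearMap.rTensor (Chains L k) (rightAct L (Env L))
            ((TensorProduct.assoc ℂ (Env L) L (Chains L k)).symm (a • z)) =
          a • LinearMap.rTensor (Chains L k) (rightAct L (Env L))
            ((TensorProduct.assoc ℂ (Env L) L (Chains L k)).symm z) := by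
        intro z
        induction z with
        | zero => simp
        | add x y hx hy => simp only [smul_add, map_add, hx, hy]
        | tmul u w =>
          induction w with
          | zero => simp
          | add x y hx hy => simp only [TensorProduct.tmul_add, smul_add, map_add, hx, hy]
          | tmul l c => simp [rightAct, TensorProduct.smul_tmul', mul_assoc]
      induction m using TensorProduct.induction_on with
      | zero => simp
      | add x y hx hy => simp only [smul_add, map_add, hx, hy]
      | tmul u c =>
        have h := hact (u ⊗ₜ chainsCo L k c)
        simp only [TensorProduct.smul_tmul', smul_eq_mul] at h
        simp [stdD, TensorProduct.smul_tmul', h, smul_add] }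

/-- The map `C_0(L) = Λ^0(L₀) ⊗ S^0(L₁) → ℂ` identifying `C_0(L)` with `ℂ`. -/
def chainsZero : Chains L 0 →ₗ[ℂ] ℂ :=
  TensorProduct.lift ((LinearMap.mul ℂ ℂ).compl₁₂
      (exteriorPower.zeroEquiv ℂ (L0 L)).toLinearMap
      (symLift (MultilinearMap.constOfIsEmpty ℂ (fun _ : Fin 0 => L1 L) (1 : ℂ))
        (fun _ _ => rfl))) ∘ₗ
    DirectSum.component ℂ (Finset.HasAntidiagonal.antidiagonal 0)
      (fun pq => (⋀[ℂ]^pq.1.1 (L0 L)) ⊗[ℂ] (Sym[ℂ]^pq.1.2 (L1 L)))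
      ⟨(0, 0), Finset.HasAntidiagonal.mem_antidiagonal.2 rfl⟩

/-- The augmentation `∂_0 : M_0 → ℂ`, `u ⊗ 1 ↦` the constant term of `u`. -/
def koszulAug : Koszul L 0 →ₗ[Env L] TrivialModule.{w} :=
  TensorProduct.AlgebraTensorModule.lift
    (LinearMap.toSpanSingleton (Env L) (Chains L 0 →ₗ[ℂ] TrivialModule.{w})
      ((ULift.moduleEquiv (R := ℂ) (M := ℂ)).symm.toLinearMap ∘ₗ chainsZero L))

end Complex

section Formula

theorem eraseIdx_ofFn {A : Type u} {p : ℕ} (x : Fin (p + 1) → A) (s : Fin (p + 1)) :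
    (List.ofFn x).eraseIdx s = List.ofFn (s.removeNth x) := by
  apply List.ext_getElem
  · have := s.2
    simp [List.length_eraseIdx]
    omega
  · intro i h1 h2
    simp only [List.getElem_eraseIdx, List.getElem_ofFn, Fin.removeNth_apply]
    by_cases h : i < s
    · simp [h, Fin.succAbove, Fin.lt_def]
    · simp [h, Fin.succAbove, Fin.lt_def]

theorem eraseIdx_eraseIdx_of_lt {A : Type u} (X : List A) (s t : ℕ) (h : s < t) :
    (X.eraseIdx s).eraseIdx (t - 1) = (X.eraseIdx t).eraseIdx s := by
  apply List.ext_getElem?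
  intro i
  simp only [List.getElem?_eraseIdx]
  split_ifs <;> first | rfl | omega

theorem sum_succAbove {N : Type u} [AddCommMonoid N] (n : ℕ) (P : Fin (n + 2) → Fin (n + 1) → N)
    (H : Fin (n + 2) → Fin (n + 2) → N) (hP : ∀ s j, P s j = H s (s.succAbove j)) :
    ∑ s, ∑ j, P s j = ∑ s, ∑ t ∈ Finset.Ioi s, (H s t + H t s) := by
  have h1 : ∀ s, ∑ j, P s j = ∑ t ∈ Finset.Ioi s, H s t + ∑ t ∈ Finset.Iio s, H s t := by
    intro s
    simp only [hP]
    have := Fin.sum_univ_succAbove (fun t => if t = s then 0 else H s t) s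
    simp only [if_true, zero_add, Fin.succAbove_ne, if_false] at this
    rw [← this, ← Finset.sum_union]
    · rw [← Finset.sum_subset (Finset.subset_univ _)]
      · refine Finset.sum_congr rfl fun t ht => ?_
        rw [if_neg]
        rintro rfl
        simp at ht
      · intro t _ ht
        simp at ht
        rw [if_pos ht.symm]
    · rw [Finset.disjoint_left]
      intro t h1 h2
      simp at h1 h2
      exact absurd h1 (not_lt.2 h2.le)
  simp only [h1, Finset.sum_add_distrib]
  congr 1
  rw [Finset.sum_comm' (t' := Finset.univ) (s' := fun t => Finset.Ioi t)]
  simp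

variable {L : Type u} [AddCommGroup L] [Module ℂ L] [LieSuperalgebra L]

theorem gen_ofFn {p q k : ℕ} (h : p + q = k) (x : Fin p → L0 L) (y : Fin q → L1 L)
    (X : List (L0 L)) (Y : List (L1 L)) (hX : X = List.ofFn x) (hY : Y = List.ofFn y) :
    gen k X Y = incl p q k h (exteriorPower.ιMulti ℂ p x ⊗ₜ SymmetricPower.tprod ℂ y) := by
  have hp : p = X.length := by simp [hX]
  have hq : q = Y.length := by simp [hY]
  subst hp hq
  have hx : x = X.get := List.ofFn_injective (by rw [← hX, List.ofFn_get])
  have hy : y = Y.get := List.ofFn_injective (by rw [← hY, List.ofFn_get])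
  rw [gen, dif_pos h, hx, hy]

theorem gen_of_ne {k : ℕ} (X : List (L0 L)) (Y : List (L1 L)) (h : X.length + Y.length ≠ k) :
    gen k X Y = 0 := dif_neg h

theorem gen_cons_smul (k : ℕ) (r : ℂ) (z : L0 L) (X : List (L0 L)) (Y : List (L1 L)) :
    gen k (r • z :: X) Y = r • gen k (z :: X) Y := by
  by_cases h : (X.length + 1) + Y.length = k
  · rw [gen_ofFn h (Fin.cons (r • z) X.get) Y.get _ Y (by simp [List.ofFn_succ]) (by simp),
      gen_ofFn h (Fin.cons z X.get) Y.get _ Y (by simp [List.ofFn_succ]) (by simp),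
      ← extMul_ιMulti, ← extMul_ιMulti, ← TensorProduct.smul_tmul', map_smul,
      ← TensorProduct.smul_tmul', map_smul]
  · rw [gen_of_ne, gen_of_ne, smul_zero] <;> simpa using h

theorem diffXX_apply {p q k : ℕ} (h : p + q = k + 1) (x : Fin p → L0 L) (y : Fin q → L1 L) :
    diffXX p q k h (exteriorPower.ιMulti ℂ p x ⊗ₜ SymmetricPower.tprod ℂ y) =
      ∑ s : Fin p, ∑ t ∈ Finset.Ioi s, ((-1 : ℂ) ^ (s + t : ℕ)) •
        gen k (br00 (x s) (x t) :: ((List.ofFn x).eraseIdx t).eraseIdx s) (List.ofFn y) := by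
  match p, x, h with
  | 0, x, h => simp [diffXX]
  | 1, x, h => simp [diffXX]
  | p + 2, x, h =>
    have key : ∀ (s : Fin (p + 2)) (j : Fin (p + 1)),
        incl (p + 1) q k (by omega) (exteriorPower.ιMulti ℂ (p + 1)
          (Fin.cons (br00 (x s) (x (s.succAbove j))) (j.removeNth (s.removeNth x)) :
            Fin (p + 1) → L0 L) ⊗ₜ SymmetricPower.tprod ℂ y) =
          gen k (br00 (x s) (x (s.succAbove j)) ::
            ((List.ofFn x).eraseIdx s).eraseIdx j) (List.ofFn y) := by
      intro s j
      refine (gen_ofFn _ _ _ _ _ ?_ rfl).symm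
      rw [eraseIdx_ofFn, eraseIdx_ofFn, List.ofFn_cons]
    have expand : diffXX (p + 2) q k h
          (exteriorPower.ιMulti ℂ (p + 2) x ⊗ₜ SymmetricPower.tprod ℂ y) =
        ∑ s : Fin (p + 2), ∑ j : Fin (p + 1),
          (-(1 / 2 : ℂ) * ((-1) ^ (s : ℕ) * (-1) ^ (j : ℕ))) •
          gen k (br00 (x s) (x (s.succAbove j)) ::
            ((List.ofFn x).eraseIdx s).eraseIdx j) (List.ofFn y) := by
      simp only [← key]
      simp only [diffXX, LinearMap.comp_apply, LinearMap.rTensor_tmul, LinearMap.smul_apply,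
        extCo_ιMulti, map_sum, map_smul, LinearMap.lTensor_tmul, LinearEquiv.coe_coe,
        TensorProduct.tmul_sum, TensorProduct.sum_tmul, TensorProduct.tmul_smul,
        TensorProduct.assoc_symm_tmul, TensorProduct.lift.tmul, extMul_ιMulti,
        ← TensorProduct.smul_tmul', Finset.smul_sum, smul_smul, Fin.removeNth_apply]
    rw [expand, sum_succAbove p _ (fun s t => if s < t then
      ((1 / 2 : ℂ) * (-1) ^ (s + t : ℕ)) • gen k (br00 (x s) (x t) ::
            ((List.ofFn x).eraseIdx t).eraseIdx s) (List.ofFn y)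
      else (-(1 / 2 : ℂ) * (-1) ^ (s + t : ℕ)) • gen k (br00 (x s) (x t) ::
            ((List.ofFn x).eraseIdx s).eraseIdx t) (List.ofFn y))]
    · refine Finset.sum_congr rfl fun s _ => Finset.sum_congr rfl fun t ht => ?_
      rw [Finset.mem_Ioi] at ht
      rw [if_pos ht, if_neg (not_lt.2 ht.le), br00_antisymm (x t) (x s), ← neg_one_smul ℂ (br00 (x s) (x t)),
        gen_cons_smul, smul_smul, ← add_smul]
      congr 1
      rw [add_comm (t : ℕ) s]
      ring
    · intro s j
      by_cases hj : j.castSucc < s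
      · rw [Fin.succAbove_of_castSucc_lt _ _ hj, if_neg (not_lt.2 hj.le)]
        simp [pow_add]
      · have hj' := not_lt.1 hj
        have hlt : s < j.succ := lt_of_le_of_lt hj' (Fin.castSucc_lt_succ)
        rw [Fin.succAbove_of_le_castSucc _ _ hj', if_pos hlt,
          ← eraseIdx_eraseIdx_of_lt _ s _ hlt]
        simp only [Fin.val_succ, Nat.add_sub_cancel]
        congr 1
        ring

theorem diffYY_apply {p q k : ℕ} (h : p + q = k + 1) (x : Fin p → L0 L) (y : Fin q → L1 L) :
    diffYY p q k h (exteriorPower.ιMulti ℂ p x ⊗ₜ SymmetricPower.tprod ℂ y) =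
      ∑ s : Fin q, ∑ t ∈ Finset.Ioi s, (-1 : ℂ) •
        gen k (br11 (y s) (y t) :: List.ofFn x) (((List.ofFn y).eraseIdx t).eraseIdx s) := by
  match q, y, h with
  | 0, y, h => simp [diffYY]
  | 1, y, h => simp [diffYY]
  | q + 2, y, h =>
    have key : ∀ (s : Fin (q + 2)) (j : Fin (q + 1)),
        incl (p + 1) q k (by omega) (exteriorPower.ιMulti ℂ (p + 1)
          (Fin.cons (br11 (y s) (y (s.succAbove j))) x : Fin (p + 1) → L0 L) ⊗ₜ
            SymmetricPower.tprod ℂ (j.removeNth (s.removeNth y))) =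
          gen k (br11 (y s) (y (s.succAbove j)) :: List.ofFn x)
            (((List.ofFn y).eraseIdx s).eraseIdx j) := by
      intro s j
      refine (gen_ofFn _ _ _ _ _ ?_ ?_).symm
      · rw [List.ofFn_cons]
      · rw [eraseIdx_ofFn, eraseIdx_ofFn]
    have expand : diffYY p (q + 2) k h
          (exteriorPower.ιMulti ℂ p x ⊗ₜ SymmetricPower.tprod ℂ y) =
        ∑ s : Fin (q + 2), ∑ j : Fin (q + 1), (-(1 / 2 : ℂ)) •
          gen k (br11 (y s) (y (s.succAbove j)) :: List.ofFn x)
            (((List.ofFn y).eraseIdx s).eraseIdx j) := by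
      simp only [← key]
      simp only [diffYY, LinearMap.comp_apply, LinearMap.rTensor_tmul, LinearMap.smul_apply,
        symCo_tprod, map_sum, map_smul, LinearMap.lTensor_tmul, LinearEquiv.coe_coe,
        TensorProduct.tmul_sum, TensorProduct.tmul_smul,
        TensorProduct.assoc_symm_tmul, TensorProduct.lift.tmul, extMul_ιMulti,
        TensorProduct.leftComm_tmul,
        Finset.smul_sum, Fin.removeNth_apply]
    rw [expand, sum_succAbove q _ (fun s t => if s < t then
      (-(1 / 2 : ℂ)) • gen k (br11 (y s) (y t) :: List.ofFn x)
            (((List.ofFn y).eraseIdx t).eraseIdx s)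
      else (-(1 / 2 : ℂ)) • gen k (br11 (y s) (y t) :: List.ofFn x)
            (((List.ofFn y).eraseIdx s).eraseIdx t))]
    · refine Finset.sum_congr rfl fun s _ => Finset.sum_congr rfl fun t ht => ?_
      rw [Finset.mem_Ioi] at ht
      rw [if_pos ht, if_neg (not_lt.2 ht.le), br11_symm (y t) (y s), ← add_smul]
      congr 1
      ring
    · intro s j
      by_cases hj : j.castSucc < s
      · rw [Fin.succAbove_of_castSucc_lt _ _ hj, if_neg (not_lt.2 hj.le)]
        simp
      · have hj' := not_lt.1 hj
        have hlt : s < j.succ := lt_of_le_of_lt hj' (Fin.castSucc_lt_succ)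
        rw [Fin.succAbove_of_le_castSucc _ _ hj', if_pos hlt,
          ← eraseIdx_eraseIdx_of_lt _ s _ hlt]
        simp only [Fin.val_succ, Nat.add_sub_cancel]

theorem diffXY_apply {p q k : ℕ} (h : p + q = k + 1) (x : Fin p → L0 L) (y : Fin q → L1 L) :
    diffXY p q k h (exteriorPower.ιMulti ℂ p x ⊗ₜ SymmetricPower.tprod ℂ y) =
      ∑ s : Fin p, ∑ t : Fin q, ((-1 : ℂ) ^ (s + 1 : ℕ)) •
        gen k ((List.ofFn x).eraseIdx s) (br01 (x s) (y t) :: (List.ofFn y).eraseIdx t) := by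
  match p, q, x, y, h with
  | 0, q, x, y, h => simp [diffXY]
  | p + 1, 0, x, y, h => simp [diffXY]
  | p + 1, q + 1, x, y, h =>
    have key : ∀ (s : Fin (p + 1)) (t : Fin (q + 1)),
        incl p (q + 1) k (by omega) (exteriorPower.ιMulti ℂ p (s.removeNth x) ⊗ₜ
            SymmetricPower.tprod ℂ (Fin.cons (br01 (x s) (y t)) (t.removeNth y) :
              Fin (q + 1) → L1 L)) =
          gen k ((List.ofFn x).eraseIdx s) (br01 (x s) (y t) :: (List.ofFn y).eraseIdx t) := by
      intro s t
      refine (gen_ofFn _ _ _ _ _ ?_ ?_).symm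
      · rw [eraseIdx_ofFn]
      · rw [eraseIdx_ofFn, List.ofFn_cons]
    simp only [← key]
    simp only [diffXY, symAct, LinearMap.comp_apply, LinearMap.rTensor_tmul, LinearMap.smul_apply,
        symCo_tprod, extCo_ιMulti, map_sum, map_smul, LinearMap.lTensor_tmul, LinearEquiv.coe_coe,
        TensorProduct.tmul_sum, TensorProduct.sum_tmul, TensorProduct.assoc_tmul,
        TensorProduct.assoc_symm_tmul, TensorProduct.lift.tmul, symMul_tprod,
        TensorProduct.leftComm_tmul, ← TensorProduct.smul_tmul', smul_smul,
        Finset.smul_sum, pow_succ']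

theorem diffX_apply {p q k : ℕ} (h : p + q = k + 1) (x : Fin p → L0 L) (y : Fin q → L1 L) :
    diffX p q k h (exteriorPower.ιMulti ℂ p x ⊗ₜ SymmetricPower.tprod ℂ y) =
      ∑ s : Fin p, ((-1 : ℂ) ^ (s : ℕ)) •
        ((x s : L) ⊗ₜ[ℂ] gen k ((List.ofFn x).eraseIdx s) (List.ofFn y)) := by
  match p, x, h with
  | 0, x, h => simp [diffX]
  | p + 1, x, h =>
    have key : ∀ s : Fin (p + 1),
        incl p q k (by omega) (exteriorPower.ιMulti ℂ p (s.removeNth x) ⊗ₜ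
            SymmetricPower.tprod ℂ y) = gen k ((List.ofFn x).eraseIdx s) (List.ofFn y) := by
      intro s
      exact (gen_ofFn _ _ _ _ _ (eraseIdx_ofFn x s) rfl).symm
    simp only [← key]
    simp only [diffX, LinearMap.comp_apply, LinearMap.rTensor_tmul, extCo_ιMulti, map_sum,
      map_smul, LinearEquiv.coe_coe, TensorProduct.sum_tmul, TensorProduct.assoc_tmul,
      ← TensorProduct.smul_tmul', TensorProduct.map_tmul, Submodule.subtype_apply]

theorem diffY_apply {p q k : ℕ} (h : p + q = k + 1) (x : Fin p → L0 L) (y : Fin q → L1 L) :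
    diffY p q k h (exteriorPower.ιMulti ℂ p x ⊗ₜ SymmetricPower.tprod ℂ y) =
      ((-1 : ℂ) ^ p) • ∑ t : Fin q,
        ((y t : L) ⊗ₜ[ℂ] gen k (List.ofFn x) ((List.ofFn y).eraseIdx t)) := by
  match q, y, h with
  | 0, y, h => simp [diffY]
  | q + 1, y, h =>
    have key : ∀ t : Fin (q + 1),
        incl p q k (by omega) (exteriorPower.ιMulti ℂ p x ⊗ₜ
            SymmetricPower.tprod ℂ (t.removeNth y)) =
          gen k (List.ofFn x) ((List.ofFn y).eraseIdx t) := by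
      intro t
      exact (gen_ofFn _ _ _ _ _ rfl (eraseIdx_ofFn y t)).symm
    simp only [← key]
    simp only [diffY, LinearMap.comp_apply, LinearMap.smul_apply, LinearMap.lTensor_tmul,
      symCo_tprod, map_sum, LinearEquiv.coe_coe, TensorProduct.tmul_sum,
      TensorProduct.leftComm_tmul, TensorProduct.map_tmul, Submodule.subtype_apply]

theorem chainsD_incl {p q k : ℕ} (h : p + q = k + 1)
    (z : (⋀[ℂ]^p (L0 L)) ⊗[ℂ] (Sym[ℂ]^q (L1 L))) :
    chainsD L k (incl p q (k + 1) h z) =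
      diffXX p q k h z + diffXY p q k h z + diffYY p q k h z := by
  rw [chainsD, incl, DirectSum.toModule_lof]
  rfl

theorem chainsCo_incl {p q k : ℕ} (h : p + q = k + 1)
    (z : (⋀[ℂ]^p (L0 L)) ⊗[ℂ] (Sym[ℂ]^q (L1 L))) :
    chainsCo L k (incl p q (k + 1) h z) = diffX p q k h z + diffY p q k h z := by
  rw [chainsCo, incl, DirectSum.toModule_lof]
  rfl

variable (V : Type v) [AddCommGroup V] [Module ℂ V] [Module (Env L)ᵐᵒᵖ V]
  [IsScalarTower ℂ (Env L)ᵐᵒᵖ V]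

/-- The value of the differential on generators. The lists are `X = [x_1, …, x_p]`,
`Y = [y_1, …, y_q]`; indices start at `0`, so that `(-1)^s` below is `(-1)^(s+1)` in the usual
numbering. -/
theorem stdD_gen (k : ℕ) (v : V) (X : List (L0 L)) (Y : List (L1 L))
    (h : X.length + Y.length = k + 1) :
    stdD L V k (v ⊗ₜ gen (k + 1) X Y) =
      (∑ s : Fin X.length, ∑ t ∈ Finset.Ioi s, ((-1 : ℂ) ^ (s + t : ℕ)) •
        (v ⊗ₜ[ℂ] gen k (br00 X[s] X[t] :: (X.eraseIdx t).eraseIdx s) Y)) +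
      (∑ s : Fin X.length, ∑ t : Fin Y.length, ((-1 : ℂ) ^ (s + 1 : ℕ)) •
        (v ⊗ₜ[ℂ] gen k (X.eraseIdx s) (br01 X[s] Y[t] :: Y.eraseIdx t))) -
      (∑ s : Fin Y.length, ∑ t ∈ Finset.Ioi s,
        v ⊗ₜ[ℂ] gen k (br11 Y[s] Y[t] :: X) ((Y.eraseIdx t).eraseIdx s)) +
      (∑ s : Fin X.length, ((-1 : ℂ) ^ (s : ℕ)) •
        ((MulOpposite.op (envι L X[s]) • v) ⊗ₜ[ℂ] gen k (X.eraseIdx s) Y)) +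
      ((-1 : ℂ) ^ X.length) • (∑ t : Fin Y.length,
        (MulOpposite.op (envι L Y[t]) • v) ⊗ₜ[ℂ] gen k X (Y.eraseIdx t)) := by
  have hD : chainsD L k (gen (k + 1) X Y) =
      diffXX _ _ k h (exteriorPower.ιMulti ℂ _ X.get ⊗ₜ SymmetricPower.tprod ℂ Y.get) +
      diffXY _ _ k h (exteriorPower.ιMulti ℂ _ X.get ⊗ₜ SymmetricPower.tprod ℂ Y.get) +
      diffYY _ _ k h (exteriorPower.ιMulti ℂ _ X.get ⊗ₜ SymmetricPower.tprod ℂ Y.get) := by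
    rw [gen, dif_pos h, chainsD_incl]
  have hC : chainsCo L k (gen (k + 1) X Y) =
      diffX _ _ k h (exteriorPower.ιMulti ℂ _ X.get ⊗ₜ SymmetricPower.tprod ℂ Y.get) +
      diffY _ _ k h (exteriorPower.ιMulti ℂ _ X.get ⊗ₜ SymmetricPower.tprod ℂ Y.get) := by
    rw [gen, dif_pos h, chainsCo_incl]
  rw [diffXX_apply h X.get Y.get, diffXY_apply h X.get Y.get, diffYY_apply h X.get Y.get] at hD
  rw [diffX_apply h X.get Y.get, diffY_apply h X.get Y.get] at hC
  simp only [List.ofFn_get] at hD hC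
  simp only [stdD, LinearMap.add_apply, LinearMap.comp_apply, LinearMap.lTensor_tmul, hD, hC,
    TensorProduct.tmul_add, TensorProduct.tmul_sum, TensorProduct.tmul_smul, map_add, map_sum,
    map_smul, LinearEquiv.coe_coe, TensorProduct.assoc_symm_tmul, LinearMap.rTensor_tmul,
    rightAct, TensorProduct.lift.tmul, LinearMap.mk₂_apply, neg_one_smul,
    Finset.sum_neg_distrib, List.get_eq_getElem, Fin.getElem_fin, sub_eq_add_neg]
  abel

end Formula

/-! ## Tensor products over `U(L)`, Tor, and homology -/

section Tor

open CategoryTheory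
open scoped ModuleCat

variable (A : Type u) [Ring A] [Algebra ℂ A]
variable (V : Type v) [AddCommGroup V] [Module ℂ V] [Module Aᵐᵒᵖ V] [IsScalarTower ℂ Aᵐᵒᵖ V]

section Balanced

variable (N : Type w) [AddCommGroup N] [Module ℂ N] [Module A N] [IsScalarTower ℂ A N]

/-- The subspace of `V ⊗_ℂ N` spanned by the elements `(v a) ⊗ n - v ⊗ (a n)`. -/
def balancedSub : Submodule ℂ (V ⊗[ℂ] N) :=
  Submodule.span ℂ
    {z | ∃ (v : V) (a : A) (n : N), z = (MulOpposite.op a • v) ⊗ₜ[ℂ] n - v ⊗ₜ[ℂ] (a • n)}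

/-- The tensor product `V ⊗_A N` of a right module and a left module over a `ℂ`-algebra `A`. -/
abbrev BalancedTensor : Type (max v w) := (V ⊗[ℂ] N) ⧸ balancedSub A V N

variable {N} {N' : Type w} [AddCommGroup N'] [Module ℂ N'] [Module A N'] [IsScalarTower ℂ A N']

/-- The map `1_V ⊗_A f : V ⊗_A N → V ⊗_A N'`. -/
def balancedMap (f : N →ₗ[A] N') : BalancedTensor A V N →ₗ[ℂ] BalancedTensor A V N' :=
  Submodule.mapQ _ _ (LinearMap.lTensor V (f.restrictScalars ℂ)) (by
    rw [balancedSub, Submodule.span_le]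
    rintro _ ⟨v, a, n, rfl⟩
    exact Submodule.subset_span ⟨v, a, f n, by simp⟩)

end Balanced

/-- The functor `V ⊗_A -` from left `A`-modules to complex vector spaces. -/
def tensorFunctor : ModuleCat.{w} A ⥤ ModuleCat.{max v w} ℂ where
  obj N := ModuleCat.of ℂ (BalancedTensor A V N)
  map f := ModuleCat.ofHom (balancedMap A V f.hom)
  map_id N := by
    ext x
    simp [balancedMap]
  map_comp f g := by
    ext x
    simp [balancedMap]

instance : (tensorFunctor.{u, v, w} A V).Additive where
  map_add {N N' f g} := by
    refine ModuleCat.hom_ext ?_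
    change balancedMap A V (f.hom + g.hom) = balancedMap A V f.hom + balancedMap A V g.hom
    refine Submodule.linearMap_qext _ ?_
    ext v n
    simp [balancedMap]

/-- `Tor_k^A(V, N)`: the `k`-th left derived functor of `V ⊗_A -`, evaluated at `N`. -/
def TorOver [Small.{w} A] (k : ℕ) (N : ModuleCat.{w} A) : ModuleCat.{max v w} ℂ :=
  ((tensorFunctor.{u, v, w} A V).leftDerived k).obj N

end Tor

section Homology

open CategoryTheory

variable (L : Type u) [AddCommGroup L] [Module ℂ L] [LieSuperalgebra L]
variable (V : Type v) [AddCommGroup V] [Module ℂ V] [Module (Env L)ᵐᵒᵖ V]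
  [IsScalarTower ℂ (Env L)ᵐᵒᵖ V]

/-- The homology `H_k(L, V) = Tor_k^{U(L)}(V, ℂ)` of `L` with coefficients in a right
`U(L)`-module `V`. -/
abbrev superHomology (k : ℕ) : ModuleCat.{max u v} ℂ :=
  TorOver.{u, v, max u v} (Env L) V k (ModuleCat.of (Env L) TrivialModule.{max u v})

/-- The cycles of degree `k` of the standard complex `V ⊗ C_•(L)`. -/
def stdCycles : ∀ k : ℕ, Submodule ℂ (V ⊗[ℂ] Chains L k)
  | 0 => ⊤
  | k + 1 => LinearMap.ker (stdD L V k)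

/-- The boundaries of degree `k` of the standard complex, as a subspace of the cycles. -/
def stdBoundaries (k : ℕ) : Submodule ℂ (stdCycles L V k) :=
  (LinearMap.range (stdD L V k)).submoduleOf (stdCycles L V k)

/-- The `k`-th homology space (cycles modulo boundaries) of the standard complex. -/
abbrev StdHomology (k : ℕ) : Type (max u v) := stdCycles L V k ⧸ stdBoundaries L V k

end Homology

end LieSuperalgebra
end

open LieSuperalgebra

noncomputable section

/-! On the total space U ⊗ Λ(L₀) ⊗ S(L₁) the differential D obeys a Cartan calculus. Let e_x and e_y
be multiplication of chains by x ∈ L₀ and y ∈ L₁. Then D e_x + e_x D = θ_x and D e_y - e_y D = θ_y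
(`kD_kWedge`, `kD_kOdd`), where θ combines right multiplication on U with minus the adjoint action
on chains. Every element is obtained from elements u ⊗ 1 by operators e_x and e_y, so an operator is
determined by its values there and its commutation relations with these multiplications. The Jacobi
identity gives the relations among the θ, from which D commutes with θ_x and anticommutes with θ_y,
and then D² = 0 (`kD_kD`).

Exactness comes from a homotopy. Let g : U → L be linear, with g = id on L, g(1) = 0, and g
compatible with parity. Writing the coproduct of u as ∑ u' ⊗ u'', put h(u ⊗ c) = ∑ u' ⊗ g(u'')c.
Filter the total space by counting elements of L in both factors. Commuting h with θ gives an
operator of the same kind for another g, whose leading term is multiplication by g(1). Hence Dh + hD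
is multiplication by n in filtration degree n, up to lower degree (`eulerOp_sub`), as for the Euler
operator on the classical Koszul complex. Since n is invertible for n > 0, induction on n turns a
cycle into a multiple of 1 ⊗ 1 plus a boundary (`exists_of_kD_eq_zero`); splitting by chain degree
gives the exact sequences.

The map g is the only point where a form of the Poincaré–Birkhoff–Witt theorem is needed, and only
the weak one that L splits off U (`exists_retraction`). It is proved by a dual diamond lemma: a
function prescribed on ordered words in a homogeneous basis extends to all words compatibly with the
relations of U (`defect_straighten`). U acts on compatible functions by appending letters;
evaluation at the empty word gives the retraction.

Finally V ⊗_U (U ⊗ C) = V ⊗ C carries the Koszul differential to the standard one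
(`balancedEquiv_balancedMap`), so a free resolution of ℂ computes Tor by the standard complex. -/

namespace LieSuperalgebra

/-! ## Straightening of words in a homogeneous basis -/

section Words

variable {I : Type*} [LinearOrder I]

/-- The number of inversions of a word. -/
def inversions : List I → ℕ
  | [] => 0
  | a :: l => l.countP (· < a) + inversions l

/-- Only the exchanged pair changes its relative order. This is the measure for the termination of
the straightening and for the inner induction in `defect_straighten`. -/
theorem inversions_swap (u : List I) {i j : I} (v : List I) (h : j < i) :
    inversions (u ++ i :: j :: v) = inversions (u ++ j :: i :: v) + 1 := by
  induction u with
  | nil =>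
    simp only [List.nil_append, inversions, List.countP_cons, h, not_lt.2 h.le, decide_true,
      decide_false, if_true]
    simp
    omega
  | cons a u ih =>
    have hp : (u ++ i :: j :: v).countP (· < a) = (u ++ j :: i :: v).countP (· < a) :=
      List.Perm.countP_eq _ (List.Perm.append_left _ (List.Perm.swap _ _ _))
    simp only [List.cons_append, inversions, ih, hp]
    omega

end Words

/-! ### The commutation factor. -/

section Signs

theorem superSign_comm (a b : ZMod 2) : superSign a b = superSign b a := by
  rw [superSign, superSign, mul_comm]

theorem superSign_mul_self (a b : ZMod 2) : superSign a b * superSign a b = 1 := by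
  rw [superSign, ← mul_pow]
  simp

theorem superSign_add_left (a b c : ZMod 2) :
    superSign (a + b) c = superSign a c * superSign b c := by
  have h : ∀ a b c : ZMod 2, (-1 : ℤ) ^ ((a + b).val * c.val) =
      (-1) ^ (a.val * c.val) * (-1) ^ (b.val * c.val) := by decide
  simp only [superSign]
  exact_mod_cast congrArg (Int.cast : ℤ → ℂ) (h a b c)

theorem superSign_one_one : superSign 1 1 = -1 := by simp [superSign, ZMod.val_one]

end Signs

/-! ### A diamond lemma for functions on words. -/

section Straightening

variable {L : Type u} [AddCommGroup L] [Module ℂ L]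
variable {I : Type*} (b : Module.Basis I ℂ L) (p : I → ZMod 2)
variable {N : Type*} [AddCommGroup N] [Module ℂ N]

/-- The value at `u x v` of the multilinear extension of a function on words, `x ∈ L`. -/
def insertAt (f : List I → N) (u v : List I) : L →ₗ[ℂ] N :=
  b.constr ℂ fun k => f (u ++ k :: v)

@[simp]
theorem insertAt_basis (f : List I → N) (u v : List I) (k : I) :
    insertAt b f u v (b k) = f (u ++ k :: v) := by
  simp [insertAt]

/-- The action of `L` on functions on words by appending letters. -/
def appendOp : L →ₗ[ℂ] (List I → N) →ₗ[ℂ] (List I → N) :=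
  b.constr ℂ fun i => LinearMap.funLeft ℂ N fun w => w ++ [i]

theorem appendOp_basis (i : I) (f : List I → N) (w : List I) :
    appendOp b (b i) f w = f (w ++ [i]) := by
  simp [appendOp, LinearMap.funLeft_apply]

variable [LieSuperalgebra L]

/-- The amount by which a function on words fails to be compatible with exchanging the letters
`i` and `j` in the word `u i j v`. -/
def defect (f : List I → N) (u : List I) (i j : I) (v : List I) : N :=
  f (u ++ i :: j :: v) - superSign (p i) (p j) • f (u ++ j :: i :: v) -
    insertAt b f u v (sbracket (b i) (b j))

/-- Super-antisymmetry of the bracket, with the sign squaring to 1. Hence a pair of letters has to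
be checked in one order only. -/
theorem defect_antisymm (hb : ∀ i, b i ∈ part (L := L) (p i)) (f : List I → N) (u : List I)
    (i j : I) (v : List I) :
    defect b p f u j i v = -(superSign (p i) (p j) • defect b p f u i j v) := by
  have h := sbracket_antisymm _ _ _ (hb j) _ (hb i)
  have hs := superSign_mul_self (p i) (p j)
  rw [superSign_comm (p j)] at h
  simp only [defect, h, map_neg, map_smul, superSign_comm (p j) (p i), smul_sub, smul_smul, hs]
  module

/-- Induction over the homogeneous component of parity `a`. -/
theorem part_induction (hb : ∀ i, b i ∈ part (L := L) (p i)) (a : ZMod 2) {P : L → Prop}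
    (h0 : P 0) (hadd : ∀ x y, P x → P y → P (x + y)) (hsmul : ∀ (r : ℂ) x, P x → P (r • x))
    (hbasis : ∀ i, p i = a → P (b i)) (x : L) (hx : x ∈ part (L := L) a) : P x := by
  classical
  have hindep := (isInternal (L := L)).submodule_iSupIndep
  have hS : ∀ y : L, y ∈ Submodule.span ℂ (b '' {i | p i = a}) → P y := by
    intro y hy
    induction hy using Submodule.span_induction with
    | mem y hy => obtain ⟨i, hi, rfl⟩ := hy; exact hbasis i hi
    | zero => exact h0
    | add y z _ _ h1 h2 => exact hadd _ _ h1 h2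
    | smul r y _ h => exact hsmul _ _ h
  apply hS
  -- Split x into a part y on basis vectors of parity a and a part z on the others. Then z lies both
  -- in the component a and in the sum of the other components, so it vanishes by independence.
  have htop : x ∈ Submodule.span ℂ (b '' {i | p i = a}) ⊔ Submodule.span ℂ (b '' {i | p i ≠ a}) := by
    rw [← Submodule.span_union, ← Set.image_union]
    have : {i | p i = a} ∪ {i | p i ≠ a} = Set.univ := by ext i; simp [em]
    rw [this, Set.image_univ, b.span_eq]
    trivial
  obtain ⟨y, hy, z, hz, hyz⟩ := Submodule.mem_sup.1 htop
  have hya : y ∈ part (L := L) a := by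
    refine Submodule.span_le.2 ?_ hy
    rintro _ ⟨i, hi, rfl⟩
    rw [← Set.mem_ofPred.1 hi]
    exact hb i
  have hza : z ∈ ⨆ (c : ZMod 2) (_ : c ≠ a), part (L := L) c := by
    refine Submodule.span_le.2 ?_ hz
    rintro _ ⟨i, hi, rfl⟩
    exact Submodule.mem_iSup_of_mem (p i) (Submodule.mem_iSup_of_mem hi (hb i))
  have hz' : z ∈ part (L := L) a := by
    have : z = x - y := by rw [← hyz]; abel
    rw [this]
    exact sub_mem hx hya
  have hz0 : z = 0 := Submodule.disjoint_def.1 (hindep a) z hz' hza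
  rw [← hyz, hz0, add_zero]
  exact hy

variable {b p}

/-- Both sides are linear in x on a homogeneous component, and for a basis letter the identity is
the vanishing of the defect. It moves an inserted bracket past the letter k. -/
theorem insertAt_exchange_right (hb : ∀ i, b i ∈ part (L := L) (p i)) {f : List I → N} {u v : List I} {k : I}
    (h : ∀ i, defect b p f u i k v = 0) {a : ZMod 2} {x : L} (hx : x ∈ part (L := L) a) :
    insertAt b f u (k :: v) x =
      superSign a (p k) • insertAt b f (u ++ [k]) v x + insertAt b f u v (sbracket x (b k)) := by
  refine part_induction b p hb a (P := fun x => insertAt b f u (k :: v) x =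
      superSign a (p k) • insertAt b f (u ++ [k]) v x + insertAt b f u v (sbracket x (b k)))
    (by simp) ?_ ?_ ?_ x hx
  · intro x y hx hy
    simp only [map_add, LinearMap.add_apply, hx, hy]
    module
  · intro r x hx
    simp only [map_smul, LinearMap.smul_apply, hx]
    module
  · rintro i rfl
    have := h i
    rw [defect, sub_sub, sub_eq_zero] at this
    simpa using this

/-- The two ways to reverse three adjacent letters. -/
theorem defect_hexagon (hb : ∀ i, b i ∈ part (L := L) (p i)) {f : List I → N} {u v : List I}
    (h : ∀ i k, defect b p f u i k v = 0) (i j k : I) :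
    defect b p f u i j (k :: v) + superSign (p i) (p j) • defect b p f (u ++ [j]) i k v +
        (superSign (p i) (p j) * superSign (p i) (p k)) • defect b p f u j k (i :: v) =
      defect b p f (u ++ [i]) j k v + superSign (p j) (p k) • defect b p f u i k (j :: v) +
        (superSign (p j) (p k) * superSign (p i) (p k)) • defect b p f (u ++ [k]) i j v := by
  -- Along each of the two paths from ijk to kji the inserted brackets differ by moving one of them
  -- past the third letter. The resulting double brackets are all reduced to [[i,j],k] and
  -- [j,[i,k]], where Jacobi makes them cancel.
  have e1 := insertAt_exchange_right hb (h · k) (sbracket_mem _ _ _ (hb i) _ (hb j))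
  have e2 := insertAt_exchange_right hb (h · j) (sbracket_mem _ _ _ (hb i) _ (hb k))
  have e3 := insertAt_exchange_right hb (h · i) (sbracket_mem _ _ _ (hb j) _ (hb k))
  have jac := sbracket_jacobi _ _ _ (hb i) _ (hb j) (b k)
  have a1 := sbracket_antisymm _ _ _ (sbracket_mem _ _ _ (hb j) _ (hb k)) _ (hb i)
  have a2 := sbracket_antisymm _ _ _ (sbracket_mem _ _ _ (hb i) _ (hb k)) _ (hb j)
  rw [a1, jac] at e3
  rw [a2] at e2
  simp only [defect, e1, e2, e3, superSign_add_left, superSign_comm (p j) (p i),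
    superSign_comm (p k) (p i), superSign_comm (p k) (p j), List.append_assoc, List.cons_append,
    List.nil_append, map_add, map_neg, map_smul]
  -- The signs enter through their squares; once each is fixed as 1 or -1 the identity is linear
  -- with numerical coefficients.
  rcases mul_self_eq_one_iff.1 (superSign_mul_self (p i) (p j)) with h1 | h1 <;>
  rcases mul_self_eq_one_iff.1 (superSign_mul_self (p i) (p k)) with h2 | h2 <;>
  rcases mul_self_eq_one_iff.1 (superSign_mul_self (p j) (p k)) with h3 | h3 <;>
  · simp only [h1, h2, h3]
    module

/-- Exchanges at two disjoint places of a word commute. -/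
theorem defect_square {f : List I → N} {u a v : List I} {i j k l : I}
    (h1 : ∀ t, defect b p f (u ++ t :: a) k l v = 0)
    (h2 : ∀ t, defect b p f u i j (a ++ t :: v) = 0) :
    defect b p f u i j (a ++ k :: l :: v) +
        superSign (p i) (p j) • defect b p f (u ++ j :: i :: a) k l v =
      defect b p f (u ++ i :: j :: a) k l v +
        superSign (p k) (p l) • defect b p f u i j (a ++ l :: k :: v) := by
  have e1 : ∀ x : L, insertAt b f u (a ++ k :: l :: v) x -
      superSign (p k) (p l) • insertAt b f u (a ++ l :: k :: v) x =
      b.constr ℂ (fun t => insertAt b f (u ++ t :: a) v (sbracket (b k) (b l))) x := by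
    intro x
    refine LinearMap.congr_fun (f := insertAt b f u (a ++ k :: l :: v) -
      superSign (p k) (p l) • insertAt b f u (a ++ l :: k :: v)) (b.ext fun t => ?_) x
    have := h1 t
    rw [defect, sub_eq_zero] at this
    simpa using this
  have e2 : ∀ x : L, insertAt b f (u ++ i :: j :: a) v x -
      superSign (p i) (p j) • insertAt b f (u ++ j :: i :: a) v x =
      b.constr ℂ (fun t => insertAt b f u (a ++ t :: v) (sbracket (b i) (b j))) x := by
    intro x
    refine LinearMap.congr_fun (f := insertAt b f (u ++ i :: j :: a) v -
      superSign (p i) (p j) • insertAt b f (u ++ j :: i :: a) v) (b.ext fun t => ?_) x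
    have := h2 t
    rw [defect, sub_eq_zero] at this
    simpa using this
  -- Inserting both brackets [i,j] and [k,l] is a double sum, independent of the order of insertion;
  -- the remaining terms of the two paths agree formally.
  have e3 : b.constr ℂ (fun t => insertAt b f (u ++ t :: a) v (sbracket (b k) (b l)))
        (sbracket (b i) (b j)) =
      b.constr ℂ (fun t => insertAt b f u (a ++ t :: v) (sbracket (b i) (b j)))
        (sbracket (b k) (b l)) := by
    simp only [insertAt, Module.Basis.constr_apply, Finsupp.sum, Finset.smul_sum,
      List.append_assoc, List.cons_append]
    rw [Finset.sum_comm]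
    exact Finset.sum_congr rfl fun _ _ => Finset.sum_congr rfl fun _ _ => smul_comm _ _ _
  have e4 := (e1 _).trans (e3.trans (e2 _).symm)
  simp only [defect, List.append_assoc, List.cons_append]
  rw [sub_eq_iff_eq_add] at e4
  rw [e4]
  module

variable [LinearOrder I]

variable (b p) in
/-- Adjacent letters which are out of order. -/
def OutOfOrder (i j : I) : Prop := j < i ∨ (i = j ∧ p i = 1)

variable (b p) in
open Classical in
/-- The value of a word is computed by exchanging adjacent letters that are out of order; ordered
words have prescribed values. -/
def straighten (n : List I → N) (w : List I) : N :=
  if h : ∃ q : List I × I × I × List I,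
      w = q.1 ++ q.2.1 :: q.2.2.1 :: q.2.2.2 ∧ OutOfOrder p q.2.1 q.2.2.1 then
    -- Equal out-of-order letters are odd, and the relation becomes 2xx = [x,x]; this is the factor
    -- 1/2.
    if h.choose.2.1 = h.choose.2.2.1 then
      (1 / 2 : ℂ) • (b.repr (sbracket (b h.choose.2.1) (b h.choose.2.2.1))).sum
        fun k a => a • straighten n (h.choose.1 ++ k :: h.choose.2.2.2)
    else
      superSign (p h.choose.2.1) (p h.choose.2.2.1) •
          straighten n (h.choose.1 ++ h.choose.2.2.1 :: h.choose.2.1 :: h.choose.2.2.2) +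
        (b.repr (sbracket (b h.choose.2.1) (b h.choose.2.2.1))).sum
          fun k a => a • straighten n (h.choose.1 ++ k :: h.choose.2.2.2)
  else n w
termination_by (w.length, inversions w)
decreasing_by
  · apply Prod.Lex.left
    conv_rhs => rw [h.choose_spec.1]
    simp
  -- Only the exchange of distinct letters keeps the length of the word, and it removes one
  -- inversion.
  · rename_i h4
    obtain ⟨h1, h2⟩ := h.choose_spec
    rw [Prod.lex_def]
    refine Or.inr ⟨?_, ?_⟩
    · conv_rhs => rw [h1]
      simp
    · conv_rhs => rw [h1]
      rw [inversions_swap _ _ (h2.resolve_right fun h' => h4 h'.1)]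
      exact Nat.lt_succ_self _
  · apply Prod.Lex.left
    conv_rhs => rw [h.choose_spec.1]
    simp

variable (b p) in
theorem straighten_of_sorted (n : List I → N) (w : List I)
    (h : ¬ ∃ q : List I × I × I × List I,
      w = q.1 ++ q.2.1 :: q.2.2.1 :: q.2.2.2 ∧ OutOfOrder p q.2.1 q.2.2.1) :
    straighten b p n w = n w := by
  rw [straighten, dif_neg h]

-- The relation holds by construction at the position chosen by `straighten`. That position is not
-- under control, which is why only its existence is asserted.
variable (b p) in
theorem exists_defect_straighten (n : List I → N) (u : List I) (i j : I) (v : List I)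
    (hij : OutOfOrder p i j) :
    ∃ u' i' j' v', u ++ i :: j :: v = u' ++ i' :: j' :: v' ∧ OutOfOrder p i' j' ∧
      defect b p (straighten b p n) u' i' j' v' = 0 := by
  have h : ∃ q : List I × I × I × List I,
      u ++ i :: j :: v = q.1 ++ q.2.1 :: q.2.2.1 :: q.2.2.2 ∧ OutOfOrder p q.2.1 q.2.2.1 :=
    ⟨(u, i, j, v), rfl, hij⟩
  obtain ⟨h1, h2⟩ := h.choose_spec
  refine ⟨h.choose.1, h.choose.2.1, h.choose.2.2.1, h.choose.2.2.2, h1, h2, ?_⟩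
  have h3 := straighten.eq_1 b p n (u ++ i :: j :: v)
  rw [dif_pos h] at h3
  rw [defect, ← h1, insertAt, Module.Basis.constr_apply]
  by_cases h4 : h.choose.2.1 = h.choose.2.2.1
  · have h5 : p h.choose.2.1 = 1 := (h2.resolve_left (by rw [h4]; exact lt_irrefl _)).2
    have h6 : superSign (p h.choose.2.1) (p h.choose.2.2.1) = -1 := by
      rw [← h4, h5, superSign_one_one]
    rw [h6]
    have h7 : straighten b p n (h.choose.1 ++ h.choose.2.2.1 :: h.choose.2.1 :: h.choose.2.2.2) =
        straighten b p n (u ++ i :: j :: v) := by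
      conv_rhs => rw [h1]
      rw [h4]
    rw [h7, h3, if_pos h4]
    module
  · rw [h3, if_neg h4]
    module

theorem OutOfOrder.superSign_eq {i j : I} (h : OutOfOrder p i j) :
    j < i ∨ (i = j ∧ superSign (p i) (p j) = -1) := by
  rcases h with h | ⟨rfl, h⟩
  · exact Or.inl h
  · exact Or.inr ⟨rfl, by rw [h, superSign_one_one]⟩

/-- In the hexagon for ijk all defects other than the two compared belong to words with fewer
inversions and vanish, up to coincidences when letters repeat. In each case a nonzero multiple of
one remaining defect equals a nonzero multiple of the other. -/
theorem defect_overlap (hb : ∀ i, b i ∈ part (L := L) (p i)) {f : List I → N} {u v : List I}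
    {i j k : I} (hij : OutOfOrder p i j) (hjk : OutOfOrder p j k)
    (hlen : ∀ i k, defect b p f u i k v = 0)
    (hinv : ∀ u' i' j' v', (u' ++ i' :: j' :: v').length = (u ++ i :: j :: k :: v).length →
      inversions (u' ++ i' :: j' :: v') < inversions (u ++ i :: j :: k :: v) →
      inversions (u' ++ j' :: i' :: v') < inversions (u ++ i :: j :: k :: v) →
      defect b p f u' i' j' v' = 0) :
    defect b p f u i j (k :: v) = 0 ↔ defect b p f (u ++ [i]) j k v = 0 := by
  have hex := defect_hexagon hb hlen i j k
  have sw1 : ∀ a c d : I, c < a → inversions (u ++ a :: c :: d :: v) =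
      inversions (u ++ c :: a :: d :: v) + 1 := fun a c d h => inversions_swap u (d :: v) h
  have sw2 : ∀ a c d : I, d < c → inversions (u ++ a :: c :: d :: v) =
      inversions (u ++ a :: d :: c :: v) + 1 := fun a c d h => by
    simpa using inversions_swap (u ++ [a]) v h
  rcases hij.superSign_eq with h1 | ⟨rfl, h1⟩ <;> rcases hjk.superSign_eq with h2 | ⟨rfl, h2⟩
  · have h3 := h2.trans h1
    have := sw1 i j k h1
    have := sw2 j i k h3
    have := sw1 j k i h2
    have := sw2 i j k h2
    have := sw1 i k j h3
    have := sw2 k i j h1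
    rw [hinv (u ++ [j]) i k v (by simp) (by simp; omega) (by simp; omega),
      hinv u j k (i :: v) (by simp) (by omega) (by omega),
      hinv u i k (j :: v) (by simp) (by omega) (by omega),
      hinv (u ++ [k]) i j v (by simp) (by simp; omega) (by simp; omega)] at hex
    simp only [smul_zero, add_zero] at hex
    rw [hex]
  · have := sw1 i j j h1
    have := sw2 j i j h1
    rw [hinv (u ++ [j]) i j v (by simp) (by simp; omega) (by simp; omega),
      hinv u j j (i :: v) (by simp) (by omega) (by omega), h2] at hex
    -- With j = k odd, the defect at (i,j) occurs on both sides of the hexagon with opposite signs;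
    -- hence the factor 2.
    have : defect b p f (u ++ [i]) j j v = (2 : ℂ) • defect b p f u i j (j :: v) := by
      linear_combination (norm := module) (-1 : ℂ) • hex
    rw [this]
    simp
  · have := sw2 i i k h2
    have := sw1 i k i h2
    rw [hinv u i k (i :: v) (by simp) (by omega) (by omega),
      hinv (u ++ [k]) i i v (by simp) (by simp; omega) (by simp; omega), h1] at hex
    have : defect b p f u i i (k :: v) = (2 : ℂ) • defect b p f (u ++ [i]) i k v := by
      linear_combination (norm := module) (1 : ℂ) • hex
    rw [this]
    simp
  · rw [h1] at hex
    -- For three equal odd letters only two defects D and D' remain, and the hexagon reads 2D - D' =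
    -- 2D' - D, that is 3D = 3D'.
    have : defect b p f u i i (i :: v) = defect b p f (u ++ [i]) i i v := by
      linear_combination (norm := module) (1 / 3 : ℂ) • hex
    rw [this]

/-- The counterpart of `defect_overlap` for two pairs without a common letter, with the commuting
square of exchanges in place of the hexagon. -/
theorem defect_disjoint {f : List I → N} {u a v : List I}
    {i j k l : I} (hij : OutOfOrder p i j) (hkl : OutOfOrder p k l)
    (h1 : ∀ t, defect b p f (u ++ t :: a) k l v = 0)
    (h2 : ∀ t, defect b p f u i j (a ++ t :: v) = 0)
    (hinv : ∀ u' i' j' v',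
      (u' ++ i' :: j' :: v').length = (u ++ i :: j :: (a ++ k :: l :: v)).length →
      inversions (u' ++ i' :: j' :: v') < inversions (u ++ i :: j :: (a ++ k :: l :: v)) →
      inversions (u' ++ j' :: i' :: v') < inversions (u ++ i :: j :: (a ++ k :: l :: v)) →
      defect b p f u' i' j' v' = 0) :
    defect b p f u i j (a ++ k :: l :: v) = 0 ↔ defect b p f (u ++ i :: j :: a) k l v = 0 := by
  have hex := defect_square h1 h2
  have sw1 : ∀ c, j < i → inversions (u ++ i :: j :: c) = inversions (u ++ j :: i :: c) + 1 :=
    fun c h => inversions_swap u c h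
  have sw2 : ∀ c d : I, l < k → inversions (u ++ c :: d :: (a ++ k :: l :: v)) =
      inversions (u ++ c :: d :: (a ++ l :: k :: v)) + 1 := fun c d h => by
    simpa using inversions_swap (u ++ c :: d :: a) v h
  have H1 : j < i → defect b p f (u ++ j :: i :: a) k l v = 0 := fun h => by
    have e1 := sw1 (a ++ k :: l :: v) h
    have e2 := sw1 (a ++ l :: k :: v) h
    refine hinv _ _ _ _ (by simp) (by simp; omega) ?_
    rcases hkl with hkl | ⟨rfl, -⟩
    · have := sw2 i j hkl
      simp
      omega
    · simp; omega
  have H2 : l < k → defect b p f u i j (a ++ l :: k :: v) = 0 := fun h => by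
    have e1 := sw2 i j h
    have e2 := sw2 j i h
    refine hinv _ _ _ _ (by simp) (by omega) ?_
    rcases hij with hij | ⟨rfl, -⟩
    · have := sw1 (a ++ k :: l :: v) hij
      omega
    · omega
  clear h1 h2
  rcases hij.superSign_eq with h1 | ⟨rfl, h1⟩ <;> rcases hkl.superSign_eq with h2 | ⟨rfl, h2⟩
  · rw [H1 h1, H2 h2] at hex
    simp only [smul_zero, add_zero] at hex
    rw [hex]
  · rw [H1 h1, h2] at hex
    have : defect b p f (u ++ i :: j :: a) k k v =
        (2 : ℂ) • defect b p f u i j (a ++ k :: k :: v) := by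
      linear_combination (norm := module) (-1 : ℂ) • hex
    rw [this]
    simp
  · rw [H2 h2, h1] at hex
    have : defect b p f u i i (a ++ k :: l :: v) =
        (2 : ℂ) • defect b p f (u ++ i :: i :: a) k l v := by
      linear_combination (norm := module) (1 : ℂ) • hex
    rw [this]
    simp
  · rw [h1, h2] at hex
    -- Both pairs are repeated odd letters, so exchanging changes no word and the square reads D -
    -- D' = D' - D.
    have : defect b p f u i i (a ++ k :: k :: v) = defect b p f (u ++ i :: i :: a) k k v := by
      linear_combination (norm := module) (1 / 2 : ℂ) • hex
    rw [this]

/-- A pair in increasing order is handled by antisymmetry, and for equal even letters the defect is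
its own negative. The predicate Q delimits the words covered by an induction hypothesis; it is
needed on both words because antisymmetry interchanges them. -/
theorem defect_eq_zero_of_outOfOrder (hb : ∀ i, b i ∈ part (L := L) (p i)) {f : List I → N}
    {Q : List I → Prop} (hQ : ∀ u i j v, OutOfOrder p i j → Q (u ++ i :: j :: v) →
      Q (u ++ j :: i :: v) → defect b p f u i j v = 0) (u : List I) (i j : I) (v : List I)
    (h1 : Q (u ++ i :: j :: v)) (h2 : Q (u ++ j :: i :: v)) : defect b p f u i j v = 0 := by
  rcases lt_trichotomy i j with h | h | h
  · rw [defect_antisymm b p hb, hQ u j i v (Or.inl h) h2 h1, smul_zero, neg_zero]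
  · subst h
    by_cases hi : p i = 1
    · exact hQ u i i v (Or.inr ⟨rfl, hi⟩) h1 h2
    · have hi0 : p i = 0 := by
        generalize p i = a at hi
        revert hi
        revert a
        decide
      have := defect_antisymm b p hb f u i i v
      rw [hi0] at this
      simp only [superSign, ZMod.val_zero, zero_mul, pow_zero, one_smul] at this
      have h2 : (2 : ℂ) • defect b p f u i i v = 0 := by linear_combination (norm := module) (1 : ℂ) • this
      exact (smul_eq_zero.1 h2).resolve_left two_ne_zero
  · exact hQ u i j v (Or.inl h) h1 h2

/-- Every function on ordered words extends to a function on all words that is compatible with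
the relations of the enveloping algebra. -/
theorem defect_straighten (hb : ∀ i, b i ∈ part (L := L) (p i)) (n : List I → N) (u : List I)
    (i j : I) (v : List I) : defect b p (straighten b p n) u i j v = 0 := by
  suffices H : ∀ (len m : ℕ) (u : List I) (i j : I) (v : List I), OutOfOrder p i j →
      (u ++ i :: j :: v).length = len → inversions (u ++ i :: j :: v) = m →
      defect b p (straighten b p n) u i j v = 0 by
    exact defect_eq_zero_of_outOfOrder hb (Q := fun _ => True)
      (fun u i j v h _ _ => H _ _ u i j v h rfl rfl) u i j v trivial trivial
  intro len
  induction len using Nat.strong_induction_on with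
  | _ len ihlen =>
  intro m
  induction m using Nat.strong_induction_on with
  | _ m ihinv =>
  intro u i j v hij hlen hm
  -- The inductions treat out-of-order pairs only; here and in `hsmall` the hypotheses are extended
  -- to arbitrary pairs.
  have hshort : ∀ u' i' j' v', (u' ++ i' :: j' :: v').length < len →
      defect b p (straighten b p n) u' i' j' v' = 0 := fun u' i' j' v' h =>
    defect_eq_zero_of_outOfOrder hb (Q := fun w => w.length < len)
      (fun u i j v hij h1 _ => ihlen _ h1 _ u i j v hij rfl rfl)
      u' i' j' v' h (by simpa using h)
  have hsmall : ∀ u' i' j' v', (u' ++ i' :: j' :: v').length = len →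
      inversions (u' ++ i' :: j' :: v') < m → inversions (u' ++ j' :: i' :: v') < m →
      defect b p (straighten b p n) u' i' j' v' = 0 := fun u' i' j' v' h h1 h2 =>
    defect_eq_zero_of_outOfOrder hb (Q := fun w => w.length = len ∧ inversions w < m)
      (fun u i j v hij h1 _ => ihinv _ h1.2 u i j v hij h1.1 rfl)
      u' i' j' v' ⟨h, h1⟩ ⟨by simpa using h, h2⟩
  obtain ⟨u', i', j', v', hw, hij', h0⟩ := exists_defect_straighten b p n u i j v hij
  -- The relation is known at one position of the word. The given position coincides with it, shares
  -- one letter with it, or is disjoint from it; the list a is the offset of the right pair from the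
  -- left one.
  rcases List.append_eq_append_iff.1 hw with ⟨a, ha, hb'⟩ | ⟨a, ha, hb'⟩
  · match a, ha, hb' with
    | [], ha, hb' =>
      simp only [List.nil_append, List.cons.injEq] at hb'
      simp only [List.append_nil] at ha
      obtain ⟨rfl, rfl, rfl⟩ := hb'
      subst ha
      exact h0
    | [c], ha, hb' =>
      simp only [List.cons_append, List.nil_append, List.cons.injEq] at hb'
      obtain ⟨rfl, rfl, rfl⟩ := hb'
      subst ha
      refine (defect_overlap hb hij hij' ?_ ?_).2 h0
      · exact fun i k => hshort _ _ _ _ (by rw [← hlen]; simp)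
      · exact fun u i j v h1 h2 h3 => hsmall u i j v (h1.trans hlen) (hm ▸ h2) (hm ▸ h3)
    | c :: d :: a, ha, hb' =>
      simp only [List.cons_append, List.cons.injEq] at hb'
      obtain ⟨rfl, rfl, rfl⟩ := hb'
      subst ha
      refine (defect_disjoint hij hij' ?_ ?_ ?_).2 h0
      · exact fun t => hshort _ _ _ _ (by rw [← hlen]; simp)
      · exact fun t => hshort _ _ _ _ (by rw [← hlen]; simp)
      · exact fun u i j v h1 h2 h3 => hsmall u i j v (h1.trans hlen) (hm ▸ h2) (hm ▸ h3)
  · rw [hw] at hlen hm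
    match a, ha, hb' with
    | [], ha, hb' =>
      simp only [List.nil_append, List.cons.injEq] at hb'
      simp only [List.append_nil] at ha
      obtain ⟨rfl, rfl, rfl⟩ := hb'
      subst ha
      exact h0
    | [c], ha, hb' =>
      simp only [List.cons_append, List.nil_append, List.cons.injEq] at hb'
      obtain ⟨rfl, rfl, rfl⟩ := hb'
      subst ha
      refine (defect_overlap hb hij' hij ?_ ?_).1 h0
      · exact fun i k => hshort _ _ _ _ (by rw [← hlen]; simp)
      · exact fun u i j v h1 h2 h3 => hsmall u i j v (h1.trans hlen) (hm ▸ h2) (hm ▸ h3)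
    | c :: d :: a, ha, hb' =>
      simp only [List.cons_append, List.cons.injEq] at hb'
      obtain ⟨rfl, rfl, rfl⟩ := hb'
      subst ha
      refine (defect_disjoint hij' hij ?_ ?_ ?_).1 h0
      · exact fun t => hshort _ _ _ _ (by rw [← hlen]; simp)
      · exact fun t => hshort _ _ _ _ (by rw [← hlen]; simp)
      · exact fun u i j v h1 h2 h3 => hsmall u i j v (h1.trans hlen) (hm ▸ h2) (hm ▸ h3)

end Straightening

/-! ## The canonical map `L → U(L)` has a linear retraction -/

section EnvLift

variable {L : Type u} [AddCommGroup L] [Module ℂ L] [LieSuperalgebra L]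
variable {A : Type*} [Ring A] [Algebra ℂ A]

/-- The universal property of the enveloping algebra. -/
def envLift (f : L →ₗ[ℂ] A) (hf : ∀ a b : ZMod 2, ∀ x ∈ part (L := L) a, ∀ y ∈ part (L := L) b,
    f (sbracket x y) = f x * f y - superSign a b • (f y * f x)) : Env L →ₐ[ℂ] A :=
  RingQuot.liftAlgHom ℂ ⟨TensorAlgebra.lift ℂ f, by
    intro s t h
    induction h with
    | super_comm a b x y hx hy => simpa using hf a b x hx y hy⟩

@[simp]
theorem envLift_ι (f : L →ₗ[ℂ] A) (hf : ∀ a b : ZMod 2, ∀ x ∈ part (L := L) a,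
    ∀ y ∈ part (L := L) b, f (sbracket x y) = f x * f y - superSign a b • (f y * f x)) (x : L) :
    envLift f hf (envι L x) = f x := by
  refine (RingQuot.liftAlgHom_mkAlgHom_apply ℂ _ _ _).trans ?_
  simp

theorem envι_bracket {a b : ZMod 2} {x y : L} (hx : x ∈ part (L := L) a)
    (hy : y ∈ part (L := L) b) :
    envι L (sbracket x y) = envι L x * envι L y - superSign a b • (envι L y * envι L x) := by
  have h := RingQuot.mkAlgHom_rel ℂ (EnvRel.super_comm a b x y hx hy)
  rw [map_sub, map_smul, map_mul, map_mul] at h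
  exact h

variable (L) in
/-- The projection of the tensor algebra onto `U(L)`. -/
def envMk : TensorAlgebra ℂ L →ₐ[ℂ] Env L := RingQuot.mkAlgHom ℂ (EnvRel L)

variable (L) in
theorem envMk_surjective : Function.Surjective (envMk L) :=
  RingQuot.mkAlgHom_surjective ℂ (EnvRel L)

/-- Right multiplication by elements of `L` generates `U(L)`. -/
theorem env_induction {P : Env L → Prop} (h1 : P 1) (hadd : ∀ u v, P u → P v → P (u + v))
    (hsmul : ∀ (r : ℂ) u, P u → P (r • u)) (hmul : ∀ u (z : L), P u → P (u * envι L z))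
    (u : Env L) : P u := by
  -- The left factor u is arbitrary so that a product st can be absorbed one factor at a time.
  have key : ∀ t : TensorAlgebra ℂ L, ∀ u, P u → P (u * envMk L t) := by
    intro t
    induction t using TensorAlgebra.induction with
    | algebraMap r =>
      intro u hu
      rw [AlgHom.commutes, ← Algebra.commutes, ← Algebra.smul_def]
      exact hsmul r u hu
    | ι x => exact fun u hu => hmul u x hu
    | mul s t hs ht =>
      intro u hu
      rw [map_mul, ← mul_assoc]
      exact ht _ (hs _ hu)
    | add s t hs ht =>
      intro u hu
      rw [map_add, mul_add]
      exact hadd _ _ (hs _ hu) (ht _ hu)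
  obtain ⟨t, rfl⟩ := envMk_surjective L u
  simpa using key t 1 h1

end EnvLift

/-! ### The representation of U(L) on compatible functions. -/

section Retraction

variable {L : Type u} [AddCommGroup L] [Module ℂ L] [LieSuperalgebra L]
variable {I : Type*} (b : Module.Basis I ℂ L) (p : I → ZMod 2)
variable {N : Type*} [AddCommGroup N] [Module ℂ N]

/-- The functions on words that are compatible with the relations of the enveloping algebra. -/
def compatible (N : Type*) [AddCommGroup N] [Module ℂ N] : Submodule ℂ (List I → N) where
  carrier := {f | ∀ u i j v, defect b p f u i j v = 0}
  zero_mem' u i j v := by simp [defect, insertAt, Module.Basis.constr_apply]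
  add_mem' {f g} hf hg u i j v := by
    have h : defect b p (f + g) u i j v = defect b p f u i j v + defect b p g u i j v := by
      simp only [defect, insertAt, Module.Basis.constr_apply, Pi.add_apply, smul_add,
        Finsupp.sum_add]
      abel
    rw [h, hf, hg, add_zero]
  smul_mem' r f hf u i j v := by
    have h : defect b p (r • f) u i j v = r • defect b p f u i j v := by
      simp only [defect, insertAt, Module.Basis.constr_apply, Pi.smul_apply, smul_sub,
        Finsupp.smul_sum, smul_comm r]
    rw [h, hf, smul_zero]

/-- Appending a letter k turns a defect with right context v into one with right context vk. -/
theorem appendOp_mem (x : L) {f : List I → N} (hf : f ∈ compatible b p N) :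
    appendOp b x f ∈ compatible b p N := by
  have h : ⊤ ≤ (compatible b p N).comap ((appendOp b).flip f) := by
    rw [← b.span_eq, Submodule.span_le]
    rintro _ ⟨k, rfl⟩ u i j v
    have h1 : insertAt b (appendOp b (b k) f) u v = insertAt b f u (v ++ [k]) :=
      b.ext fun t => by simp [appendOp_basis]
    rw [LinearMap.flip_apply, ← hf u i j (v ++ [k])]
    simp [defect, h1, appendOp_basis]
  exact h (Submodule.mem_top (x := x))

/-- By bilinearity x and y may be basis letters i and j; at a word w the identity is then the
vanishing of the defect of f at w i j. -/
theorem appendOp_bracket (hb : ∀ i, b i ∈ part (L := L) (p i)) {f : List I → N}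
    (hf : f ∈ compatible b p N) {s t : ZMod 2} {x y : L} (hx : x ∈ part (L := L) s)
    (hy : y ∈ part (L := L) t) :
    appendOp b (sbracket x y) f =
      appendOp b x (appendOp b y f) - superSign s t • appendOp b y (appendOp b x f) := by
  refine part_induction b p hb s (P := fun x => appendOp b (sbracket x y) f =
      appendOp b x (appendOp b y f) - superSign s t • appendOp b y (appendOp b x f))
    (by simp) ?_ ?_ ?_ x hx
  · intro x x' h h'
    simp only [map_add, LinearMap.add_apply, h, h']
    module
  · intro r x h
    simp only [map_smul, LinearMap.smul_apply, h]
    module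
  rintro i rfl
  refine part_induction b p hb t (P := fun y => appendOp b (sbracket (b i) y) f =
      appendOp b (b i) (appendOp b y f) - superSign (p i) t • appendOp b y (appendOp b (b i) f))
    (by simp) ?_ ?_ ?_ y hy
  · intro x x' h h'
    simp only [map_add, LinearMap.add_apply, h, h']
    module
  · intro r x h
    simp only [map_smul, LinearMap.smul_apply, h]
    module
  rintro j rfl
  ext w
  have h1 : ∀ x : L, appendOp b x f w = insertAt b f w [] x := fun x =>
    LinearMap.congr_fun (f := (LinearMap.proj w ∘ₗ (appendOp b).flip f)) (g := insertAt b f w [])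
      (b.ext fun k => by simp [appendOp_basis]) x
  have h2 := hf w i j []
  rw [defect, sub_eq_zero] at h2
  rw [h1, ← h2]
  simp [appendOp_basis]

/-- The action of `U(L)` on the compatible functions on words. -/
def compatibleRep (hb : ∀ i, b i ∈ part (L := L) (p i)) :
    Env L →ₐ[ℂ] Module.End ℂ (compatible b p N) :=
  envLift
    { toFun := fun x => (appendOp b x).restrict fun _ hf => appendOp_mem (N := N) b p x hf
      map_add' := fun x y => by
        ext f : 2
        exact LinearMap.congr_fun (map_add (appendOp b) x y) (f : List I → N)
      map_smul' := fun r x => by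
        ext f : 2
        exact LinearMap.congr_fun (map_smul (appendOp b) r x) (f : List I → N) }
    fun s t x hx y hy => by
      ext f : 2
      exact appendOp_bracket b p hb f.2 hx hy

end Retraction

section RetractionExists

variable (L : Type u) [AddCommGroup L] [Module ℂ L] [LieSuperalgebra L]

/-- The canonical map from a Lie superalgebra to its enveloping algebra is a split injection of
vector spaces. -/
theorem exists_retraction : ∃ g : Env L →ₗ[ℂ] L, ∀ z, g (envι L z) = z := by
  classical
  let α : ZMod 2 → Type u := fun a => Module.Basis.ofVectorSpaceIndex ℂ (part (L := L) a)
  let B : ∀ a, Module.Basis (α a) ℂ (part (L := L) a) := fun a => Module.Basis.ofVectorSpace ℂ _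
  let b := (isInternal (L := L)).collectedBasis B
  let p : (Σ a, α a) → ZMod 2 := Sigma.fst
  have hb : ∀ i, b i ∈ part (L := L) (p i) := (isInternal (L := L)).collectedBasis_mem B
  -- The straightening works for any linear order on the index set.
  let _ : LinearOrder (Σ a, α a) := linearOrderOfSTO WellOrderingRel
  -- The prescribed function is the tautological one on one-letter words. A single letter contains
  -- no adjacent pair, so straightening leaves its value b i unchanged.
  let n : List (Σ a, α a) → L := fun w => match w with
    | [i] => b i
    | _ => 0
  let σ : compatible b p L := ⟨straighten b p n, defect_straighten hb n⟩
  -- The retraction sends u to the value of u · σ at the empty word; for u = z this is the value of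
  -- σ at the letter z.
  refine ⟨LinearMap.proj [] ∘ₗ (compatible b p L).subtype ∘ₗ
    ((compatibleRep b p hb).toLinearMap.flip σ), fun z => ?_⟩
  have h : LinearMap.proj [] ∘ₗ (appendOp b).flip (straighten b p n) = LinearMap.id := by
    refine b.ext fun i => ?_
    simp only [LinearMap.comp_apply, LinearMap.flip_apply, LinearMap.proj_apply, appendOp_basis,
      List.nil_append, LinearMap.id_apply]
    rw [straighten_of_sorted]
    rintro ⟨⟨u, j, k, v⟩, h, -⟩
    have := congrArg List.length h
    simp at this
    omega
  have h2 := LinearMap.congr_fun h z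
  simpa [compatibleRep, σ] using h2

end RetractionExists

/-! ## Operators on the total space of chains -/

section ChainSum

variable (L : Type u) [AddCommGroup L] [Module ℂ L] [LieSuperalgebra L]

/-- The sum `⨁ₖ C_k(L) = Λ(L₀) ⊗ S(L₁)`. -/
def ChainSum : Type u := DirectSum ℕ fun k => Chains L k

instance : AddCommGroup (ChainSum L) :=
  Module.addCommMonoidToAddCommGroup ℂ (M := DirectSum ℕ fun k => Chains L k)

instance : Module ℂ (ChainSum L) := inferInstanceAs (Module ℂ (DirectSum ℕ fun k => Chains L k))

variable {L}

/-- The inclusion of `C_k(L)` into the total space of chains. -/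
def ofChains (k : ℕ) : Chains L k →ₗ[ℂ] ChainSum L :=
  DirectSum.lof ℂ ℕ (fun k => Chains L k) k

/-- The projection of the total space of chains onto `C_k(L)`. -/
def chainsComponent (k : ℕ) : ChainSum L →ₗ[ℂ] Chains L k :=
  DirectSum.component ℂ ℕ (fun k => Chains L k) k

theorem chainsComponent_self (k : ℕ) (c : Chains L k) : chainsComponent k (ofChains k c) = c :=
  DirectSum.component.lof_self (R := ℂ) (M := fun k => Chains L k) k c

theorem chainsComponent_of_ne {k l : ℕ} (h : k ≠ l) (c : Chains L k) :
    chainsComponent l (ofChains k c) = 0 :=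
  DirectSum.of_eq_of_ne (β := fun k => Chains L k) k l c h.symm

/-- The linear map on the total space of chains with given restrictions to the `C_k(L)`. -/
def chainSumLift {N : Type*} [AddCommMonoid N] [Module ℂ N] (f : ∀ k, Chains L k →ₗ[ℂ] N) :
    ChainSum L →ₗ[ℂ] N :=
  DirectSum.toModule ℂ ℕ N f

@[simp]
theorem chainSumLift_ofChains {N : Type*} [AddCommMonoid N] [Module ℂ N]
    (f : ∀ k, Chains L k →ₗ[ℂ] N) (k : ℕ) (c : Chains L k) :
    chainSumLift f (ofChains k c) = f k c :=
  DirectSum.toModule_lof ℂ k c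

theorem chainSum_of_induction {P : ChainSum L → Prop} (h0 : P 0)
    (hadd : ∀ a b, P a → P b → P (a + b)) (hof : ∀ k c, P (ofChains k c)) (c : ChainSum L) :
    P c :=
  DirectSum.induction_on c h0 hof hadd

/-- The generators `(x_1 ∧ ⋯ ∧ x_p) ⊗ (y_1 ⋯ y_q)` of the total space of chains. -/
def chain (X : List (L0 L)) (Y : List (L1 L)) : ChainSum L :=
  ofChains (X.length + Y.length) (gen (X.length + Y.length) X Y)

theorem ofChains_gen {k : ℕ} {X : List (L0 L)} {Y : List (L1 L)} (h : X.length + Y.length = k) :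
    ofChains k (gen k X Y) = chain X Y := by
  subst h
  rfl

theorem ofChains_incl {p q k : ℕ} (h : p + q = k) (x : Fin p → L0 L) (y : Fin q → L1 L) :
    ofChains k (incl p q k h (exteriorPower.ιMulti ℂ p x ⊗ₜ SymmetricPower.tprod ℂ y)) =
      chain (List.ofFn x) (List.ofFn y) := by
  rw [← gen_ofFn h x y _ _ rfl rfl, ofChains_gen (by simpa using h)]

/-- Decomposable elements span each exterior and each symmetric power, so the chains attached to
pairs of lists span. -/
theorem chainSum_induction {P : ChainSum L → Prop} (h0 : P 0)
    (hadd : ∀ a b, P a → P b → P (a + b)) (hsmul : ∀ (r : ℂ) a, P a → P (r • a))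
    (hchain : ∀ X Y, P (chain X Y)) (c : ChainSum L) : P c := by
  let S : Submodule ℂ (ChainSum L) :=
    Submodule.span ℂ (Set.range fun XY : List (L0 L) × List (L1 L) => chain XY.1 XY.2)
  have hS : ∀ c ∈ S, P c := fun c hc => by
    induction hc using Submodule.span_induction with
    | mem c hc => obtain ⟨XY, rfl⟩ := hc; exact hchain _ _
    | zero => exact h0
    | add a b _ _ ha hb => exact hadd _ _ ha hb
    | smul r a _ ha => exact hsmul _ _ ha
  apply hS
  have hincl : ∀ (p q k : ℕ) (h : p + q = k) (z : (⋀[ℂ]^p (L0 L)) ⊗[ℂ] (Sym[ℂ]^q (L1 L))),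
      ofChains k (incl p q k h z) ∈ S := by
    intro p q k h z
    induction z with
    | zero => simp
    | add a b ha hb => rw [map_add, map_add]; exact add_mem ha hb
    | tmul ω s =>
      have hω : ω ∈ Submodule.span ℂ (Set.range (exteriorPower.ιMulti ℂ p (M := L0 L))) := by
        rw [exteriorPower.ιMulti_span]; trivial
      have hs : s ∈ Submodule.span ℂ (Set.range (SymmetricPower.tprod ℂ (ι := Fin q)
          (M := L1 L))) := by
        rw [SymmetricPower.span_tprod_eq_top]; trivial
      induction hω using Submodule.span_induction with
      | zero => simp
      | add a b _ _ ha hb => rw [TensorProduct.add_tmul, map_add, map_add]; exact add_mem ha hb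
      | smul r a _ ha =>
        rw [← TensorProduct.smul_tmul', map_smul, map_smul]; exact S.smul_mem _ ha
      | mem ω hω =>
        obtain ⟨x, rfl⟩ := hω
        induction hs using Submodule.span_induction with
        | zero => simp
        | add a b _ _ ha hb => rw [TensorProduct.tmul_add, map_add, map_add]; exact add_mem ha hb
        | smul r a _ ha =>
          rw [TensorProduct.tmul_smul, map_smul, map_smul]; exact S.smul_mem _ ha
        | mem s hs =>
          obtain ⟨y, rfl⟩ := hs
          rw [ofChains_incl]
          exact Submodule.subset_span ⟨(_, _), rfl⟩
  refine chainSum_of_induction S.zero_mem (fun _ _ => S.add_mem) (fun k c => ?_) c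
  induction c using DirectSum.induction_on with
  | zero => rw [map_zero]; exact S.zero_mem
  | add a b ha hb => rw [map_add]; exact S.add_mem ha hb
  | of pq z => exact hincl _ _ k (Finset.HasAntidiagonal.mem_antidiagonal.1 pq.2) z

theorem chainSum_hom_ext {N : Type*} [AddCommGroup N] [Module ℂ N] {f g : ChainSum L →ₗ[ℂ] N}
    (h : ∀ X Y, f (chain X Y) = g (chain X Y)) : f = g :=
  LinearMap.ext fun c => chainSum_induction (P := fun c => f c = g c) (by simp)
    (fun a b ha hb => by rw [map_add, map_add, ha, hb])
    (fun r a ha => by rw [map_smul, map_smul, ha]) h c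

/-- Exterior multiplication `C_k(L) → C_{k+1}(L)` by an even element, on the left. -/
def chainsWedge (k : ℕ) : Chains L k →ₗ[ℂ] L0 L →ₗ[ℂ] Chains L (k + 1) :=
  DirectSum.toModule ℂ _ _ fun pq =>
    (TensorProduct.curry (incl (pq.1.1 + 1) pq.1.2 (k + 1)
        (by have := Finset.HasAntidiagonal.mem_antidiagonal.1 pq.2; omega) ∘ₗ
      LinearMap.rTensor _ (extMul (L0 L) pq.1.1) ∘ₗ
        (TensorProduct.assoc ℂ (L0 L) (⋀[ℂ]^pq.1.1 (L0 L))
          (Sym[ℂ]^pq.1.2 (L1 L))).symm.toLinearMap)).flip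

/-- Multiplication `C_k(L) → C_{k+1}(L)` by an odd element in the factor `S(L₁)`. -/
def chainsMul (k : ℕ) : Chains L k →ₗ[ℂ] L1 L →ₗ[ℂ] Chains L (k + 1) :=
  DirectSum.toModule ℂ _ _ fun pq =>
    (TensorProduct.curry (incl pq.1.1 (pq.1.2 + 1) (k + 1)
        (by have := Finset.HasAntidiagonal.mem_antidiagonal.1 pq.2; omega) ∘ₗ
      LinearMap.lTensor _ (symMul (L1 L) pq.1.2) ∘ₗ
        (TensorProduct.leftComm ℂ (L1 L) (⋀[ℂ]^pq.1.1 (L0 L))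
          (Sym[ℂ]^pq.1.2 (L1 L))).toLinearMap)).flip

/-- Exterior multiplication by an even element on the total space of chains. -/
def wedge : L0 L →ₗ[ℂ] ChainSum L →ₗ[ℂ] ChainSum L :=
  LinearMap.flip (chainSumLift fun k => (chainsWedge k).compr₂ (ofChains (k + 1)))

/-- Multiplication by an odd element on the total space of chains. -/
def oddMul : L1 L →ₗ[ℂ] ChainSum L →ₗ[ℂ] ChainSum L :=
  LinearMap.flip (chainSumLift fun k => (chainsMul k).compr₂ (ofChains (k + 1)))

variable (L) in
/-- The operator `(-1)^p` on `Λ^p(L₀) ⊗ S^q(L₁) ⊆ C_k(L)`. -/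
def chainsSign (k : ℕ) : Chains L k →ₗ[ℂ] Chains L k :=
  DirectSum.toModule ℂ _ _ fun pq =>
    incl pq.1.1 pq.1.2 k (Finset.HasAntidiagonal.mem_antidiagonal.1 pq.2) ∘ₗ
      LinearMap.rTensor _ (((-1 : ℂ) ^ pq.1.1) • LinearMap.id)

/-- The operator `(-1)^p` on `Λ^p(L₀) ⊗ S^q(L₁)`. -/
def chainSign : ChainSum L →ₗ[ℂ] ChainSum L := chainSumLift fun k => ofChains k ∘ₗ chainsSign L k

theorem chain_eq (X : List (L0 L)) (Y : List (L1 L)) :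
    chain X Y = ofChains (X.length + Y.length) (incl X.length Y.length _ rfl
      (exteriorPower.ιMulti ℂ X.length X.get ⊗ₜ SymmetricPower.tprod ℂ Y.get)) := by
  rw [chain, gen, dif_pos rfl]

@[simp]
theorem wedge_chain (x : L0 L) (X : List (L0 L)) (Y : List (L1 L)) :
    wedge x (chain X Y) = chain (x :: X) Y := by
  have h : wedge x (chain X Y) = ofChains (X.length + Y.length + 1)
      (incl (X.length + 1) Y.length (X.length + Y.length + 1) (by omega)
        (exteriorPower.ιMulti ℂ (X.length + 1) (Fin.cons x X.get : Fin (X.length + 1) → L0 L) ⊗ₜ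
          SymmetricPower.tprod ℂ Y.get)) := by
    rw [chain_eq, wedge, LinearMap.flip_apply, chainSumLift_ofChains,
      LinearMap.compr₂_apply, chainsWedge, incl, DirectSum.toModule_lof]
    simp [extMul_ιMulti]
  rw [h, ofChains_incl]
  simp

@[simp]
theorem oddMul_chain (y : L1 L) (X : List (L0 L)) (Y : List (L1 L)) :
    oddMul y (chain X Y) = chain X (y :: Y) := by
  have h : oddMul y (chain X Y) = ofChains (X.length + Y.length + 1)
      (incl X.length (Y.length + 1) (X.length + Y.length + 1) (by omega)
        (exteriorPower.ιMulti ℂ X.length X.get ⊗ₜ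
          SymmetricPower.tprod ℂ (Fin.cons y Y.get : Fin (Y.length + 1) → L1 L))) := by
    rw [chain_eq, oddMul, LinearMap.flip_apply, chainSumLift_ofChains,
      LinearMap.compr₂_apply, chainsMul, incl, DirectSum.toModule_lof]
    simp [symMul_tprod]
  rw [h, ofChains_incl]
  simp

@[simp]
theorem chainSign_chain (X : List (L0 L)) (Y : List (L1 L)) :
    chainSign (chain X Y) = (-1 : ℂ) ^ X.length • chain X Y := by
  rw [chain_eq, chainSign, chainSumLift_ofChains, LinearMap.comp_apply, chainsSign, incl,
    DirectSum.toModule_lof]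
  simp only [LinearMap.comp_apply, LinearMap.rTensor_tmul, LinearMap.smul_apply, LinearMap.id_apply,
    ← TensorProduct.smul_tmul', map_smul]
  rfl

/-- With its odd counterpart, this is the only consequence of (anti)symmetry used later: in the
formulas below a new letter is always put in front. -/
theorem chain_swap (a b : L0 L) (X : List (L0 L)) (Y : List (L1 L)) :
    chain (a :: b :: X) Y = -chain (b :: a :: X) Y := by
  let v : Fin (X.length + 2) → L0 L := Fin.cons a (Fin.cons b X.get : Fin (X.length + 1) → L0 L)
  have h1 := ofChains_incl (k := X.length + 2 + Y.length) rfl v Y.get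
  have h2 := ofChains_incl (k := X.length + 2 + Y.length) rfl
    (fun i => v (Equiv.swap 0 1 i)) Y.get
  have h3 : List.ofFn v = a :: b :: X := by simp [v]
  have h4 : List.ofFn (fun i => v (Equiv.swap 0 1 i)) = b :: a :: X := by
    rw [List.ofFn_succ, List.ofFn_succ]
    have : ∀ i : Fin X.length, Equiv.swap (0 : Fin (X.length + 2)) 1 i.succ.succ = i.succ.succ :=
      fun i => Equiv.swap_apply_of_ne_of_ne (Fin.succ_ne_zero _)
        (by rw [← Fin.succ_zero_eq_one]; exact fun h => Fin.succ_ne_zero _ (Fin.succ_injective _ h))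
    simp only [this, Fin.succ_zero_eq_one, Equiv.swap_apply_left, Equiv.swap_apply_right]
    simp [v]
  rw [h3, List.ofFn_get] at h1
  have h5 : (exteriorPower.ιMulti ℂ (X.length + 2) fun i => v (Equiv.swap 0 1 i)) =
      (-1 : ℂ) • exteriorPower.ιMulti ℂ (X.length + 2) v := by
    exact (AlternatingMap.map_swap _ _ Fin.zero_ne_one).trans (neg_one_smul ℂ _).symm
  rw [h4, List.ofFn_get, h5, ← TensorProduct.smul_tmul', map_smul, map_smul, h1] at h2
  rw [← h2, neg_one_smul, neg_neg]

theorem chain_swap_odd (a b : L1 L) (X : List (L0 L)) (Y : List (L1 L)) :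
    chain X (a :: b :: Y) = chain X (b :: a :: Y) := by
  let v : Fin (Y.length + 2) → L1 L := Fin.cons a (Fin.cons b Y.get : Fin (Y.length + 1) → L1 L)
  have h1 := ofChains_incl (k := X.length + (Y.length + 2)) rfl X.get v
  have h2 := ofChains_incl (k := X.length + (Y.length + 2)) rfl X.get
    (fun i => v (Equiv.swap 0 1 i))
  have h3 : List.ofFn v = a :: b :: Y := by simp [v]
  have h4 : List.ofFn (fun i => v (Equiv.swap 0 1 i)) = b :: a :: Y := by
    rw [List.ofFn_succ, List.ofFn_succ]
    have : ∀ i : Fin Y.length, Equiv.swap (0 : Fin (Y.length + 2)) 1 i.succ.succ = i.succ.succ :=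
      fun i => Equiv.swap_apply_of_ne_of_ne (Fin.succ_ne_zero _)
        (by rw [← Fin.succ_zero_eq_one]; exact fun h => Fin.succ_ne_zero _ (Fin.succ_injective _ h))
    simp only [this, Fin.succ_zero_eq_one, Equiv.swap_apply_left, Equiv.swap_apply_right]
    simp [v]
  rw [h3, List.ofFn_get] at h1
  rw [h4, List.ofFn_get, SymmetricPower.tprod_equiv, h1] at h2
  exact h2

end ChainSum

section ListSums

theorem sum_fin_cons {α N : Type*} [AddCommMonoid N] (x : α) (X : List α)
    (f : Fin (x :: X).length → N) :
    ∑ s, f s = f (0 : Fin (X.length + 1)) + ∑ s : Fin X.length, f (Fin.succ s) :=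
  Fin.sum_univ_succ f

end ListSums

/-! ### The differential on chains and the operators it generates. -/

section ChainDifferential

variable {L : Type u} [AddCommGroup L] [Module ℂ L] [LieSuperalgebra L]

theorem chainsD_gen {k : ℕ} {X : List (L0 L)} {Y : List (L1 L)} (h : X.length + Y.length = k + 1) :
    chainsD L k (gen (k + 1) X Y) =
      (∑ s : Fin X.length, ∑ t ∈ Finset.Ioi s, ((-1 : ℂ) ^ (s + t : ℕ)) •
        gen k (br00 (X.get s) (X.get t) :: (X.eraseIdx t).eraseIdx s) Y) +
      (∑ s : Fin X.length, ∑ t : Fin Y.length, ((-1 : ℂ) ^ (s + 1 : ℕ)) •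
        gen k (X.eraseIdx s) (br01 (X.get s) (Y.get t) :: Y.eraseIdx t)) +
      ∑ s : Fin Y.length, ∑ t ∈ Finset.Ioi s, (-1 : ℂ) •
        gen k (br11 (Y.get s) (Y.get t) :: X) ((Y.eraseIdx t).eraseIdx s) := by
  rw [gen, dif_pos h, chainsD_incl, diffXX_apply h X.get Y.get, diffXY_apply h X.get Y.get,
    diffYY_apply h X.get Y.get]
  simp only [List.ofFn_get]

theorem chainsCo_gen {k : ℕ} {X : List (L0 L)} {Y : List (L1 L)} (h : X.length + Y.length = k + 1) :
    chainsCo L k (gen (k + 1) X Y) =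
      (∑ s : Fin X.length, ((-1 : ℂ) ^ (s : ℕ)) • ((X.get s : L) ⊗ₜ[ℂ] gen k (X.eraseIdx s) Y)) +
      (-1 : ℂ) ^ X.length • ∑ t : Fin Y.length, ((Y.get t : L) ⊗ₜ[ℂ] gen k X (Y.eraseIdx t)) := by
  rw [gen, dif_pos h, chainsCo_incl, diffX_apply h X.get Y.get, diffY_apply h X.get Y.get]
  simp only [List.ofFn_get]

/-- The part of the differential with values in `C(L)`, on the total space of chains. -/
def chainSumD : ChainSum L →ₗ[ℂ] ChainSum L :=
  chainSumLift fun
    | 0 => 0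
    | k + 1 => ofChains k ∘ₗ chainsD L k

/-- The part of the differential with values in `L ⊗ C(L)`, on the total space of chains. -/
def chainSumCo : ChainSum L →ₗ[ℂ] L ⊗[ℂ] ChainSum L :=
  chainSumLift fun
    | 0 => 0
    | k + 1 => LinearMap.lTensor L (ofChains k) ∘ₗ chainsCo L k

theorem chainSumD_chain (X : List (L0 L)) (Y : List (L1 L)) :
    chainSumD (chain X Y) =
      (∑ s : Fin X.length, ∑ t ∈ Finset.Ioi s, ((-1 : ℂ) ^ (s + t : ℕ)) •
        chain (br00 (X.get s) (X.get t) :: (X.eraseIdx t).eraseIdx s) Y) +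
      (∑ s : Fin X.length, ∑ t : Fin Y.length, ((-1 : ℂ) ^ (s + 1 : ℕ)) •
        chain (X.eraseIdx s) (br01 (X.get s) (Y.get t) :: Y.eraseIdx t)) +
      ∑ s : Fin Y.length, ∑ t ∈ Finset.Ioi s, (-1 : ℂ) •
        chain (br11 (Y.get s) (Y.get t) :: X) ((Y.eraseIdx t).eraseIdx s) := by
  rcases h : X.length + Y.length with _ | k
  · obtain ⟨hX, hY⟩ := Nat.add_eq_zero_iff.1 h
    rw [List.length_eq_zero_iff] at hX hY
    subst hX hY
    rw [← ofChains_gen h, chainSumD, chainSumLift_ofChains]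
    simp
  · rw [← ofChains_gen h, chainSumD, chainSumLift_ofChains, LinearMap.comp_apply, chainsD_gen h]
    simp only [map_add, map_sum, map_smul]
    congr 1
    · congr 1
      · refine Finset.sum_congr rfl fun s _ => Finset.sum_congr rfl fun t ht => ?_
        have h1 := s.2
        have h2 := t.2
        have h3 := Fin.lt_def.1 (Finset.mem_Ioi.1 ht)
        rw [ofChains_gen]
        rw [List.length_cons, List.length_eraseIdx, List.length_eraseIdx_of_lt h2, if_pos] <;> omega
      · refine Finset.sum_congr rfl fun s _ => Finset.sum_congr rfl fun t ht => ?_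
        have h1 := s.2
        have h2 := t.2
        rw [ofChains_gen]
        rw [List.length_cons, List.length_eraseIdx_of_lt h2, List.length_eraseIdx_of_lt h1]
        omega
    · refine Finset.sum_congr rfl fun s _ => Finset.sum_congr rfl fun t ht => ?_
      have h1 := s.2
      have h2 := t.2
      have h3 := Fin.lt_def.1 (Finset.mem_Ioi.1 ht)
      rw [ofChains_gen]
      rw [List.length_cons, List.length_eraseIdx, List.length_eraseIdx_of_lt h2, if_pos] <;> omega

theorem chainSumCo_chain (X : List (L0 L)) (Y : List (L1 L)) :
    chainSumCo (chain X Y) =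
      (∑ s : Fin X.length, ((-1 : ℂ) ^ (s : ℕ)) • ((X.get s : L) ⊗ₜ[ℂ] chain (X.eraseIdx s) Y)) +
      (-1 : ℂ) ^ X.length • ∑ t : Fin Y.length, ((Y.get t : L) ⊗ₜ[ℂ] chain X (Y.eraseIdx t)) := by
  rcases h : X.length + Y.length with _ | k
  · obtain ⟨hX, hY⟩ := Nat.add_eq_zero_iff.1 h
    rw [List.length_eq_zero_iff] at hX hY
    subst hX hY
    rw [← ofChains_gen h, chainSumCo, chainSumLift_ofChains]
    simp
  · rw [← ofChains_gen h, chainSumCo, chainSumLift_ofChains, LinearMap.comp_apply, chainsCo_gen h]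
    simp only [map_add, map_sum, map_smul, LinearMap.lTensor_tmul]
    congr 1
    · refine Finset.sum_congr rfl fun s _ => ?_
      have h1 := s.2
      rw [ofChains_gen]
      rw [List.length_eraseIdx_of_lt h1]
      omega
    · congr 1
      refine Finset.sum_congr rfl fun s _ => ?_
      have h1 := s.2
      rw [ofChains_gen]
      rw [List.length_eraseIdx_of_lt h1]
      omega

/-- Splitting off the first letter gives x ⊗ c; every other index is shifted by one, which changes
its sign. -/
theorem chainSumCo_wedge (x : L0 L) (c : ChainSum L) :
    chainSumCo (wedge x c) =
      (x : L) ⊗ₜ[ℂ] c - LinearMap.lTensor L (wedge x) (chainSumCo c) := by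
  refine LinearMap.congr_fun (f := chainSumCo ∘ₗ wedge x)
    (g := TensorProduct.mk ℂ L (ChainSum L) x - LinearMap.lTensor L (wedge x) ∘ₗ chainSumCo)
    (chainSum_hom_ext fun X Y => ?_) c
  simp only [LinearMap.comp_apply, LinearMap.sub_apply, wedge_chain, chainSumCo_chain,
    TensorProduct.mk_apply, sum_fin_cons, map_add, map_sum, map_smul, LinearMap.lTensor_tmul]
  simp [pow_succ]
  abel

/-- The new odd letter does not shift the even indices, but splitting it off costs (-1)^p, which is
`chainSign`. -/
theorem chainSumCo_oddMul (y : L1 L) (c : ChainSum L) :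
    chainSumCo (oddMul y c) =
      (y : L) ⊗ₜ[ℂ] chainSign c + LinearMap.lTensor L (oddMul y) (chainSumCo c) := by
  refine LinearMap.congr_fun (f := chainSumCo ∘ₗ oddMul y)
    (g := TensorProduct.mk ℂ L (ChainSum L) y ∘ₗ chainSign +
      LinearMap.lTensor L (oddMul y) ∘ₗ chainSumCo)
    (chainSum_hom_ext fun X Y => ?_) c
  simp only [LinearMap.comp_apply, LinearMap.add_apply, oddMul_chain, chainSumCo_chain,
    TensorProduct.mk_apply, sum_fin_cons, map_add, map_sum, map_smul, LinearMap.lTensor_tmul]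
  simp
  abel

/-- The action of an even element on chains, up to sign. -/
def evenAct (x : L0 L) : ChainSum L →ₗ[ℂ] ChainSum L :=
  chainSumD ∘ₗ wedge x + wedge x ∘ₗ chainSumD

/-- The action of an odd element on chains, up to sign. -/
def oddAct (y : L1 L) : ChainSum L →ₗ[ℂ] ChainSum L :=
  chainSumD ∘ₗ oddMul y - oddMul y ∘ₗ chainSumD

/-- Terms of D(x ∧ c) that do not bracket with x cancel against x ∧ Dc. What remains is minus the
derivation extending ad x. -/
theorem evenAct_chain (x : L0 L) (X : List (L0 L)) (Y : List (L1 L)) :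
    evenAct x (chain X Y) =
      -(∑ t : Fin X.length, (-1 : ℂ) ^ (t : ℕ) • chain (br00 x (X.get t) :: X.eraseIdx t) Y) -
        ∑ t : Fin Y.length, chain X (br01 x (Y.get t) :: Y.eraseIdx t) := by
  simp only [evenAct, LinearMap.comp_apply, LinearMap.add_apply, wedge_chain, chainSumD_chain,
    sum_fin_cons, map_add, map_sum, map_smul]
  simp [pow_succ, pow_add]
  simp only [chain_swap x]
  simp
  abel

/-- The same cancellation as in `evenAct_chain`; only the brackets with y survive. -/
theorem oddAct_chain (y : L1 L) (X : List (L0 L)) (Y : List (L1 L)) :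
    oddAct y (chain X Y) =
      -(∑ s : Fin X.length, (-1 : ℂ) ^ (s : ℕ) • chain (X.eraseIdx s) (br01 (X.get s) y :: Y)) -
        ∑ t : Fin Y.length, chain (br11 y (Y.get t) :: X) (Y.eraseIdx t) := by
  simp only [oddAct, LinearMap.comp_apply, LinearMap.sub_apply, oddMul_chain, chainSumD_chain,
    sum_fin_cons, map_add, map_sum, map_smul]
  simp [pow_succ, pow_add]
  simp only [fun a => chain_swap_odd a y]
  simp only [Finset.sum_add_distrib, Finset.sum_neg_distrib]
  abel

/-! ### Commutation relations -/

theorem wedge_wedge (x x' : L0 L) (c : ChainSum L) :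
    wedge x (wedge x' c) = -wedge x' (wedge x c) :=
  LinearMap.congr_fun (f := wedge x ∘ₗ wedge x') (g := -(wedge x' ∘ₗ wedge x))
    (chainSum_hom_ext fun X Y => by simp [chain_swap x]) c

theorem oddMul_oddMul (y y' : L1 L) (c : ChainSum L) :
    oddMul y (oddMul y' c) = oddMul y' (oddMul y c) :=
  LinearMap.congr_fun (f := oddMul y ∘ₗ oddMul y') (g := oddMul y' ∘ₗ oddMul y)
    (chainSum_hom_ext fun X Y => by simp [chain_swap_odd y y']) c

theorem oddMul_wedge (y : L1 L) (x : L0 L) (c : ChainSum L) :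
    oddMul y (wedge x c) = wedge x (oddMul y c) :=
  LinearMap.congr_fun (f := oddMul y ∘ₗ wedge x) (g := wedge x ∘ₗ oddMul y)
    (chainSum_hom_ext fun X Y => by simp) c

theorem chainSign_wedge (x : L0 L) (c : ChainSum L) :
    chainSign (wedge x c) = -wedge x (chainSign c) :=
  LinearMap.congr_fun (f := chainSign ∘ₗ wedge x) (g := -(wedge x ∘ₗ chainSign))
    (chainSum_hom_ext fun X Y => by simp [pow_succ]) c

theorem chainSign_oddMul (y : L1 L) (c : ChainSum L) :
    chainSign (oddMul y c) = oddMul y (chainSign c) :=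
  LinearMap.congr_fun (f := chainSign ∘ₗ oddMul y) (g := oddMul y ∘ₗ chainSign)
    (chainSum_hom_ext fun X Y => by simp) c

theorem chainSign_chainSign (c : ChainSum L) : chainSign (chainSign c) = c :=
  LinearMap.congr_fun (f := chainSign ∘ₗ chainSign) (g := LinearMap.id)
    (chainSum_hom_ext fun X Y => by simp [smul_smul, ← mul_pow]) c

/-- In this and the next three lemmas, the explicit formula for the action is split at its first
letter: bracketing with that letter gives the correction term. With the vanishing on the empty chain
these rules determine the actions, and the sums over indices are not needed again. -/
theorem evenAct_wedge (x x' : L0 L) (c : ChainSum L) :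
    evenAct x (wedge x' c) = wedge x' (evenAct x c) - wedge (br00 x x') c := by
  refine LinearMap.congr_fun (f := evenAct x ∘ₗ wedge x')
    (g := wedge x' ∘ₗ evenAct x - wedge (br00 x x')) (chainSum_hom_ext fun X Y => ?_) c
  simp only [LinearMap.comp_apply, LinearMap.sub_apply, wedge_chain, evenAct_chain, sum_fin_cons,
    map_sub, map_neg, map_sum, map_smul]
  simp [pow_succ]
  simp only [chain_swap x']
  simp
  abel

theorem evenAct_oddMul (x : L0 L) (y : L1 L) (c : ChainSum L) :
    evenAct x (oddMul y c) = oddMul y (evenAct x c) - oddMul (br01 x y) c := by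
  refine LinearMap.congr_fun (f := evenAct x ∘ₗ oddMul y)
    (g := oddMul y ∘ₗ evenAct x - oddMul (br01 x y)) (chainSum_hom_ext fun X Y => ?_) c
  simp only [LinearMap.comp_apply, LinearMap.sub_apply, oddMul_chain, evenAct_chain, sum_fin_cons,
    map_sub, map_neg, map_sum, map_smul]
  simp
  simp only [fun a => chain_swap_odd a y]
  abel

theorem oddAct_wedge (y : L1 L) (x : L0 L) (c : ChainSum L) :
    oddAct y (wedge x c) = -wedge x (oddAct y c) - oddMul (br01 x y) c := by
  refine LinearMap.congr_fun (f := oddAct y ∘ₗ wedge x)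
    (g := -(wedge x ∘ₗ oddAct y) - oddMul (br01 x y)) (chainSum_hom_ext fun X Y => ?_) c
  simp only [LinearMap.comp_apply, LinearMap.sub_apply, LinearMap.neg_apply, wedge_chain,
    oddMul_chain, oddAct_chain, sum_fin_cons, map_sub, map_neg, map_sum, map_smul]
  simp [pow_succ]
  simp only [chain_swap x]
  simp
  abel

theorem oddAct_oddMul (y y' : L1 L) (c : ChainSum L) :
    oddAct y (oddMul y' c) = oddMul y' (oddAct y c) - wedge (br11 y y') c := by
  refine LinearMap.congr_fun (f := oddAct y ∘ₗ oddMul y')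
    (g := oddMul y' ∘ₗ oddAct y - wedge (br11 y y')) (chainSum_hom_ext fun X Y => ?_) c
  simp only [LinearMap.comp_apply, LinearMap.sub_apply, wedge_chain,
    oddMul_chain, oddAct_chain, sum_fin_cons, map_sub, map_neg, map_sum, map_smul]
  simp
  simp only [fun a => chain_swap_odd a y']
  abel

theorem chainSumD_nil : chainSumD (chain ([] : List (L0 L)) ([] : List (L1 L))) = 0 := by
  simp [chainSumD_chain]

theorem chainSumCo_nil : chainSumCo (chain ([] : List (L0 L)) ([] : List (L1 L))) = 0 := by
  simp [chainSumCo_chain]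

theorem evenAct_nil (x : L0 L) : evenAct x (chain ([] : List (L0 L)) ([] : List (L1 L))) = 0 := by
  simp [evenAct_chain]

theorem oddAct_nil (y : L1 L) : oddAct y (chain ([] : List (L0 L)) ([] : List (L1 L))) = 0 := by
  simp [oddAct_chain]

/-- Induction over the total space of chains, by multiplication operators. -/
theorem chainSum_mul_induction {P : ChainSum L → Prop}
    (hadd : ∀ a b, P a → P b → P (a + b)) (hsmul : ∀ (r : ℂ) a, P a → P (r • a))
    (hnil : P (chain [] [])) (hwedge : ∀ x c, P c → P (wedge x c))
    (hodd : ∀ y c, P c → P (oddMul y c)) (c : ChainSum L) : P c := by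
  have h0 : P 0 := by simpa using hsmul 0 _ hnil
  refine chainSum_induction h0 hadd hsmul (fun X Y => ?_) c
  induction X with
  | nil =>
    induction Y with
    | nil => exact hnil
    | cons y Y ih => simpa using hodd y _ ih
  | cons x X ih => simpa using hwedge x _ ih

theorem chainSumD_wedge (x : L0 L) (c : ChainSum L) :
    chainSumD (wedge x c) = evenAct x c - wedge x (chainSumD c) := by
  simp [evenAct]

theorem chainSumD_oddMul (y : L1 L) (c : ChainSum L) :
    chainSumD (oddMul y c) = oddAct y c + oddMul y (chainSumD c) := by
  simp [oddAct]

theorem chainSign_nil : chainSign (chain ([] : List (L0 L)) ([] : List (L1 L))) = chain [] [] := by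
  simp

theorem chainSign_evenAct (x : L0 L) (c : ChainSum L) :
    chainSign (evenAct x c) = evenAct x (chainSign c) := by
  refine chainSum_mul_induction (P := fun c => chainSign (evenAct x c) = evenAct x (chainSign c))
    (fun a b ha hb => ?_) (fun r a ha => ?_) ?_ (fun x' c hc => ?_) (fun y c hc => ?_) c
  · simp only [map_add, ha, hb]
  · simp only [map_smul, ha]
  · rw [chainSign_nil, evenAct_nil, map_zero]
  · simp only [evenAct_wedge, chainSign_wedge, map_sub, map_neg, hc]
    abel
  · simp only [evenAct_oddMul, chainSign_oddMul, map_sub, hc]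

/-- Bracketing with an odd element changes the number of even letters by one. -/
theorem chainSign_oddAct (y : L1 L) (c : ChainSum L) :
    chainSign (oddAct y c) = -oddAct y (chainSign c) := by
  refine chainSum_mul_induction (P := fun c => chainSign (oddAct y c) = -oddAct y (chainSign c))
    (fun a b ha hb => ?_) (fun r a ha => ?_) ?_ (fun x' c hc => ?_) (fun y c hc => ?_) c
  · simp only [map_add, ha, hb, neg_add]
  · simp only [map_smul, ha, smul_neg]
  · rw [chainSign_nil, oddAct_nil, map_zero, neg_zero]
  · simp only [oddAct_wedge, chainSign_wedge, chainSign_oddMul, map_sub, map_neg, hc]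
    abel
  · simp only [oddAct_oddMul, chainSign_oddMul, chainSign_wedge, map_sub, map_neg, hc]
    abel

end ChainDifferential

/-! ## The Koszul complex squares to zero -/

section Jacobi

variable {L : Type u} [AddCommGroup L] [Module ℂ L] [LieSuperalgebra L]

theorem coe_br00 (x x' : L0 L) : (br00 x x' : L) = sbracket (x : L) (x' : L) := rfl

theorem coe_br01 (x : L0 L) (y : L1 L) : (br01 x y : L) = sbracket (x : L) (y : L) := rfl

theorem coe_br11 (y y' : L1 L) : (br11 y y' : L) = sbracket (y : L) (y' : L) := rfl

theorem superSign_zero_left (a : ZMod 2) : superSign 0 a = 1 := by simp [superSign]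

theorem superSign_zero_right (a : ZMod 2) : superSign a 0 = 1 := by simp [superSign]

theorem br00_br00 (x x' w : L0 L) :
    br00 x (br00 x' w) = br00 (br00 x x') w + br00 x' (br00 x w) :=
  Subtype.ext (by
    have h := sbracket_jacobi 0 0 _ x.2 _ x'.2 (w : L)
    simpa [superSign_zero_left, coe_br00] using h)

theorem br01_br01 (x x' : L0 L) (y : L1 L) :
    br01 x (br01 x' y) = br01 (br00 x x') y + br01 x' (br01 x y) :=
  Subtype.ext (by
    have h := sbracket_jacobi 0 0 _ x.2 _ x'.2 (y : L)
    simpa [superSign_zero_left, coe_br00, coe_br01] using h)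

theorem br00_br11 (x : L0 L) (y y' : L1 L) :
    br00 x (br11 y y') = br11 (br01 x y) y' + br11 y (br01 x y') :=
  Subtype.ext (by
    have h := sbracket_jacobi 0 1 _ x.2 _ y.2 (y' : L)
    simpa [superSign_zero_left, coe_br00, coe_br01, coe_br11] using h)

/-- The Jacobi identity for three odd elements, brought to symmetric form by antisymmetry of the
bracket between odd and even elements. -/
theorem br01_br11 (y y' y'' : L1 L) :
    br01 (br11 y' y'') y + br01 (br11 y y') y'' + br01 (br11 y y'') y' = 0 :=
  Subtype.ext (by
    have h := sbracket_jacobi 1 1 _ y.2 _ y'.2 (y'' : L)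
    have h1 := sbracket_antisymm 1 0 _ y.2 _ (br11 y' y'').2
    have h2 := sbracket_antisymm 1 0 _ y'.2 _ (br11 y y'').2
    rw [superSign_zero_right, one_smul] at h1 h2
    rw [superSign_one_one, ← coe_br11, ← coe_br11, ← coe_br11, h1, h2] at h
    simp only [Submodule.coe_add, coe_br01, Submodule.coe_zero]
    linear_combination (norm := module) (-1 : ℂ) • h)

theorem envι_br00 (x x' : L0 L) :
    envι L (br00 x x') = envι L x * envι L x' - envι L x' * envι L x := by
  rw [coe_br00, envι_bracket x.2 x'.2, superSign_zero_left, one_smul]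

theorem envι_br01 (x : L0 L) (y : L1 L) :
    envι L (br01 x y) = envι L x * envι L y - envι L y * envι L x := by
  rw [coe_br01, envι_bracket x.2 y.2, superSign_zero_left, one_smul]

theorem envι_br11 (y y' : L1 L) :
    envι L (br11 y y') = envι L y * envι L y' + envι L y' * envι L y := by
  rw [coe_br11, envι_bracket y.2 y'.2, superSign_one_one]
  module

end Jacobi

/-! ### Cartan calculus on U(L) ⊗ Λ(L₀) ⊗ S(L₁). -/

section KoszulSum

variable (L : Type u) [AddCommGroup L] [Module ℂ L] [LieSuperalgebra L]

/-- The total space of the Koszul complex. -/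
abbrev KoszulSum : Type u := Env L ⊗[ℂ] ChainSum L

variable {L}

/-- Multiplication by an even element in the second factor of `U(L) ⊗ C(L)`. -/
def kWedge (x : L0 L) : KoszulSum L →ₗ[ℂ] KoszulSum L := LinearMap.lTensor _ (wedge x)

/-- Multiplication by an odd element in the second factor of `U(L) ⊗ C(L)`. -/
def kOdd (y : L1 L) : KoszulSum L →ₗ[ℂ] KoszulSum L := LinearMap.lTensor _ (oddMul y)

/-- The action of an even element on `U(L) ⊗ C(L)` from the right. -/
def kActEven (x : L0 L) : KoszulSum L →ₗ[ℂ] KoszulSum L :=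
  LinearMap.rTensor _ (LinearMap.mulRight ℂ (envι L x)) + LinearMap.lTensor _ (evenAct x)

/-- The action of an odd element on `U(L) ⊗ C(L)` from the right. -/
def kActOdd (y : L1 L) : KoszulSum L →ₗ[ℂ] KoszulSum L :=
  TensorProduct.map (LinearMap.mulRight ℂ (envι L y)) chainSign + LinearMap.lTensor _ (oddAct y)

variable (L) in
/-- The part of the differential of the Koszul complex in which `L` acts on `U(L)`. -/
def kAct : Env L ⊗[ℂ] (L ⊗[ℂ] ChainSum L) →ₗ[ℂ] KoszulSum L :=
  LinearMap.rTensor _ (rightAct L (Env L)) ∘ₗ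
    (TensorProduct.assoc ℂ (Env L) L (ChainSum L)).symm.toLinearMap

variable (L) in
/-- The differential of the Koszul complex on the total space. -/
def kD : KoszulSum L →ₗ[ℂ] KoszulSum L :=
  LinearMap.lTensor _ chainSumD + kAct L ∘ₗ LinearMap.lTensor _ chainSumCo

@[simp]
theorem kWedge_tmul (x : L0 L) (u : Env L) (c : ChainSum L) :
    kWedge x (u ⊗ₜ c) = u ⊗ₜ wedge x c := rfl

@[simp]
theorem kOdd_tmul (y : L1 L) (u : Env L) (c : ChainSum L) :
    kOdd y (u ⊗ₜ c) = u ⊗ₜ oddMul y c := rfl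

@[simp]
theorem kActEven_tmul (x : L0 L) (u : Env L) (c : ChainSum L) :
    kActEven x (u ⊗ₜ c) = (u * envι L x) ⊗ₜ c + u ⊗ₜ evenAct x c := rfl

@[simp]
theorem kActOdd_tmul (y : L1 L) (u : Env L) (c : ChainSum L) :
    kActOdd y (u ⊗ₜ c) = (u * envι L y) ⊗ₜ chainSign c + u ⊗ₜ oddAct y c := rfl

@[simp]
theorem kAct_tmul (u : Env L) (z : L) (c : ChainSum L) :
    kAct L (u ⊗ₜ (z ⊗ₜ c)) = (u * envι L z) ⊗ₜ c := rfl

@[simp]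
theorem kD_tmul (u : Env L) (c : ChainSum L) :
    kD L (u ⊗ₜ c) = u ⊗ₜ chainSumD c + kAct L (u ⊗ₜ chainSumCo c) := rfl

theorem kAct_lTensor (u : Env L) (f : ChainSum L →ₗ[ℂ] ChainSum L) (z : L ⊗[ℂ] ChainSum L) :
    kAct L (u ⊗ₜ LinearMap.lTensor L f z) = LinearMap.lTensor _ f (kAct L (u ⊗ₜ z)) := by
  induction z with
  | zero => simp
  | add a b ha hb => simp only [map_add, TensorProduct.tmul_add, ha, hb]
  | tmul z c => simp

variable (L) in
/-- The generator `1` of the Koszul complex in degree zero. -/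
def emptyChain : ChainSum L := chain [] []

/-- The elements u ⊗ 1 and the two kinds of multiplication generate everything; scalars are absorbed
into u. This reduces an identity of operators to their commutators with multiplications. -/
theorem koszulSum_induction {P : KoszulSum L → Prop} (hadd : ∀ a b, P a → P b → P (a + b))
    (hnil : ∀ u, P (u ⊗ₜ emptyChain L)) (hwedge : ∀ x m, P m → P (kWedge x m))
    (hodd : ∀ y m, P m → P (kOdd y m)) (m : KoszulSum L) : P m := by
  have key : ∀ c : ChainSum L, ∀ u, P (u ⊗ₜ c) := by
    refine chainSum_mul_induction (fun a b ha hb u => ?_) (fun r a ha u => ?_) hnil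
      (fun x c hc u => hwedge x _ (hc u)) (fun y c hc u => hodd y _ (hc u))
    · rw [TensorProduct.tmul_add]
      exact hadd _ _ (ha u) (hb u)
    · rw [← TensorProduct.smul_tmul]
      exact ha _
  induction m using TensorProduct.induction_on with
  | zero => simpa using key 0 0
  | add a b ha hb => exact hadd a b ha hb
  | tmul u c => exact key c u

theorem koszulSum_hom_ext {N : Type*} [AddCommMonoid N] [Module ℂ N] {f g : KoszulSum L →ₗ[ℂ] N}
    (h : ∀ u c, f (u ⊗ₜ c) = g (u ⊗ₜ c)) : f = g := TensorProduct.ext' h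

/-- Cartan's formula: the summand x ⊗ c split off by `chainSumCo_wedge` contributes right
multiplication by x, and the bracket part contributes `evenAct`. -/
theorem kD_kWedge (x : L0 L) (m : KoszulSum L) :
    kD L (kWedge x m) = kActEven x m - kWedge x (kD L m) :=
  LinearMap.congr_fun (f := kD L ∘ₗ kWedge x) (g := kActEven x - kWedge x ∘ₗ kD L)
    (koszulSum_hom_ext fun u c => by
      simp only [LinearMap.comp_apply, LinearMap.sub_apply, kWedge_tmul, kD_tmul, chainSumD_wedge,
        chainSumCo_wedge, TensorProduct.tmul_sub, map_sub, kAct_tmul, kAct_lTensor, kActEven_tmul,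
        map_add]
      simp only [kWedge]
      abel) m

theorem kD_kOdd (y : L1 L) (m : KoszulSum L) :
    kD L (kOdd y m) = kActOdd y m + kOdd y (kD L m) :=
  LinearMap.congr_fun (f := kD L ∘ₗ kOdd y) (g := kActOdd y + kOdd y ∘ₗ kD L)
    (koszulSum_hom_ext fun u c => by
      simp only [LinearMap.comp_apply, LinearMap.add_apply, kOdd_tmul, kD_tmul, chainSumD_oddMul,
        chainSumCo_oddMul, TensorProduct.tmul_add, map_add, kAct_tmul, kAct_lTensor, kActOdd_tmul]
      simp only [kOdd]
      abel) m

theorem kActEven_kWedge (x x' : L0 L) (m : KoszulSum L) :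
    kActEven x (kWedge x' m) = kWedge x' (kActEven x m) - kWedge (br00 x x') m :=
  LinearMap.congr_fun (f := kActEven x ∘ₗ kWedge x')
    (g := kWedge x' ∘ₗ kActEven x - kWedge (br00 x x'))
    (koszulSum_hom_ext fun u c => by
      simp only [LinearMap.comp_apply, LinearMap.sub_apply, kWedge_tmul, kActEven_tmul,
        evenAct_wedge, TensorProduct.tmul_sub, map_add]
      abel) m

theorem kActEven_kOdd (x : L0 L) (y : L1 L) (m : KoszulSum L) :
    kActEven x (kOdd y m) = kOdd y (kActEven x m) - kOdd (br01 x y) m :=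
  LinearMap.congr_fun (f := kActEven x ∘ₗ kOdd y)
    (g := kOdd y ∘ₗ kActEven x - kOdd (br01 x y))
    (koszulSum_hom_ext fun u c => by
      simp only [LinearMap.comp_apply, LinearMap.sub_apply, kOdd_tmul, kActEven_tmul,
        evenAct_oddMul, TensorProduct.tmul_sub, map_add]
      abel) m

theorem kActOdd_kWedge (y : L1 L) (x : L0 L) (m : KoszulSum L) :
    kActOdd y (kWedge x m) = -kWedge x (kActOdd y m) - kOdd (br01 x y) m :=
  LinearMap.congr_fun (f := kActOdd y ∘ₗ kWedge x)
    (g := -(kWedge x ∘ₗ kActOdd y) - kOdd (br01 x y))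
    (koszulSum_hom_ext fun u c => by
      simp only [LinearMap.comp_apply, LinearMap.sub_apply, LinearMap.neg_apply, kOdd_tmul,
        kWedge_tmul, kActOdd_tmul, oddAct_wedge, chainSign_wedge, TensorProduct.tmul_sub,
        TensorProduct.tmul_neg, map_add]
      abel) m

theorem kActOdd_kOdd (y y' : L1 L) (m : KoszulSum L) :
    kActOdd y (kOdd y' m) = kOdd y' (kActOdd y m) - kWedge (br11 y y') m :=
  LinearMap.congr_fun (f := kActOdd y ∘ₗ kOdd y')
    (g := kOdd y' ∘ₗ kActOdd y - kWedge (br11 y y'))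
    (koszulSum_hom_ext fun u c => by
      simp only [LinearMap.comp_apply, LinearMap.sub_apply, kOdd_tmul,
        kWedge_tmul, kActOdd_tmul, oddAct_oddMul, chainSign_oddMul, TensorProduct.tmul_sub,
        map_add]
      abel) m

@[simp]
theorem kActEven_nil (x : L0 L) (u : Env L) :
    kActEven x (u ⊗ₜ emptyChain L) = (u * envι L x) ⊗ₜ emptyChain L := by
  simp [emptyChain, evenAct_nil]

@[simp]
theorem kActOdd_nil (y : L1 L) (u : Env L) :
    kActOdd y (u ⊗ₜ emptyChain L) = (u * envι L y) ⊗ₜ emptyChain L := by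
  simp [emptyChain, oddAct_nil]

@[simp]
theorem kD_nil (u : Env L) : kD L (u ⊗ₜ emptyChain L) = 0 := by
  simp [emptyChain, chainSumD_nil, chainSumCo_nil]

theorem kWedge_add (x x' : L0 L) (m : KoszulSum L) :
    kWedge (x + x') m = kWedge x m + kWedge x' m := by simp [kWedge]

theorem kWedge_neg (x : L0 L) (m : KoszulSum L) : kWedge (-x) m = -kWedge x m := by simp [kWedge]

theorem kOdd_zero (m : KoszulSum L) : kOdd 0 m = 0 := by simp [kOdd]

theorem kOdd_add (y y' : L1 L) (m : KoszulSum L) :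
    kOdd (y + y') m = kOdd y m + kOdd y' m := by simp [kOdd]

/-- The operators θ form a right action, whence the minus sign at the bracket. On u ⊗ 1 it is the
relation of U; the induction steps are Jacobi identities. The same pattern proves the two mixed and
odd versions. -/
theorem kActEven_kActEven (x x' : L0 L) (m : KoszulSum L) :
    kActEven x (kActEven x' m) = kActEven x' (kActEven x m) - kActEven (br00 x x') m := by
  induction m using koszulSum_induction with
  | hadd a b ha hb => simp only [map_add, ha, hb]; abel
  | hnil u =>
    simp only [kActEven_nil, envι_br00, mul_assoc, mul_sub, TensorProduct.sub_tmul]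
    abel
  | hwedge w m hm =>
    simp only [kActEven_kWedge, map_sub, hm, br00_br00 x x' w, kWedge_add]
    abel
  | hodd y m hm =>
    simp only [kActEven_kOdd, map_sub, hm, br01_br01 x x' y, kOdd_add]
    abel

theorem kActEven_kActOdd (x : L0 L) (y : L1 L) (m : KoszulSum L) :
    kActEven x (kActOdd y m) = kActOdd y (kActEven x m) - kActOdd (br01 x y) m := by
  induction m using koszulSum_induction with
  | hadd a b ha hb => simp only [map_add, ha, hb]; abel
  | hnil u =>
    simp only [kActEven_nil, kActOdd_nil, envι_br01, mul_assoc, mul_sub, TensorProduct.sub_tmul]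
    abel
  | hwedge w m hm =>
    simp only [kActEven_kWedge, kActOdd_kWedge, kActEven_kOdd, map_sub, map_neg, hm,
      br01_br01 x w y, kOdd_add]
    abel
  | hodd y' m hm =>
    simp only [kActEven_kOdd, kActOdd_kOdd, kActEven_kWedge, map_sub, hm, br00_br11 x y y',
      kWedge_add]
    abel

theorem kActOdd_kActOdd (y y' : L1 L) (m : KoszulSum L) :
    kActOdd y (kActOdd y' m) = -kActOdd y' (kActOdd y m) + kActEven (br11 y y') m := by
  induction m using koszulSum_induction with
  | hadd a b ha hb => simp only [map_add, ha, hb]; abel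
  | hnil u =>
    simp only [kActEven_nil, kActOdd_nil, envι_br11, mul_assoc, mul_add, TensorProduct.add_tmul]
    abel
  | hwedge w m hm =>
    simp only [kActEven_kWedge, kActOdd_kWedge, kActOdd_kOdd, map_sub, map_neg, hm, map_add,
      br00_antisymm (br11 y y') w, br00_br11 w y y', br11_symm y' (br01 w y), kWedge_neg, kWedge_add]
    abel
  | hodd z m hm =>
    simp only [kActEven_kOdd, kActOdd_kOdd, kActOdd_kWedge, map_sub, map_neg, hm, map_add]
    -- The three multiplications by double brackets left over are those in the odd Jacobi identity.
    have h := congrArg (fun w => kOdd w m) (br01_br11 y y' z)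
    simp only [kOdd_add, kOdd_zero] at h
    linear_combination (norm := module) h

/-- Passing D and θ_x over a multiplication e_w produces the commutator of θ_x with θ_w and the
operator θ of the bracket, which cancel. -/
theorem kD_kActEven (x : L0 L) (m : KoszulSum L) :
    kD L (kActEven x m) = kActEven x (kD L m) := by
  induction m using koszulSum_induction with
  | hadd a b ha hb => simp only [map_add, ha, hb]
  | hnil u => simp only [kActEven_nil, kD_nil, map_zero]
  | hwedge w m hm =>
    simp only [kActEven_kWedge, kD_kWedge, map_sub, hm, kActEven_kActEven x w]
    abel
  | hodd z m hm =>
    simp only [kActEven_kOdd, kD_kOdd, map_sub, map_add, hm, kActEven_kActOdd x z]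
    abel

theorem kD_kActOdd (y : L1 L) (m : KoszulSum L) :
    kD L (kActOdd y m) = -kActOdd y (kD L m) := by
  induction m using koszulSum_induction with
  | hadd a b ha hb => simp only [map_add, ha, hb]; abel
  | hnil u => simp only [kActOdd_nil, kD_nil, map_zero, neg_zero]
  | hwedge w m hm =>
    simp only [kActOdd_kWedge, kD_kWedge, kD_kOdd, map_sub, map_neg, hm, kActEven_kActOdd w y]
    abel
  | hodd z m hm =>
    simp only [kActOdd_kOdd, kD_kWedge, kD_kOdd, map_sub, map_add, map_neg, hm, kActOdd_kActOdd y z]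
    abel

/-- D²(e_x m) = θ_x Dm - (θ_x Dm - e_x D²m) = e_x D²m, and likewise for e_y, where D anticommutes
with θ_y; on u ⊗ 1 already D vanishes. -/
theorem kD_kD (m : KoszulSum L) : kD L (kD L m) = 0 := by
  induction m using koszulSum_induction with
  | hadd a b ha hb => simp only [map_add, ha, hb, add_zero]
  | hnil u => simp only [kD_nil, map_zero]
  | hwedge w m hm => simp [kD_kWedge, kD_kActEven, hm]
  | hodd z m hm => simp [kD_kOdd, kD_kActOdd, hm]

end KoszulSum

/-! ## Projections onto the even and the odd part -/

section Projections

variable {L : Type u} [AddCommGroup L] [Module ℂ L] [LieSuperalgebra L]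

theorem zmod_two_cases : ∀ a : ZMod 2, a = 0 ∨ a = 1 := by decide

variable (L) in
theorem bijective_coeLinearMap_part :
    Function.Bijective (DirectSum.coeLinearMap (part (L := L))) := isInternal

/-- The projection of `L` onto a homogeneous component. -/
def projPart (a : ZMod 2) : L →ₗ[ℂ] part (L := L) a :=
  DirectSum.component ℂ (ZMod 2) (fun a => part (L := L) a) a ∘ₗ
    (LinearEquiv.ofBijective _ (bijective_coeLinearMap_part L)).symm.toLinearMap

theorem projPart_coe (a b : ZMod 2) (x : part (L := L) b) :
    projPart a (x : L) = if h : b = a then h ▸ x else 0 := by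
  have h : (LinearEquiv.ofBijective _ (bijective_coeLinearMap_part L)).symm x =
      DirectSum.lof ℂ (ZMod 2) (fun a => part (L := L) a) b x := by
    rw [LinearEquiv.symm_apply_eq, LinearEquiv.ofBijective_apply, DirectSum.coeLinearMap_lof]
  rw [projPart, LinearMap.comp_apply, LinearEquiv.coe_coe, h]
  exact DirectSum.component.of ..

theorem projPart_self (a : ZMod 2) (x : part (L := L) a) : projPart a (x : L) = x := by
  rw [projPart_coe, dif_pos rfl]

@[simp]
theorem projPart_zero_even (x : L0 L) : projPart 0 (x : L) = x := projPart_self 0 x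

@[simp]
theorem projPart_one_odd (y : L1 L) : projPart 1 (y : L) = y := projPart_self 1 y

@[simp]
theorem projPart_one_even (x : L0 L) : projPart 1 (x : L) = 0 := by
  rw [projPart_coe, dif_neg (by decide)]

@[simp]
theorem projPart_zero_odd (y : L1 L) : projPart 0 (y : L) = 0 := by
  rw [projPart_coe, dif_neg (by decide)]

theorem projPart_add_projPart (z : L) : (projPart 0 z : L) + (projPart 1 z : L) = z := by
  have h : (part (L := L) 0).subtype ∘ₗ projPart 0 + (part (L := L) 1).subtype ∘ₗ projPart 1 =
      LinearMap.id := by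
    have hs := (isInternal (L := L)).submodule_iSup_eq_top
    refine LinearMap.ext fun z => ?_
    have hz : z ∈ ⨆ a, part (L := L) a := by rw [hs]; trivial
    induction hz using Submodule.iSup_induction' with
    | zero => simp
    | add a b _ _ ha hb => rw [map_add, map_add, ha, hb]
    | mem a z hz =>
      have ha := zmod_two_cases a
      rcases ha with rfl | rfl
      · have h0 := projPart_zero_even (⟨z, hz⟩ : L0 L)
        have h1 := projPart_one_even (⟨z, hz⟩ : L0 L)
        simp at h0 h1
        simp [h0, h1]
      · have h0 := projPart_zero_odd (⟨z, hz⟩ : L1 L)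
        have h1 := projPart_one_odd (⟨z, hz⟩ : L1 L)
        simp at h0 h1
        simp [h0, h1]
  exact LinearMap.congr_fun h z

/-- The parity automorphism of `L`. -/
def parity : L →ₗ[ℂ] L :=
  (part (L := L) 0).subtype ∘ₗ projPart 0 - (part (L := L) 1).subtype ∘ₗ projPart 1

@[simp]
theorem parity_even (x : L0 L) : parity (x : L) = x := by simp [parity]

@[simp]
theorem parity_odd (y : L1 L) : parity (y : L) = -y := by simp [parity]

theorem projPart_zero_parity (z : L) : projPart 0 (parity z) = projPart 0 z := by
  simp [parity]

theorem projPart_one_parity (z : L) : projPart 1 (parity z) = -projPart 1 z := by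
  simp [parity]

theorem parity_parity (z : L) : parity (parity z) = z := by
  conv_rhs => rw [← projPart_add_projPart z]
  conv_lhs => rw [← projPart_add_projPart z]
  simp

variable {A : Type*} [Ring A] [Algebra ℂ A]

/-- The universal property of the enveloping algebra in terms of even and odd elements. -/
def envLiftParts (f₀ : L0 L →ₗ[ℂ] A) (f₁ : L1 L →ₗ[ℂ] A)
    (h₀₀ : ∀ x x', f₀ (br00 x x') = f₀ x * f₀ x' - f₀ x' * f₀ x)
    (h₀₁ : ∀ x y, f₁ (br01 x y) = f₀ x * f₁ y - f₁ y * f₀ x)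
    (h₁₁ : ∀ y y', f₀ (br11 y y') = f₁ y * f₁ y' + f₁ y' * f₁ y) : Env L →ₐ[ℂ] A :=
  envLift (f₀ ∘ₗ projPart 0 + f₁ ∘ₗ projPart 1) fun a b x hx y hy => by
    have ha := zmod_two_cases a
    have hb := zmod_two_cases b
    rcases ha with rfl | rfl <;> rcases hb with rfl | rfl
    · lift x to L0 L using hx
      lift y to L0 L using hy
      rw [← coe_br00]
      simpa [superSign_zero_left] using h₀₀ x y
    · lift x to L0 L using hx
      lift y to L1 L using hy
      rw [← coe_br01]
      simpa [superSign_zero_left] using h₀₁ x y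
    · lift x to L1 L using hx
      lift y to L0 L using hy
      -- The relation between an odd and an even element is the negative of the one in the other
      -- order.
      have h := sbracket_antisymm 1 0 _ x.2 _ y.2
      rw [superSign_zero_right, one_smul, ← coe_br01] at h
      rw [h, map_neg]
      simpa [superSign_zero_right] using congrArg (fun a => -a) (h₀₁ y x)
    · lift x to L1 L using hx
      lift y to L1 L using hy
      rw [← coe_br11]
      simpa [superSign_one_one] using h₁₁ x y

@[simp]
theorem envLiftParts_even (f₀ : L0 L →ₗ[ℂ] A) (f₁ : L1 L →ₗ[ℂ] A) (h₀₀ h₀₁ h₁₁) (x : L0 L) :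
    envLiftParts f₀ f₁ h₀₀ h₀₁ h₁₁ (envι L x) = f₀ x := by
  simp [envLiftParts]

@[simp]
theorem envLiftParts_odd (f₀ : L0 L →ₗ[ℂ] A) (f₁ : L1 L →ₗ[ℂ] A) (h₀₀ h₀₁ h₁₁) (y : L1 L) :
    envLiftParts f₀ f₁ h₀₀ h₀₁ h₁₁ (envι L y) = f₁ y := by
  simp [envLiftParts]

/-- Induction over `U(L)` by right multiplication with even and odd elements. -/
theorem env_induction_parts {P : Env L → Prop} (h1 : P 1) (hadd : ∀ u v, P u → P v → P (u + v))
    (hsmul : ∀ (r : ℂ) u, P u → P (r • u)) (heven : ∀ u (x : L0 L), P u → P (u * envι L x))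
    (hodd : ∀ u (y : L1 L), P u → P (u * envι L y)) (u : Env L) : P u :=
  env_induction h1 hadd hsmul (fun u z hu => by
    rw [← projPart_add_projPart z, map_add, mul_add]
    exact hadd _ _ (heven _ _ hu) (hodd _ _ hu)) u

end Projections

/-! ## The coproduct of the enveloping algebra -/

section Coproduct

variable (L : Type u) [AddCommGroup L] [Module ℂ L] [LieSuperalgebra L]

/-- The parity automorphism of `U(L)`. -/
def envParity : Env L →ₐ[ℂ] Env L :=
  envLiftParts (envι L ∘ₗ (part (L := L) 0).subtype) (-(envι L ∘ₗ (part (L := L) 1).subtype))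
    (fun x x' => envι_br00 x x') (fun x y => by simp [envι_br01]; abel)
    (fun y y' => by simp [envι_br11])

@[simp]
theorem envParity_even (x : L0 L) : envParity L (envι L x) = envι L x :=
  envLiftParts_even ..

@[simp]
theorem envParity_odd (y : L1 L) : envParity L (envι L y) = -envι L y :=
  envLiftParts_odd ..

@[simp]
theorem envParity_envParity (u : Env L) : envParity L (envParity L u) = u := by
  induction u using env_induction_parts with
  | h1 => simp
  | hadd u v hu hv => simp [hu, hv]
  | hsmul r u hu => simp [hu]
  | heven u x hu => simp [hu]
  | hodd u y hu => simp [hu]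

variable {L}

/-- Right multiplication by the coproduct of an even element. -/
def copEven : L0 L →ₗ[ℂ] Module.End ℂ (Env L ⊗[ℂ] Env L) where
  toFun x := LinearMap.rTensor _ (LinearMap.mulRight ℂ (envι L x)) +
    LinearMap.lTensor _ (LinearMap.mulRight ℂ (envι L x))
  map_add' x x' := TensorProduct.ext' fun a b => by
    simp [mul_add, TensorProduct.add_tmul, TensorProduct.tmul_add]
    abel
  map_smul' r x := TensorProduct.ext' fun a b => by
    simp [TensorProduct.smul_tmul']

/-- Right multiplication by the coproduct of an odd element. -/
def copOdd : L1 L →ₗ[ℂ] Module.End ℂ (Env L ⊗[ℂ] Env L) where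
  -- The parity automorphism is the sign for moving y past the second factor.
  toFun y := TensorProduct.map (LinearMap.mulRight ℂ (envι L y)) (envParity L).toLinearMap +
    LinearMap.lTensor _ (LinearMap.mulRight ℂ (envι L y))
  map_add' x x' := TensorProduct.ext' fun a b => by
    simp [mul_add, TensorProduct.add_tmul, TensorProduct.tmul_add]
    abel
  map_smul' r x := TensorProduct.ext' fun a b => by
    simp [TensorProduct.smul_tmul']

@[simp]
theorem copEven_tmul (x : L0 L) (a b : Env L) :
    copEven x (a ⊗ₜ b) = (a * envι L x) ⊗ₜ b + a ⊗ₜ (b * envι L x) := rfl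

@[simp]
theorem copOdd_tmul (y : L1 L) (a b : Env L) :
    copOdd y (a ⊗ₜ b) = (a * envι L y) ⊗ₜ envParity L b + a ⊗ₜ (b * envι L y) := rfl

variable (L) in
/-- The right action of `U(L)` on `U(L) ⊗ U(L)` through the coproduct. -/
def copRep : Env L →ₐ[ℂ] (Module.End ℂ (Env L ⊗[ℂ] Env L))ᵐᵒᵖ :=
  -- A right action is a homomorphism to the opposite of the endomorphism algebra. The mixed terms
  -- of each relation cancel because of the signs in `copOdd`.
  envLiftParts ((MulOpposite.opLinearEquiv ℂ).toLinearMap ∘ₗ copEven)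
    ((MulOpposite.opLinearEquiv ℂ).toLinearMap ∘ₗ copOdd)
    (fun x x' => MulOpposite.unop_injective (TensorProduct.ext' fun a b => by
      simp [envι_br00, mul_sub, TensorProduct.sub_tmul, TensorProduct.tmul_sub, mul_assoc]
      abel))
    (fun x y => MulOpposite.unop_injective (TensorProduct.ext' fun a b => by
      simp [envι_br01, mul_sub, TensorProduct.sub_tmul, TensorProduct.tmul_sub, mul_assoc]
      abel))
    (fun y y' => MulOpposite.unop_injective (TensorProduct.ext' fun a b => by
      simp [envι_br11, mul_add, TensorProduct.add_tmul, TensorProduct.tmul_add, mul_assoc,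
        TensorProduct.tmul_neg]
      abel))

variable (L) in
/-- The coproduct of `U(L)`. -/
def coproduct : Env L →ₗ[ℂ] Env L ⊗[ℂ] Env L :=
  LinearMap.applyₗ (1 ⊗ₜ 1) ∘ₗ (MulOpposite.opLinearEquiv ℂ).symm.toLinearMap ∘ₗ
    (copRep L).toLinearMap

theorem coproduct_one : coproduct L 1 = 1 ⊗ₜ 1 := by simp [coproduct]

theorem coproduct_mul_even (u : Env L) (x : L0 L) :
    coproduct L (u * envι L x) = copEven x (coproduct L u) := by simp [coproduct, copRep]

theorem coproduct_mul_odd (u : Env L) (y : L1 L) :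
    coproduct L (u * envι L y) = copOdd y (coproduct L u) := by simp [coproduct, copRep]

end Coproduct

/-! ### Normalizing the retraction. -/

section EvenRetraction

variable (L : Type u) [AddCommGroup L] [Module ℂ L] [LieSuperalgebra L]

theorem envAug_ι (z : L) : envAug L (envι L z) = 0 := by
  refine (RingQuot.liftAlgHom_mkAlgHom_apply ℂ _ _ _).trans ?_
  simp

/-- Subtracting a multiple of the augmentation forces g(1) = 0 without changing g on L, where the
augmentation vanishes. Averaging over the parity automorphism then keeps both properties. -/
theorem exists_even_retraction : ∃ g : Env L →ₗ[ℂ] L, (∀ z, g (envι L z) = z) ∧ g 1 = 0 ∧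
    ∀ u, g (envParity L u) = parity (g u) := by
  obtain ⟨g, hg⟩ := exists_retraction L
  let g' : Env L →ₗ[ℂ] L := g - (envAug L).toLinearMap.smulRight (g 1)
  have h1 : ∀ z, g' (envι L z) = z := fun z => by simp [g', hg, envAug_ι]
  have h2 : g' 1 = 0 := by simp [g']
  refine ⟨(1 / 2 : ℂ) • (g' + parity ∘ₗ g' ∘ₗ (envParity L).toLinearMap), fun z => ?_, ?_,
    fun u => ?_⟩
  · have h3 : parity (g' (envParity L (envι L z))) = z := by
      rw [← projPart_add_projPart z]
      simp only [map_add, envParity_even, envParity_odd, map_neg, h1, parity_even, parity_odd,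
        neg_neg]
    simp only [LinearMap.smul_apply, LinearMap.add_apply, h1, LinearMap.comp_apply,
      AlgHom.toLinearMap_apply, h3]
    module
  · simp [h2]
  · simp only [LinearMap.smul_apply, LinearMap.add_apply, LinearMap.comp_apply,
      AlgHom.toLinearMap_apply, envParity_envParity, map_smul, map_add, parity_parity]
    module

end EvenRetraction

/-! ## The contracting homotopy -/

section Homotopy

variable {L : Type u} [AddCommGroup L] [Module ℂ L] [LieSuperalgebra L]

/-- Multiplication of chains by an element of `L`. -/
def chainMul : L →ₗ[ℂ] ChainSum L →ₗ[ℂ] ChainSum L :=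
  wedge ∘ₗ projPart 0 + LinearMap.lcomp ℂ (ChainSum L) chainSign ∘ₗ oddMul ∘ₗ projPart 1

theorem chainMul_apply (w : L) (c : ChainSum L) :
    chainMul w c = wedge (projPart 0 w) c + oddMul (projPart 1 w) (chainSign c) := rfl

/-- The factor `chainSign` in the odd part of `chainMul` makes the sign here, and in
`chainMul_oddMul`, independent of the parity of w. -/
theorem chainMul_wedge (w : L) (x : L0 L) (c : ChainSum L) :
    chainMul w (wedge x c) = -wedge x (chainMul w c) := by
  simp only [chainMul_apply, chainSign_wedge, map_add, map_neg, oddMul_wedge,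
    wedge_wedge (projPart 0 w)]
  abel

theorem chainMul_oddMul (w : L) (y : L1 L) (c : ChainSum L) :
    chainMul w (oddMul y c) = oddMul y (chainMul w c) := by
  simp only [chainMul_apply, chainSign_oddMul, map_add, oddMul_wedge,
    oddMul_oddMul (projPart 1 w)]

/-- The bracket with an even element, on the sum of `L₀` and `L₁`. -/
def evenBracket (x : L0 L) : L →ₗ[ℂ] L :=
  (part (L := L) 0).subtype ∘ₗ br00 x ∘ₗ projPart 0 +
    (part (L := L) 1).subtype ∘ₗ br01 x ∘ₗ projPart 1

/-- The map by which multiplication of chains anticommutes with the action of an odd element. -/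
def oddBracket (y : L1 L) : L →ₗ[ℂ] L :=
  -((part (L := L) 1).subtype ∘ₗ br01.flip y ∘ₗ projPart 0 +
    (part (L := L) 0).subtype ∘ₗ br11 y ∘ₗ projPart 1)

theorem chainMul_evenAct (w : L) (x : L0 L) (c : ChainSum L) :
    chainMul w (evenAct x c) = evenAct x (chainMul w c) + chainMul (evenBracket x w) c := by
  simp only [chainMul_apply, evenBracket, chainSign_evenAct, map_add, evenAct_wedge,
    evenAct_oddMul, LinearMap.add_apply, LinearMap.comp_apply, Submodule.subtype_apply,
    projPart_zero_even, projPart_one_even, projPart_zero_odd, projPart_one_odd, map_zero,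
    LinearMap.zero_apply]
  abel

theorem chainMul_oddAct (w : L) (y : L1 L) (c : ChainSum L) :
    chainMul w (oddAct y c) =
      -oddAct y (chainMul w c) + chainMul (oddBracket y w) (chainSign c) := by
  simp only [chainMul_apply, oddBracket, chainSign_oddAct, chainSign_chainSign, map_add, map_neg,
    oddAct_wedge, oddAct_oddMul, LinearMap.add_apply, LinearMap.comp_apply, LinearMap.neg_apply,
    Submodule.subtype_apply, LinearMap.flip_apply,
    projPart_zero_even, projPart_one_even, projPart_zero_odd, projPart_one_odd, map_zero,
    LinearMap.zero_apply]
  abel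

theorem chainMul_parity (w : L) (c : ChainSum L) :
    chainMul (parity w) (chainSign c) = -chainSign (chainMul w c) := by
  simp only [chainMul_apply, projPart_zero_parity, projPart_one_parity, map_add, map_neg,
    chainSign_wedge, chainSign_oddMul, chainSign_chainSign, LinearMap.neg_apply]
  abel

/-- Multiplication of chains by the image of the second factor of `U(L) ⊗ U(L)` under a linear
map. -/
def copMul (g : Env L →ₗ[ℂ] L) : Env L ⊗[ℂ] Env L →ₗ[ℂ] ChainSum L →ₗ[ℂ] KoszulSum L :=
  TensorProduct.lift ((LinearMap.llcomp ℂ (ChainSum L) (ChainSum L) (KoszulSum L)).compl₁₂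
    (TensorProduct.mk ℂ (Env L) (ChainSum L)) (chainMul ∘ₗ g))

@[simp]
theorem copMul_tmul (g : Env L →ₗ[ℂ] L) (a b : Env L) (c : ChainSum L) :
    copMul g (a ⊗ₜ b) c = a ⊗ₜ chainMul (g b) c := rfl

/-- The homotopy `u ⊗ c ↦ ∑ u' ⊗ (g(u'') c)`, where the coproduct of `u` is `∑ u' ⊗ u''`. -/
def homotopy (g : Env L →ₗ[ℂ] L) : KoszulSum L →ₗ[ℂ] KoszulSum L :=
  TensorProduct.lift (copMul g ∘ₗ coproduct L)

@[simp]
theorem homotopy_tmul (g : Env L →ₗ[ℂ] L) (u : Env L) (c : ChainSum L) :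
    homotopy g (u ⊗ₜ c) = copMul g (coproduct L u) c := rfl

/-- Right multiplication in the first factor of `U(L) ⊗ C(L)`. -/
def kMulRight (z : L) : KoszulSum L →ₗ[ℂ] KoszulSum L :=
  LinearMap.rTensor _ (LinearMap.mulRight ℂ (envι L z))

@[simp]
theorem kMulRight_tmul (z : L) (u : Env L) (c : ChainSum L) :
    kMulRight z (u ⊗ₜ c) = (u * envι L z) ⊗ₜ c := rfl

variable (L) in
/-- The sign operator on `U(L) ⊗ C(L)`. -/
def kSign : KoszulSum L →ₗ[ℂ] KoszulSum L := LinearMap.lTensor _ chainSign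

@[simp]
theorem kSign_tmul (u : Env L) (c : ChainSum L) : kSign L (u ⊗ₜ c) = u ⊗ₜ chainSign c := rfl

/-- The homotopy touches chains only through `chainMul`, so the signs are those of `chainMul`,
whatever g is. -/
theorem homotopy_kWedge (g : Env L →ₗ[ℂ] L) (x : L0 L) (m : KoszulSum L) :
    homotopy g (kWedge x m) = -kWedge x (homotopy g m) := by
  have key : ∀ t c, copMul g t (wedge x c) = -kWedge x (copMul g t c) := fun t c => by
    induction t with
    | zero => simp
    | add a b ha hb => simp only [map_add, LinearMap.add_apply, ha, hb]; abel
    | tmul a b => simp [chainMul_wedge, TensorProduct.tmul_neg]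
  induction m using TensorProduct.induction_on with
  | zero => simp
  | add a b ha hb => simp only [map_add, ha, hb]; abel
  | tmul u c => exact key _ _

theorem homotopy_kOdd (g : Env L →ₗ[ℂ] L) (y : L1 L) (m : KoszulSum L) :
    homotopy g (kOdd y m) = kOdd y (homotopy g m) := by
  have key : ∀ t c, copMul g t (oddMul y c) = kOdd y (copMul g t c) := fun t c => by
    induction t with
    | zero => simp
    | add a b ha hb => simp only [map_add, LinearMap.add_apply, ha, hb]
    | tmul a b => simp [chainMul_oddMul]
  induction m using TensorProduct.induction_on with
  | zero => simp
  | add a b ha hb => simp only [map_add, ha, hb]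
  | tmul u c => exact key _ _

/-- The coproduct of ux is that of u times x ⊗ 1 + 1 ⊗ x; the second summand is absorbed into g. -/
theorem homotopy_kMulRight_even (g : Env L →ₗ[ℂ] L) (x : L0 L) (m : KoszulSum L) :
    homotopy g (kMulRight (x : L) m) = kMulRight (x : L) (homotopy g m) +
      homotopy (g ∘ₗ LinearMap.mulRight ℂ (envι L x)) m := by
  have key : ∀ t c, copMul g (copEven x t) c = kMulRight (x : L) (copMul g t c) +
      copMul (g ∘ₗ LinearMap.mulRight ℂ (envι L x)) t c := fun t c => by
    induction t with
    | zero => simp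
    | add a b ha hb => simp only [map_add, LinearMap.add_apply, ha, hb]; abel
    | tmul a b => simp
  induction m using TensorProduct.induction_on with
  | zero => simp
  | add a b ha hb => simp only [map_add, ha, hb]; abel
  | tmul u c =>
    rw [kMulRight_tmul, homotopy_tmul, coproduct_mul_even, key]
    rfl

theorem homotopy_kMulRight_odd (g : Env L →ₗ[ℂ] L) (y : L1 L) (m : KoszulSum L) :
    homotopy g (kMulRight (y : L) m) = kMulRight (y : L) (homotopy (g ∘ₗ (envParity L).toLinearMap) m) +
      homotopy (g ∘ₗ LinearMap.mulRight ℂ (envι L y)) m := by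
  have key : ∀ t c, copMul g (copOdd y t) c =
      kMulRight (y : L) (copMul (g ∘ₗ (envParity L).toLinearMap) t c) +
      copMul (g ∘ₗ LinearMap.mulRight ℂ (envι L y)) t c := fun t c => by
    induction t with
    | zero => simp
    | add a b ha hb => simp only [map_add, LinearMap.add_apply, ha, hb]; abel
    | tmul a b => simp
  induction m using TensorProduct.induction_on with
  | zero => simp
  | add a b ha hb => simp only [map_add, ha, hb]; abel
  | tmul u c =>
    rw [kMulRight_tmul, homotopy_tmul, coproduct_mul_odd, key]
    rfl

/-- The commutator of a homotopy with the action of x is again a homotopy, for another linear map.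
For this reason homotopies are considered for arbitrary g. -/
theorem homotopy_kActEven (g : Env L →ₗ[ℂ] L) (x : L0 L) (m : KoszulSum L) :
    homotopy g (kActEven x m) = kActEven x (homotopy g m) +
      homotopy (g ∘ₗ LinearMap.mulRight ℂ (envι L x) + evenBracket x ∘ₗ g) m := by
  have key : ∀ t c, copMul g (copEven x t) c + copMul g t (evenAct x c) =
      kActEven x (copMul g t c) +
      copMul (g ∘ₗ LinearMap.mulRight ℂ (envι L x) + evenBracket x ∘ₗ g) t c := fun t c => by
    induction t with
    | zero => simp
    | add a b ha hb =>
      simp only [map_add, LinearMap.add_apply]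
      linear_combination (norm := module) ha + hb
    | tmul a b =>
      simp only [copEven_tmul, map_add, LinearMap.add_apply, copMul_tmul, chainMul_evenAct,
        kActEven_tmul, LinearMap.comp_apply, LinearMap.mulRight_apply, TensorProduct.tmul_add]
      abel
  induction m using TensorProduct.induction_on with
  | zero => simp
  | add a b ha hb => simp only [map_add, ha, hb]; abel
  | tmul u c =>
    rw [kActEven_tmul, map_add, homotopy_tmul, coproduct_mul_even]
    exact key _ _

/-- Compatibility of g with parity turns the parity twist in the coproduct of uy into a sign on
chains, as in `chainMul_parity`; otherwise the twisted term would not match the action of y. -/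
theorem homotopy_kActOdd (g : Env L →ₗ[ℂ] L) (hg : ∀ u, g (envParity L u) = parity (g u))
    (y : L1 L) (m : KoszulSum L) :
    homotopy g (kActOdd y m) = -kActOdd y (homotopy g m) +
      homotopy (g ∘ₗ LinearMap.mulRight ℂ (envι L y) + oddBracket y ∘ₗ g) (kSign L m) := by
  have key : ∀ t c, copMul g (copOdd y t) (chainSign c) + copMul g t (oddAct y c) =
      -kActOdd y (copMul g t c) +
      copMul (g ∘ₗ LinearMap.mulRight ℂ (envι L y) + oddBracket y ∘ₗ g) t (chainSign c) :=
      fun t c => by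
    induction t with
    | zero => simp
    | add a b ha hb =>
      simp only [map_add, LinearMap.add_apply]
      linear_combination (norm := module) ha + hb
    | tmul a b =>
      simp only [copOdd_tmul, map_add, LinearMap.add_apply, copMul_tmul, chainMul_oddAct, hg,
        chainMul_parity, kActOdd_tmul, LinearMap.comp_apply, LinearMap.mulRight_apply,
        TensorProduct.tmul_add, TensorProduct.tmul_neg]
      abel
  induction m using TensorProduct.induction_on with
  | zero => simp
  | add a b ha hb => simp only [map_add, ha, hb]; abel
  | tmul u c =>
    rw [kActOdd_tmul, map_add, homotopy_tmul, coproduct_mul_odd]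
    exact key _ _

end Homotopy

/-! ## The filtration of the Koszul complex -/

section Filtration

variable {L : Type u} [AddCommGroup L] [Module ℂ L] [LieSuperalgebra L]

/-- Multiplication by an element of `L` in the second factor of `U(L) ⊗ C(L)`. -/
def kMul (w : L) : KoszulSum L →ₗ[ℂ] KoszulSum L := LinearMap.lTensor _ (chainMul w)

theorem kMul_eq (w : L) (m : KoszulSum L) :
    kMul w m = kWedge (projPart 0 w) m + kOdd (projPart 1 w) (kSign L m) := by
  induction m using TensorProduct.induction_on with
  | zero => simp
  | add a b ha hb => simp only [map_add, ha, hb]; abel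
  | tmul u c => simp [kMul, chainMul_apply, TensorProduct.tmul_add]

@[simp]
theorem kSign_kSign (m : KoszulSum L) : kSign L (kSign L m) = m := by
  induction m using TensorProduct.induction_on with
  | zero => simp
  | add a b ha hb => simp only [map_add, ha, hb]
  | tmul u c => simp [chainSign_chainSign]

theorem kActEven_eq (x : L0 L) (m : KoszulSum L) :
    kActEven x m = kMulRight (x : L) m + LinearMap.lTensor _ (evenAct x) m := rfl

theorem kActOdd_eq (y : L1 L) (m : KoszulSum L) :
    kActOdd y m = kMulRight (y : L) (kSign L m) + LinearMap.lTensor _ (oddAct y) m := by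
  induction m using TensorProduct.induction_on with
  | zero => simp
  | add a b ha hb => simp only [map_add, ha, hb]; abel
  | tmul u c => simp

theorem lTensor_kMulRight (f : ChainSum L →ₗ[ℂ] ChainSum L) (z : L) (m : KoszulSum L) :
    LinearMap.lTensor _ f (kMulRight z m) = kMulRight z (LinearMap.lTensor _ f m) := by
  induction m using TensorProduct.induction_on with
  | zero => simp
  | add a b ha hb => simp only [map_add, ha, hb]
  | tmul u c => simp

/-- The filtration of `U(L) ⊗ C(L)` in which the elements of `L`, in either factor, have degree
one. -/
inductive KoszulFilt : ℕ → KoszulSum L → Prop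
  | nil : KoszulFilt 0 (1 ⊗ₜ emptyChain L)
  | add {n m m'} : KoszulFilt n m → KoszulFilt n m' → KoszulFilt n (m + m')
  | smul {n m} (r : ℂ) : KoszulFilt n m → KoszulFilt n (r • m)
  | succ {n m} : KoszulFilt n m → KoszulFilt (n + 1) m
  | even {n m} (x : L0 L) : KoszulFilt n m → KoszulFilt (n + 1) (kMulRight (x : L) m)
  | odd {n m} (y : L1 L) : KoszulFilt n m → KoszulFilt (n + 1) (kMulRight (y : L) m)
  | wedge {n m} (x : L0 L) : KoszulFilt n m → KoszulFilt (n + 1) (kWedge x m)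
  | oddMul {n m} (y : L1 L) : KoszulFilt n m → KoszulFilt (n + 1) (kOdd y m)

namespace KoszulFilt

variable {n : ℕ} {m m' : KoszulSum L}

theorem neg (h : KoszulFilt n m) : KoszulFilt n (-m) := by
  rw [show -m = (-1 : ℂ) • m by module]
  exact h.smul (-1)

theorem sub (h : KoszulFilt n m) (h' : KoszulFilt n m') : KoszulFilt n (m - m') := by
  rw [sub_eq_add_neg]
  exact h.add h'.neg

theorem zero (n : ℕ) : KoszulFilt n (0 : KoszulSum L) := by
  induction n with
  | zero => simpa using (nil (L := L)).smul 0
  | succ n ih => exact ih.succ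

theorem mono {k : ℕ} (hnk : n ≤ k) (h : KoszulFilt n m) : KoszulFilt k m := by
  induction hnk with
  | refl => exact h
  | step _ ih => exact ih.succ

theorem sign (h : KoszulFilt n m) : KoszulFilt n (kSign L m) := by
  induction h with
  | nil => simpa [emptyChain] using nil
  | add _ _ h h' => rw [map_add]; exact h.add h'
  | smul r _ h => rw [map_smul]; exact h.smul r
  | succ _ h => exact h.succ
  | even x _ h => rw [kSign, lTensor_kMulRight]; exact h.even x
  | odd y _ h => rw [kSign, lTensor_kMulRight]; exact h.odd y
  | @wedge n m x _ h =>
    have : kSign L (kWedge x m) = -kWedge x (kSign L m) :=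
      LinearMap.congr_fun (f := kSign L ∘ₗ kWedge x) (g := -(kWedge x ∘ₗ kSign L))
        (koszulSum_hom_ext fun u c => by simp [chainSign_wedge, TensorProduct.tmul_neg]) m
    rw [this]
    exact (h.wedge x).neg
  | @oddMul n m y _ h =>
    have : kSign L (kOdd y m) = kOdd y (kSign L m) :=
      LinearMap.congr_fun (f := kSign L ∘ₗ kOdd y) (g := kOdd y ∘ₗ kSign L)
        (koszulSum_hom_ext fun u c => by simp [chainSign_oddMul]) m
    rw [this]
    exact h.oddMul y

/-- The element x enters only through brackets, so the number of factors from L does not grow. -/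
theorem evenAct (h : KoszulFilt n m) (x : L0 L) :
    KoszulFilt n (LinearMap.lTensor (Env L) (evenAct x) m) := by
  induction h with
  | nil =>
    simp only [LinearMap.lTensor_tmul, emptyChain, evenAct_nil, TensorProduct.tmul_zero]
    exact zero 0
  | add _ _ h h' => rw [map_add]; exact h.add h'
  | smul r _ h => rw [map_smul]; exact h.smul r
  | succ _ h => exact h.succ
  | even x' _ h => rw [lTensor_kMulRight]; exact h.even x'
  | odd y _ h => rw [lTensor_kMulRight]; exact h.odd y
  | @wedge n m x' hm h =>
    have : LinearMap.lTensor (Env L) (LieSuperalgebra.evenAct x) (kWedge x' m) =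
        kWedge x' (LinearMap.lTensor (Env L) (LieSuperalgebra.evenAct x) m) -
          kWedge (br00 x x') m :=
      LinearMap.congr_fun
        (f := LinearMap.lTensor (Env L) (LieSuperalgebra.evenAct x) ∘ₗ kWedge x')
        (g := kWedge x' ∘ₗ LinearMap.lTensor (Env L) (LieSuperalgebra.evenAct x) -
          kWedge (br00 x x'))
        (koszulSum_hom_ext fun u c => by simp [evenAct_wedge, TensorProduct.tmul_sub]) m
    rw [this]
    exact (h.wedge x').sub (hm.wedge _)
  | @oddMul n m y hm h =>
    have : LinearMap.lTensor (Env L) (LieSuperalgebra.evenAct x) (kOdd y m) =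
        kOdd y (LinearMap.lTensor (Env L) (LieSuperalgebra.evenAct x) m) - kOdd (br01 x y) m :=
      LinearMap.congr_fun
        (f := LinearMap.lTensor (Env L) (LieSuperalgebra.evenAct x) ∘ₗ kOdd y)
        (g := kOdd y ∘ₗ LinearMap.lTensor (Env L) (LieSuperalgebra.evenAct x) - kOdd (br01 x y))
        (koszulSum_hom_ext fun u c => by simp [evenAct_oddMul, TensorProduct.tmul_sub]) m
    rw [this]
    exact (h.oddMul y).sub (hm.oddMul _)

theorem oddAct (h : KoszulFilt n m) (y : L1 L) :
    KoszulFilt n (LinearMap.lTensor (Env L) (oddAct y) m) := by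
  induction h with
  | nil =>
    simp only [LinearMap.lTensor_tmul, emptyChain, oddAct_nil, TensorProduct.tmul_zero]
    exact zero 0
  | add _ _ h h' => rw [map_add]; exact h.add h'
  | smul r _ h => rw [map_smul]; exact h.smul r
  | succ _ h => exact h.succ
  | even x _ h => rw [lTensor_kMulRight]; exact h.even x
  | odd y _ h => rw [lTensor_kMulRight]; exact h.odd y
  | @wedge n m x hm h =>
    have : LinearMap.lTensor (Env L) (LieSuperalgebra.oddAct y) (kWedge x m) =
        -kWedge x (LinearMap.lTensor (Env L) (LieSuperalgebra.oddAct y) m) -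
          kOdd (br01 x y) m :=
      LinearMap.congr_fun
        (f := LinearMap.lTensor (Env L) (LieSuperalgebra.oddAct y) ∘ₗ kWedge x)
        (g := -(kWedge x ∘ₗ LinearMap.lTensor (Env L) (LieSuperalgebra.oddAct y)) -
          kOdd (br01 x y))
        (koszulSum_hom_ext fun u c => by
          simp [oddAct_wedge, TensorProduct.tmul_sub, TensorProduct.tmul_neg]) m
    rw [this]
    exact (h.wedge x).neg.sub (hm.oddMul _)
  | @oddMul n m y' hm h =>
    have : LinearMap.lTensor (Env L) (LieSuperalgebra.oddAct y) (kOdd y' m) =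
        kOdd y' (LinearMap.lTensor (Env L) (LieSuperalgebra.oddAct y) m) - kWedge (br11 y y') m :=
      LinearMap.congr_fun
        (f := LinearMap.lTensor (Env L) (LieSuperalgebra.oddAct y) ∘ₗ kOdd y')
        (g := kOdd y' ∘ₗ LinearMap.lTensor (Env L) (LieSuperalgebra.oddAct y) -
          kWedge (br11 y y'))
        (koszulSum_hom_ext fun u c => by simp [oddAct_oddMul, TensorProduct.tmul_sub]) m
    rw [this]
    exact (h.oddMul y').sub (hm.wedge _)

theorem actEven (h : KoszulFilt n m) (x : L0 L) : KoszulFilt (n + 1) (kActEven x m) := by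
  rw [kActEven_eq]
  exact (h.even x).add (h.evenAct x).succ

theorem actOdd (h : KoszulFilt n m) (y : L1 L) : KoszulFilt (n + 1) (kActOdd y m) := by
  rw [kActOdd_eq]
  exact (h.sign.odd y).add (h.oddAct y).succ

theorem mul (h : KoszulFilt n m) (w : L) : KoszulFilt (n + 1) (kMul w m) := by
  rw [kMul_eq]
  exact (h.wedge _).add (h.sign.oddMul _)

theorem kMulRight_even_eq (x : L0 L) (m : KoszulSum L) :
    kMulRight (x : L) m = kActEven x m - LinearMap.lTensor _ (LieSuperalgebra.evenAct x) m := by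
  rw [kActEven_eq]
  abel

theorem kMulRight_odd_eq (y : L1 L) (m : KoszulSum L) :
    kMulRight (y : L) m = kActOdd y (kSign L m) -
      LinearMap.lTensor _ (LieSuperalgebra.oddAct y) (kSign L m) := by
  rw [kActOdd_eq, kSign_kSign]
  abel

/-- Induction over the filtration, where the step may use the claim for everything of smaller
degree. -/
theorem induction_total {P : ℕ → KoszulSum L → Prop} (nil : P 0 (1 ⊗ₜ emptyChain L))
    (add : ∀ n m m', P n m → P n m' → P n (m + m')) (smul : ∀ n (r : ℂ) m, P n m → P n (r • m))
    (succ : ∀ n, (∀ m, KoszulFilt n m → P n m) → ∀ m, KoszulFilt n m → P (n + 1) m)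
    (even : ∀ n, (∀ m, KoszulFilt n m → P n m) → ∀ (x : L0 L) m, KoszulFilt n m →
      P (n + 1) (kMulRight (x : L) m))
    (odd : ∀ n, (∀ m, KoszulFilt n m → P n m) → ∀ (y : L1 L) m, KoszulFilt n m →
      P (n + 1) (kMulRight (y : L) m))
    (wedge : ∀ n, (∀ m, KoszulFilt n m → P n m) → ∀ (x : L0 L) m, KoszulFilt n m →
      P (n + 1) (kWedge x m))
    (oddMul : ∀ n, (∀ m, KoszulFilt n m → P n m) → ∀ (y : L1 L) m, KoszulFilt n m →
      P (n + 1) (kOdd y m))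
    (h : KoszulFilt n m) : P n m := by
  induction n using Nat.strong_induction_on generalizing m with
  | _ n ih =>
    induction h with
    | nil => exact nil
    | add _ _ h h' => exact add _ _ _ (h ih) (h' ih)
    | smul r _ h => exact smul _ _ _ (h ih)
    | succ hm _ => exact succ _ (fun _ => ih _ (Nat.lt_succ_self _)) _ hm
    | even x hm _ => exact even _ (fun _ => ih _ (Nat.lt_succ_self _)) x _ hm
    | odd y hm _ => exact odd _ (fun _ => ih _ (Nat.lt_succ_self _)) y _ hm
    | wedge x hm _ => exact wedge _ (fun _ => ih _ (Nat.lt_succ_self _)) x _ hm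
    | oddMul y hm _ => exact oddMul _ (fun _ => ih _ (Nat.lt_succ_self _)) y _ hm

/-- Right multiplication is θ minus the action on chains, and D passes through θ. The remaining term
applies the claim to the acted-on element instead of m, which is why `induction_total` is needed. -/
theorem differential (h : KoszulFilt n m) : KoszulFilt n (kD L m) := by
  refine induction_total (P := fun n m => KoszulFilt n (kD L m)) ?_ (fun n m m' h h' => ?_)
    (fun n r m h => ?_) (fun n ih m hm => (ih m hm).succ) (fun n ih x m hm => ?_)
    (fun n ih y m hm => ?_) (fun n ih x m hm => ?_) (fun n ih y m hm => ?_) h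
  · rw [kD_nil]
    exact zero 0
  · rw [map_add]
    exact h.add h'
  · rw [map_smul]
    exact h.smul r
  · rw [kMulRight_even_eq, map_sub, kD_kActEven]
    exact ((ih m hm).actEven x).sub (ih _ (hm.evenAct x)).succ
  · rw [kMulRight_odd_eq, map_sub, kD_kActOdd]
    exact ((ih _ hm.sign).actOdd y).neg.sub (ih _ (hm.sign.oddAct y)).succ
  · rw [kD_kWedge]
    exact (hm.actEven x).sub ((ih m hm).wedge x)
  · rw [kD_kOdd]
    exact (hm.actOdd y).add ((ih m hm).oddMul y)

theorem exists_filt (m : KoszulSum L) : ∃ n, KoszulFilt n m := by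
  induction m using koszulSum_induction with
  | hadd a b ha hb =>
    obtain ⟨n, hn⟩ := ha
    obtain ⟨k, hk⟩ := hb
    exact ⟨max n k, (hn.mono (le_max_left n k)).add (hk.mono (le_max_right n k))⟩
  | hnil u =>
    induction u using env_induction_parts with
    | h1 => exact ⟨0, nil⟩
    | hadd u v hu hv =>
      obtain ⟨n, hn⟩ := hu
      obtain ⟨k, hk⟩ := hv
      rw [TensorProduct.add_tmul]
      exact ⟨max n k, (hn.mono (le_max_left n k)).add (hk.mono (le_max_right n k))⟩
    | hsmul r u hu =>
      obtain ⟨n, hn⟩ := hu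
      rw [← TensorProduct.smul_tmul']
      exact ⟨n, hn.smul r⟩
    | heven u x hu =>
      obtain ⟨n, hn⟩ := hu
      exact ⟨n + 1, hn.even x⟩
    | hodd u y hu =>
      obtain ⟨n, hn⟩ := hu
      exact ⟨n + 1, hn.odd y⟩
  | hwedge x m hm =>
    obtain ⟨n, hn⟩ := hm
    exact ⟨n + 1, hn.wedge x⟩
  | hodd y m hm =>
    obtain ⟨n, hn⟩ := hm
    exact ⟨n + 1, hn.oddMul y⟩

/-- Up to terms of lower degree, the homotopy is multiplication by `g 1`. -/
theorem homotopy_sub (h : KoszulFilt n m) (g : Env L →ₗ[ℂ] L) :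
    KoszulFilt n (homotopy g m - kMul (g 1) m) := by
  have hsucc : ∀ {n : ℕ} {m : KoszulSum L} {g : Env L →ₗ[ℂ] L}, KoszulFilt n m →
      KoszulFilt n (homotopy g m - kMul (g 1) m) → KoszulFilt (n + 1) (homotopy g m) :=
    fun {n m g} hm h => by simpa using h.succ.add (hm.mul (g 1))
  -- Right multiplication by x replaces g by u ↦ g(ux), so the claim is needed for all g at once.
  induction h generalizing g with
  | nil =>
    simp only [homotopy_tmul, coproduct_one, copMul_tmul, kMul, LinearMap.lTensor_tmul, sub_self]
    exact zero 0
  | add _ _ h h' =>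
    rw [map_add, map_add, add_sub_add_comm]
    exact (h g).add (h' g)
  | smul r _ h =>
    rw [map_smul, map_smul, show ∀ a b : KoszulSum L, r • a - r • b = r • (a - b) from
      fun a b => by module]
    exact (h g).smul r
  | succ _ h => exact (h g).succ
  | @even n m x hm h =>
    rw [homotopy_kMulRight_even, kMul, lTensor_kMulRight, add_sub_right_comm, ← map_sub]
    exact ((h g).even x).add (hsucc hm (h _))
  | @odd n m y hm h =>
    have := h (g ∘ₗ (envParity L).toLinearMap)
    rw [LinearMap.comp_apply, AlgHom.toLinearMap_apply, map_one] at this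
    rw [homotopy_kMulRight_odd, kMul, lTensor_kMulRight, add_sub_right_comm, ← map_sub]
    exact (this.odd y).add (hsucc hm (h _))
  | @wedge n m x hm h =>
    have : kMul (g 1) (kWedge x m) = -kWedge x (kMul (g 1) m) :=
      LinearMap.congr_fun (f := kMul (g 1) ∘ₗ kWedge x) (g := -(kWedge x ∘ₗ kMul (g 1)))
        (koszulSum_hom_ext fun u c => by simp [kMul, chainMul_wedge, TensorProduct.tmul_neg]) m
    rw [homotopy_kWedge, this, ← neg_sub', ← map_sub]
    exact ((h g).wedge x).neg
  | @oddMul n m y hm h =>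
    have : kMul (g 1) (kOdd y m) = kOdd y (kMul (g 1) m) :=
      LinearMap.congr_fun (f := kMul (g 1) ∘ₗ kOdd y) (g := kOdd y ∘ₗ kMul (g 1))
        (koszulSum_hom_ext fun u c => by simp [kMul, chainMul_oddMul]) m
    rw [homotopy_kOdd, this, ← map_sub]
    exact (h g).oddMul y

/-- The leading term is multiplication by g(1); when it vanishes the homotopy does not raise the
filtration degree. -/
theorem homotopy_of_map_one {g : Env L →ₗ[ℂ] L} (hg : g 1 = 0) (h : KoszulFilt n m) :
    KoszulFilt n (homotopy g m) := by
  simpa [hg, kMul] using h.homotopy_sub g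

end KoszulFilt

end Filtration

/-! ## Exactness on the total space -/

section Exactness

variable {L : Type u} [AddCommGroup L] [Module ℂ L] [LieSuperalgebra L]

/-- The filtration by degree less than `n`. -/
def KoszulFiltLT : ℕ → KoszulSum L → Prop
  | 0, m => m = 0
  | n + 1, m => KoszulFilt n m

theorem kMul_even (x : L0 L) (m : KoszulSum L) : kMul (x : L) m = kWedge x m := by
  rw [kMul_eq, projPart_zero_even, projPart_one_even, kOdd_zero, add_zero]

theorem kMul_odd (y : L1 L) (m : KoszulSum L) : kMul (y : L) m = kOdd y (kSign L m) := by
  rw [kMul_eq, projPart_zero_odd, projPart_one_odd]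
  simp [kWedge]

namespace KoszulFiltLT

variable {n : ℕ} {m m' : KoszulSum L}

theorem add (h : KoszulFiltLT n m) (h' : KoszulFiltLT n m') : KoszulFiltLT n (m + m') := by
  cases n with
  | zero => simp_all [KoszulFiltLT]
  | succ n => exact KoszulFilt.add h h'

theorem smul (r : ℂ) (h : KoszulFiltLT n m) : KoszulFiltLT n (r • m) := by
  cases n with
  | zero => simp_all [KoszulFiltLT]
  | succ n => exact KoszulFilt.smul r h

/-- A linear map that raises the degree by at most one takes degrees below `n` to degrees at
most `n`. -/
theorem map {f : KoszulSum L →ₗ[ℂ] KoszulSum L}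
    (hf : ∀ n m, KoszulFilt n m → KoszulFilt (n + 1) (f m)) (h : KoszulFiltLT n m) :
    KoszulFilt n (f m) := by
  cases n with
  | zero =>
    rw [show m = 0 from h, map_zero]
    exact KoszulFilt.zero 0
  | succ n => exact hf n m h

theorem filt (h : KoszulFiltLT n m) : KoszulFilt n m :=
  h.map (f := LinearMap.id) fun _ _ h => h.succ

end KoszulFiltLT

/-- The anticommutator of the differential and the homotopy. -/
def eulerOp (g : Env L →ₗ[ℂ] L) : KoszulSum L →ₗ[ℂ] KoszulSum L :=
  kD L ∘ₗ homotopy g + homotopy g ∘ₗ kD L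

theorem eulerOp_apply (g : Env L →ₗ[ℂ] L) (m : KoszulSum L) :
    eulerOp g m = kD L (homotopy g m) + homotopy g (kD L m) := rfl

/-- The linear map governing the commutator of the homotopy and the action of an even element. -/
def evenDeriv (g : Env L →ₗ[ℂ] L) (x : L0 L) : Env L →ₗ[ℂ] L :=
  g ∘ₗ LinearMap.mulRight ℂ (envι L x) + evenBracket x ∘ₗ g

/-- The linear map governing the anticommutator of the homotopy and the action of an odd
element. -/
def oddDeriv (g : Env L →ₗ[ℂ] L) (y : L1 L) : Env L →ₗ[ℂ] L :=
  g ∘ₗ LinearMap.mulRight ℂ (envι L y) + oddBracket y ∘ₗ g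

/-- The anticommutator of the differential and the homotopy is multiplication by the degree, up to
terms of lower degree. -/
theorem eulerOp_sub {g : Env L →ₗ[ℂ] L} (hι : ∀ z, g (envι L z) = z) (h1 : g 1 = 0)
    (hpar : ∀ u, g (envParity L u) = parity (g u)) {n : ℕ} {m : KoszulSum L}
    (h : KoszulFilt n m) : KoszulFiltLT n (eulerOp g m - (n : ℂ) • m) := by
  -- As g(x) = x and g(1) = 0, the derived map takes the value x at 1, so its homotopy has leading
  -- term e_x.
  have hE : ∀ (x : L0 L) n m, KoszulFilt n m →
      KoszulFilt n (homotopy (evenDeriv g x) m - kWedge x m) := fun x n m hm => by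
    have := hm.homotopy_sub (evenDeriv g x)
    rwa [show evenDeriv g x 1 = x by simp [evenDeriv, hι, h1], kMul_even] at this
  have hO : ∀ (y : L1 L) n m, KoszulFilt n m →
      KoszulFilt n (homotopy (oddDeriv g y) m - kOdd y (kSign L m)) := fun y n m hm => by
    have := hm.homotopy_sub (oddDeriv g y)
    rwa [show oddDeriv g y 1 = y by simp [oddDeriv, hι, h1], kMul_odd] at this
  -- Used for the terms coming from the action on chains, which have lower degree than the right
  -- multiplication.
  have hN : ∀ n m, KoszulFilt n m → KoszulFilt n (eulerOp g m) := fun n m hm =>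
    (hm.homotopy_of_map_one h1).differential.add (hm.differential.homotopy_of_map_one h1)
  have hA : ∀ x m, homotopy g (kActEven x m) =
      kActEven x (homotopy g m) + homotopy (evenDeriv g x) m := homotopy_kActEven g
  have hB : ∀ y m, homotopy g (kActOdd y m) =
      -kActOdd y (homotopy g m) + homotopy (oddDeriv g y) (kSign L m) := homotopy_kActOdd g hpar
  refine KoszulFilt.induction_total
    (P := fun n m => KoszulFiltLT n (eulerOp g m - (n : ℂ) • m)) ?_ (fun n m m' h h' => ?_)
    (fun n r m h => ?_) (fun n ih m hm => ?_) (fun n ih x m hm => ?_)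
    (fun n ih y m hm => ?_) (fun n ih x m hm => ?_) (fun n ih y m hm => ?_) h
  · change _ = _
    rw [eulerOp_apply, kD_nil, homotopy_tmul, coproduct_one, copMul_tmul, h1]
    simp
  · rw [map_add, show ∀ a b : KoszulSum L, a + b - (n : ℂ) • (m + m') =
      (a - (n : ℂ) • m) + (b - (n : ℂ) • m') from fun a b => by module]
    exact h.add h'
  · rw [map_smul, show ∀ a : KoszulSum L, r • a - (n : ℂ) • r • m = r • (a - (n : ℂ) • m) from
      fun a => by module]
    exact h.smul r
  · change KoszulFilt n _
    rw [show eulerOp g m - ((n + 1 : ℕ) : ℂ) • m = (eulerOp g m - (n : ℂ) • m) - m by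
      push_cast; module]
    exact (ih m hm).filt.sub hm
  · change KoszulFilt n _
    -- Let E = Dh + hD and let h' be the homotopy of the derived map. Then E θ_x - θ_x E = Dh' +
    -- h'D, and replacing h' by its leading term e_x gives D e_x + e_x D = θ_x. This raises the
    -- eigenvalue from n to n + 1.
    have e : eulerOp g (kMulRight (x : L) m) - ((n + 1 : ℕ) : ℂ) • kMulRight (x : L) m =
        kActEven x (eulerOp g m - (n : ℂ) • m) + (n : ℂ) • LinearMap.lTensor _ (evenAct x) m +
        LinearMap.lTensor _ (evenAct x) m +
        kD L (homotopy (evenDeriv g x) m - kWedge x m) +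
        (homotopy (evenDeriv g x) (kD L m) - kWedge x (kD L m)) -
        eulerOp g (LinearMap.lTensor _ (evenAct x) m) := by
      have h2 := KoszulFilt.kMulRight_even_eq x m
      rw [h2]
      simp only [eulerOp_apply, map_sub, map_add, map_smul, kD_kActEven, hA, kD_kWedge]
      push_cast
      rw [kActEven_eq]
      module
    rw [e]
    exact (((((ih m hm).map (f := kActEven x) fun _ _ h => h.actEven x).add
      ((hm.evenAct x).smul _)).add (hm.evenAct x)).add (hE x n m hm).differential).add
      (hE x n _ hm.differential) |>.sub (hN _ _ (hm.evenAct x))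
  · change KoszulFilt n _
    have hm' := hm.sign
    -- The same computation for θ_y, applied to the sign-twisted m because θ_y contains the sign
    -- operator. Double signs are kept so that the terms have the shape of `hO`.
    have e : eulerOp g (kMulRight (y : L) m) - ((n + 1 : ℕ) : ℂ) • kMulRight (y : L) m =
        kActOdd y (eulerOp g (kSign L m) - (n : ℂ) • kSign L m) +
        (n : ℂ) • LinearMap.lTensor _ (oddAct y) (kSign L m) +
        LinearMap.lTensor _ (oddAct y) (kSign L m) +
        kD L (homotopy (oddDeriv g y) m - kOdd y (kSign L m)) -
        (homotopy (oddDeriv g y) (kSign L (kD L (kSign L m))) -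
          kOdd y (kSign L (kSign L (kD L (kSign L m))))) -
        eulerOp g (LinearMap.lTensor _ (oddAct y) (kSign L m)) := by
      have h2 := KoszulFilt.kMulRight_odd_eq y m
      rw [h2]
      simp only [eulerOp_apply, map_sub, map_add, map_neg, map_smul, kD_kActOdd, hB, kD_kOdd,
        kSign_kSign]
      push_cast
      module
    rw [e]
    exact (((((ih _ hm').map (f := kActOdd y) fun _ _ h => h.actOdd y).add
      ((hm'.oddAct y).smul _)).add (hm'.oddAct y)).add (hO y n m hm).differential).sub
      (hO y n _ hm'.differential.sign) |>.sub (hN _ _ (hm'.oddAct y))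
  · change KoszulFilt n _
    -- The θ_x terms cancel and E e_x = e_x E + h' remains, with leading term e_x E + e_x.
    have e : eulerOp g (kWedge x m) - ((n + 1 : ℕ) : ℂ) • kWedge x m =
        kWedge x (eulerOp g m - (n : ℂ) • m) + (homotopy (evenDeriv g x) m - kWedge x m) := by
      simp only [eulerOp_apply, map_sub, map_add, map_neg, map_smul, hA, kD_kWedge,
        homotopy_kWedge]
      push_cast
      module
    rw [e]
    exact ((ih m hm).map (f := kWedge x) fun _ _ h => h.wedge x).add (hE x n m hm)
  · change KoszulFilt n _
    have e : eulerOp g (kOdd y m) - ((n + 1 : ℕ) : ℂ) • kOdd y m =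
        kOdd y (eulerOp g m - (n : ℂ) • m) +
        (homotopy (oddDeriv g y) (kSign L m) - kOdd y (kSign L (kSign L m))) := by
      simp only [eulerOp_apply, map_sub, map_add, map_smul, hB, kD_kOdd,
        homotopy_kOdd, kSign_kSign]
      push_cast
      module
    rw [e]
    exact ((ih m hm).map (f := kOdd y) fun _ _ h => h.oddMul y).add (hO y n _ hm.sign)

/-- The total Koszul complex is exact up to the multiples of `1`. -/
theorem exists_of_kD_eq_zero (m : KoszulSum L) (hm : kD L m = 0) :
    ∃ (c : ℂ) (m' : KoszulSum L), m = c • (1 ⊗ₜ emptyChain L) + kD L m' := by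
  obtain ⟨g, hι, h1, hpar⟩ := exists_even_retraction L
  obtain ⟨n, hn⟩ := KoszulFilt.exists_filt m
  have hE : ∀ n (m : KoszulSum L), KoszulFilt n m → KoszulFiltLT n (eulerOp g m - (n : ℂ) • m) :=
    fun n m h => eulerOp_sub hι h1 hpar h
  -- In filtration degree zero there are only the multiples of 1 ⊗ 1.
  have h0 : ∀ n (m : KoszulSum L), KoszulFilt n m → n = 0 → ∃ c : ℂ, m = c • (1 ⊗ₜ emptyChain L) := by
    intro n m h
    induction h with
    | nil => exact fun _ => ⟨1, by module⟩
    | add _ _ h h' =>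
      intro hn
      obtain ⟨c, rfl⟩ := h hn
      obtain ⟨c', rfl⟩ := h' hn
      exact ⟨c + c', by module⟩
    | smul r _ h =>
      intro hn
      obtain ⟨c, rfl⟩ := h hn
      exact ⟨r * c, by module⟩
    | succ => exact fun h => absurd h (Nat.succ_ne_zero _)
    | even => exact fun h => absurd h (Nat.succ_ne_zero _)
    | odd => exact fun h => absurd h (Nat.succ_ne_zero _)
    | wedge => exact fun h => absurd h (Nat.succ_ne_zero _)
    | oddMul => exact fun h => absurd h (Nat.succ_ne_zero _)
  induction n generalizing m with
  | zero =>
    obtain ⟨c, rfl⟩ := h0 0 m hn rfl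
    exact ⟨c, 0, by simp⟩
  | succ n ih =>
    have hne : ((n + 1 : ℕ) : ℂ) ≠ 0 := Nat.cast_ne_zero.2 n.succ_ne_zero
    have hf : KoszulFilt n (eulerOp g m - ((n + 1 : ℕ) : ℂ) • m) := hE _ m hn
    -- On the cycle m the operator E reduces to Dh, so Dhm - (n+1)m is a cycle of smaller degree.
    obtain ⟨c, m', hc⟩ := ih _ (by
      rw [eulerOp_apply, hm, map_zero, add_zero, map_sub, map_smul, hm, kD_kD, smul_zero,
        sub_zero]) hf
    rw [eulerOp_apply, hm, map_zero, add_zero] at hc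
    -- Solving Dhm - (n+1)m = c(1 ⊗ 1) + Dm' for m.
    refine ⟨-((n + 1 : ℕ) : ℂ)⁻¹ * c, ((n + 1 : ℕ) : ℂ)⁻¹ • (homotopy g m - m'), ?_⟩
    have h2 : m = ((n + 1 : ℕ) : ℂ)⁻¹ • (((n + 1 : ℕ) : ℂ) • m) := (inv_smul_smul₀ hne m).symm
    rw [map_smul, map_sub]
    generalize ((n + 1 : ℕ) : ℂ)⁻¹ = a at h2 ⊢
    linear_combination (norm := module) h2 - a • hc

end Exactness

/-! ## Exactness of the Koszul complex -/

section Graded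

variable {L : Type u} [AddCommGroup L] [Module ℂ L] [LieSuperalgebra L]

@[simp]
theorem stdD_tmul {V : Type v} [AddCommGroup V] [Module ℂ V] [Module (Env L)ᵐᵒᵖ V]
    [IsScalarTower ℂ (Env L)ᵐᵒᵖ V] (k : ℕ) (v : V) (c : Chains L (k + 1)) :
    stdD L V k (v ⊗ₜ c) = v ⊗ₜ chainsD L k c + LinearMap.rTensor _ (rightAct L V)
      ((TensorProduct.assoc ℂ V L (Chains L k)).symm (v ⊗ₜ chainsCo L k c)) := rfl

theorem koszulD_apply (k : ℕ) (m : Koszul L (k + 1)) :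
    koszulD L k m = stdD L (Env L) k m := rfl

theorem kD_ofChains_succ (k : ℕ) (m : Koszul L (k + 1)) :
    kD L (LinearMap.lTensor _ (ofChains (k + 1)) m) =
      LinearMap.lTensor _ (ofChains k) (stdD L (Env L) k m) := by
  induction m using TensorProduct.induction_on with
  | zero => simp
  | add a b ha hb => simp only [map_add, ha, hb]
  | tmul u c =>
    have key : ∀ z : L ⊗[ℂ] Chains L k,
        kAct L (u ⊗ₜ LinearMap.lTensor L (ofChains k) z) =
          LinearMap.lTensor _ (ofChains k) (LinearMap.rTensor _ (rightAct L (Env L))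
            ((TensorProduct.assoc ℂ (Env L) L (Chains L k)).symm (u ⊗ₜ z))) := fun z => by
      induction z with
      | zero => simp
      | add a b ha hb => simp only [map_add, TensorProduct.tmul_add, ha, hb]
      | tmul z c => rfl
    have h1 : chainSumD (ofChains (k + 1) c) = ofChains k (chainsD L k c) :=
      chainSumLift_ofChains _ _ _
    have h2 : chainSumCo (ofChains (k + 1) c) =
        LinearMap.lTensor L (ofChains k) (chainsCo L k c) := chainSumLift_ofChains _ _ _
    rw [LinearMap.lTensor_tmul, kD_tmul, h1, h2, key]
    exact (LinearMap.map_add (LinearMap.lTensor (Env L) (ofChains (L := L) k))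
      (u ⊗ₜ chainsD L k c) (LinearMap.rTensor _ (rightAct L (Env L))
        ((TensorProduct.assoc ℂ (Env L) L (Chains L k)).symm (u ⊗ₜ chainsCo L k c)))).symm

theorem kD_ofChains_zero (m : Koszul L 0) :
    kD L (LinearMap.lTensor _ (ofChains 0) m) = 0 := by
  induction m using TensorProduct.induction_on with
  | zero => simp
  | add a b ha hb => simp only [map_add, ha, hb, add_zero]
  | tmul u c =>
    have h1 : chainSumD (ofChains 0 c) = 0 := chainSumLift_ofChains _ _ _
    have h2 : chainSumCo (ofChains 0 c) = 0 := chainSumLift_ofChains _ _ _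
    rw [LinearMap.lTensor_tmul, kD_tmul, h1, h2]
    simp

theorem lTensor_component_self (k : ℕ) (m : Koszul L k) :
    LinearMap.lTensor _ (chainsComponent k) (LinearMap.lTensor (Env L) (ofChains k) m) = m := by
  induction m using TensorProduct.induction_on with
  | zero => simp
  | add a b ha hb => simp only [map_add, ha, hb]
  | tmul u c => simp [chainsComponent_self]

theorem lTensor_component_of_ne {k l : ℕ} (h : k ≠ l) (m : Koszul L k) :
    LinearMap.lTensor _ (chainsComponent l) (LinearMap.lTensor (Env L) (ofChains k) m) = 0 := by
  induction m using TensorProduct.induction_on with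
  | zero => simp
  | add a b ha hb => simp only [map_add, ha, hb, add_zero]
  | tmul u c => simp [chainsComponent_of_ne h]

/-- The total differential lowers the chain degree by exactly one, so a primitive of a homogeneous
boundary can be replaced by its component one degree higher. -/
theorem lTensor_component_kD (k : ℕ) (m : KoszulSum L) :
    LinearMap.lTensor _ (chainsComponent k) (kD L m) =
      stdD L (Env L) k (LinearMap.lTensor _ (chainsComponent (k + 1)) m) := by
  have key : ∀ l (m : Koszul L l), LinearMap.lTensor _ (chainsComponent k)
      (kD L (LinearMap.lTensor _ (ofChains l) m)) = stdD L (Env L) k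
        (LinearMap.lTensor _ (chainsComponent (k + 1)) (LinearMap.lTensor _ (ofChains l) m)) := by
    rintro (_ | l) m
    · rw [kD_ofChains_zero, lTensor_component_of_ne (Nat.succ_ne_zero k).symm, map_zero, map_zero]
    · rw [kD_ofChains_succ]
      by_cases h : l = k
      · subst h
        rw [lTensor_component_self, lTensor_component_self]
      · rw [lTensor_component_of_ne h, lTensor_component_of_ne (by omega), map_zero]
  induction m using TensorProduct.induction_on with
  | zero => simp
  | add a b ha hb => simp only [map_add, ha, hb]
  | tmul u c =>
    induction c using chainSum_of_induction with
    | h0 => simp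
    | hadd a b ha hb => simp only [TensorProduct.tmul_add, map_add, ha, hb]
    | hof l c => exact key l (u ⊗ₜ c)

theorem koszulD_koszulD (k : ℕ) (m : Koszul L (k + 2)) :
    koszulD L k (koszulD L (k + 1) m) = 0 := by
  rw [koszulD_apply, koszulD_apply, ← lTensor_component_self k (stdD L (Env L) k _),
    ← kD_ofChains_succ, ← kD_ofChains_succ, kD_kD, map_zero]

theorem exact_koszulD (k : ℕ) : Function.Exact (koszulD L (k + 1)) (koszulD L k) := by
  refine fun m => ⟨fun hm => ?_, ?_⟩
  · rw [koszulD_apply] at hm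
    obtain ⟨c, m', h⟩ := exists_of_kD_eq_zero (LinearMap.lTensor _ (ofChains (k + 1)) m)
      (by rw [kD_ofChains_succ, hm, map_zero])
    refine ⟨LinearMap.lTensor _ (chainsComponent (k + 2)) m', ?_⟩
    have h2 := congrArg (LinearMap.lTensor (Env L) (chainsComponent (k + 1))) h
    rw [lTensor_component_self, map_add, map_smul, lTensor_component_kD] at h2
    -- The exceptional element 1 ⊗ 1 has chain degree 0 and has no component in degree k + 1.
    have h3 : LinearMap.lTensor (Env L) (chainsComponent (L := L) (k + 1)) (1 ⊗ₜ emptyChain L) = 0 :=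
      lTensor_component_of_ne (Nat.succ_ne_zero k).symm (1 ⊗ₜ gen 0 [] [])
    rw [h3, smul_zero, zero_add] at h2
    exact h2.symm
  · rintro ⟨m', rfl⟩
    exact koszulD_koszulD k m'

theorem chainsZero_gen : chainsZero L (gen 0 [] []) = 1 := by
  have h : gen (L := L) 0 [] [] = incl 0 0 0 rfl (exteriorPower.ιMulti ℂ 0 ![] ⊗ₜ
      SymmetricPower.tprod ℂ ![]) := gen_ofFn (p := 0) (q := 0) rfl ![] ![] [] [] rfl rfl
  rw [h, chainsZero, LinearMap.comp_apply, incl]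
  erw [DirectSum.component.lof_self]
  simp only [TensorProduct.lift.tmul, LinearMap.compl₁₂_apply, LinearEquiv.coe_coe,
    exteriorPower.zeroEquiv_ιMulti, LinearMap.mul_apply', one_mul]
  exact symLift_tprod _ _ _

theorem koszulAug_tmul (u : Env L) (c : Chains L 0) :
    koszulAug.{u, w} L (u ⊗ₜ c) = ULift.up (envAug L u * chainsZero L c) := rfl

variable (L) in
/-- The augmentation of the total space of chains. -/
def chainSumAug : ChainSum L →ₗ[ℂ] ℂ := chainsZero L ∘ₗ chainsComponent 0

@[simp]
theorem chainSumAug_wedge (x : L0 L) (c : ChainSum L) : chainSumAug L (wedge x c) = 0 :=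
  LinearMap.congr_fun (f := chainSumAug L ∘ₗ wedge x) (g := 0) (chainSum_hom_ext fun X Y => by
    rw [LinearMap.comp_apply, wedge_chain, chainSumAug, LinearMap.comp_apply, chain,
      chainsComponent_of_ne (by simp), map_zero]
    rfl) c

@[simp]
theorem chainSumAug_oddMul (y : L1 L) (c : ChainSum L) : chainSumAug L (oddMul y c) = 0 :=
  LinearMap.congr_fun (f := chainSumAug L ∘ₗ oddMul y) (g := 0) (chainSum_hom_ext fun X Y => by
    rw [LinearMap.comp_apply, oddMul_chain, chainSumAug, LinearMap.comp_apply, chain,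
      chainsComponent_of_ne (by simp), map_zero]
    rfl) c

@[simp]
theorem chainSumAug_evenAct (x : L0 L) (c : ChainSum L) : chainSumAug L (evenAct x c) = 0 := by
  induction c using chainSum_mul_induction with
  | hadd a b ha hb => simp [ha, hb]
  | hsmul r a ha => simp [ha]
  | hnil => rw [evenAct_nil, map_zero]
  | hwedge x' c hc => simp [evenAct_wedge]
  | hodd y c hc => simp [evenAct_oddMul]

@[simp]
theorem chainSumAug_oddAct (y : L1 L) (c : ChainSum L) : chainSumAug L (oddAct y c) = 0 := by
  induction c using chainSum_mul_induction with
  | hadd a b ha hb => simp [ha, hb]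
  | hsmul r a ha => simp [ha]
  | hnil => rw [oddAct_nil, map_zero]
  | hwedge x' c hc => simp [oddAct_wedge]
  | hodd y c hc => simp [oddAct_oddMul]

variable (L) in
/-- The augmentation of the total Koszul complex. -/
def kAug : KoszulSum L →ₗ[ℂ] ℂ :=
  LinearMap.mul' ℂ ℂ ∘ₗ TensorProduct.map (envAug L).toLinearMap (chainSumAug L)

@[simp]
theorem kAug_tmul (u : Env L) (c : ChainSum L) :
    kAug L (u ⊗ₜ c) = envAug L u * chainSumAug L c := rfl

theorem kAug_kWedge (x : L0 L) (m : KoszulSum L) : kAug L (kWedge x m) = 0 :=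
  LinearMap.congr_fun (f := kAug L ∘ₗ kWedge x) (g := 0) (koszulSum_hom_ext fun u c => by simp) m

theorem kAug_kOdd (y : L1 L) (m : KoszulSum L) : kAug L (kOdd y m) = 0 :=
  LinearMap.congr_fun (f := kAug L ∘ₗ kOdd y) (g := 0) (koszulSum_hom_ext fun u c => by simp) m

theorem kAug_kActEven (x : L0 L) (m : KoszulSum L) : kAug L (kActEven x m) = 0 :=
  LinearMap.congr_fun (f := kAug L ∘ₗ kActEven x) (g := 0)
    (koszulSum_hom_ext fun u c => by simp [envAug_ι]) m

theorem kAug_kActOdd (y : L1 L) (m : KoszulSum L) : kAug L (kActOdd y m) = 0 :=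
  LinearMap.congr_fun (f := kAug L ∘ₗ kActOdd y) (g := 0)
    (koszulSum_hom_ext fun u c => by simp [envAug_ι]) m

/-- The augmentation kills all multiples by e_x and e_y, and all values of θ because it kills L in
U; D of a product consists of such terms. -/
theorem kAug_kD (m : KoszulSum L) : kAug L (kD L m) = 0 := by
  induction m using koszulSum_induction with
  | hadd a b ha hb => rw [map_add, map_add, ha, hb, add_zero]
  | hnil u => rw [kD_nil, map_zero]
  | hwedge x m hm => rw [kD_kWedge, map_sub, kAug_kActEven, kAug_kWedge, sub_zero]
  | hodd y m hm => rw [kD_kOdd, map_add, kAug_kActOdd, kAug_kOdd, add_zero]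

theorem koszulAug_eq (m : Koszul L 0) :
    koszulAug.{u, w} L m = ULift.up (kAug L (LinearMap.lTensor _ (ofChains 0) m)) := by
  induction m using TensorProduct.induction_on with
  | zero =>
    rw [map_zero, map_zero, map_zero]
    rfl
  | add a b ha hb =>
    rw [map_add, ha, hb, map_add, map_add]
    rfl
  | tmul u c =>
    rw [koszulAug_tmul, LinearMap.lTensor_tmul, kAug_tmul, chainSumAug, LinearMap.comp_apply,
      chainsComponent_self]

theorem koszulAug_gen (u : Env L) : koszulAug.{u, w} L (u ⊗ₜ gen 0 [] []) =
    ULift.up (envAug L u) := by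
  rw [koszulAug_tmul, chainsZero_gen, mul_one]

theorem koszulAug_surjective : Function.Surjective (koszulAug.{u, w} L) := fun z =>
  ⟨algebraMap ℂ (Env L) z.down ⊗ₜ gen 0 [] [], by
    rw [koszulAug_gen, AlgHom.commutes]
    rfl⟩

theorem exact_koszulAug : Function.Exact (koszulD L 0) (koszulAug.{u, w} L) := by
  refine fun m => ⟨fun hm => ?_, ?_⟩
  · obtain ⟨c, m', h⟩ := exists_of_kD_eq_zero (LinearMap.lTensor _ (ofChains 0) m)
      (kD_ofChains_zero m)
    have hc : kAug L (LinearMap.lTensor _ (ofChains 0) m) = 0 := by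
      rw [koszulAug_eq] at hm
      exact congrArg ULift.down hm
    have h1 : chainSumAug L (emptyChain L) = 1 := by
      rw [chainSumAug, LinearMap.comp_apply, emptyChain, chain]
      exact (congrArg _ (chainsComponent_self 0 _)).trans chainsZero_gen
    -- Applying the augmentation to m = c(1 ⊗ 1) + Dm' leaves c, so c = 0.
    rw [h, map_add, kAug_kD, map_smul, kAug_tmul, h1, map_one, add_zero, mul_one, smul_eq_mul,
      mul_one] at hc
    rw [hc, zero_smul, zero_add] at h
    refine ⟨LinearMap.lTensor _ (chainsComponent 1) m', ?_⟩
    rw [koszulD_apply, ← lTensor_component_kD, ← h, lTensor_component_self]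
  · rintro ⟨m', rfl⟩
    rw [koszulAug_eq, koszulD_apply, ← kD_ofChains_succ, kAug_kD]
    rfl

end Graded

/-! ## Free modules and balanced tensor products -/

section Balanced

instance freeChains (L : Type u) [AddCommGroup L] [Module ℂ L] [LieSuperalgebra L] (k : ℕ) :
    Module.Free ℂ (Chains L k) :=
  letI : AddCommGroup (Chains L k) := Module.addCommMonoidToAddCommGroup ℂ
  Module.Free.of_divisionRing ℂ (Chains L k)

theorem free_koszul (L : Type u) [AddCommGroup L] [Module ℂ L] [LieSuperalgebra L] (k : ℕ) :
    Module.Free (Env L) (Koszul L k) := inferInstance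

variable {A : Type u} [Ring A] [Algebra ℂ A]
variable {V : Type v} [AddCommGroup V] [Module ℂ V] [Module Aᵐᵒᵖ V] [IsScalarTower ℂ Aᵐᵒᵖ V]
variable {C : Type*} [AddCommMonoid C] [Module ℂ C]
variable {N : Type*} [AddCommGroup N] [Module ℂ N] [Module A N] [IsScalarTower ℂ A N]

variable (A V C) in
/-- The map `V ⊗ (A ⊗ C) → V ⊗ C`, `v ⊗ (a ⊗ c) ↦ (v a) ⊗ c`. -/
def balancedAct : V ⊗[ℂ] (A ⊗[ℂ] C) →ₗ[ℂ] V ⊗[ℂ] C :=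
  LinearMap.rTensor C (TensorProduct.lift (LinearMap.mk₂ ℂ
    (fun (v : V) (a : A) => MulOpposite.op a • v) (fun _ _ _ => smul_add _ _ _)
    (fun r v a => smul_comm _ _ _) (fun _ _ _ => by simp [add_smul])
    (fun r v a => by simp))) ∘ₗ (TensorProduct.assoc ℂ V A C).symm.toLinearMap

@[simp]
theorem balancedAct_tmul (v : V) (a : A) (c : C) :
    balancedAct A V C (v ⊗ₜ (a ⊗ₜ c)) = (MulOpposite.op a • v) ⊗ₜ c := rfl

theorem balancedAct_smul (v : V) (a : A) (z : A ⊗[ℂ] C) :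
    balancedAct A V C (v ⊗ₜ (a • z)) = balancedAct A V C ((MulOpposite.op a • v) ⊗ₜ z) := by
  induction z with
  | zero => simp
  | add x y hx hy => simp only [smul_add, TensorProduct.tmul_add, map_add, hx, hy]
  | tmul b c => simp [TensorProduct.smul_tmul', mul_smul]

/-- If `N` is isomorphic to `A ⊗ C`, then `V ⊗_A N` is isomorphic to `V ⊗ C`. -/
def balancedEquiv (φ : A ⊗[ℂ] C ≃ₗ[A] N) : BalancedTensor A V N ≃ₗ[ℂ] V ⊗[ℂ] C :=
  LinearEquiv.ofLinearMap
    (Submodule.liftQ _ (balancedAct A V C ∘ₗ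
        LinearMap.lTensor V (φ.symm.toLinearMap.restrictScalars ℂ)) (by
      rw [balancedSub, Submodule.span_le]
      rintro _ ⟨v, a, n, rfl⟩
      simp [balancedAct_smul]))
    (Submodule.mkQ _ ∘ₗ LinearMap.lTensor V (φ.toLinearMap.restrictScalars ℂ ∘ₗ
      TensorProduct.mk ℂ A C 1))
    (TensorProduct.ext' fun v c => by simp)
    (Submodule.linearMap_qext _ (TensorProduct.ext' fun v n => by
      obtain ⟨z, rfl⟩ := φ.surjective n
      induction z with
      | zero => simp
      | add x y hx hy => simp only [map_add, TensorProduct.tmul_add, hx, hy]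
      | tmul a c =>
        have h : φ (a ⊗ₜ c) = a • φ (1 ⊗ₜ c) := by
          rw [← map_smul, TensorProduct.smul_tmul', smul_eq_mul, mul_one]
        simp only [LinearMap.comp_apply, Submodule.mkQ_apply, Submodule.liftQ_apply,
          LinearMap.lTensor_tmul, LinearMap.restrictScalars_apply, LinearEquiv.coe_coe,
          LinearEquiv.symm_apply_apply, balancedAct_tmul, TensorProduct.mk_apply,
          LinearMap.id_apply]
        rw [Submodule.Quotient.eq, h]
        exact Submodule.subset_span ⟨v, a, _, rfl⟩))

theorem balancedEquiv_mk (φ : A ⊗[ℂ] C ≃ₗ[A] N) (v : V) (z : A ⊗[ℂ] C) :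
    balancedEquiv φ (Submodule.Quotient.mk (v ⊗ₜ φ z) : BalancedTensor A V N) =
      balancedAct A V C (v ⊗ₜ z) := by
  change balancedAct A V C (v ⊗ₜ (φ.symm (φ z))) = _
  rw [LinearEquiv.symm_apply_apply]

end Balanced

/-! ### From the Koszul complex to the standard complex. -/

section Standard

variable (L : Type u) [AddCommGroup L] [Module ℂ L] [LieSuperalgebra L]
variable {V : Type v} [AddCommGroup V] [Module ℂ V] [Module (Env L)ᵐᵒᵖ V]
  [IsScalarTower ℂ (Env L)ᵐᵒᵖ V]

/-- Both composites let u and then the split-off element of L act on v from the right; this is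
associativity of the action. -/
theorem balancedAct_stdD (k : ℕ) (v : V) (m : Koszul L (k + 1)) :
    balancedAct (Env L) V (Chains L k) (v ⊗ₜ stdD L (Env L) k m) =
      stdD L V k (balancedAct (Env L) V _ (v ⊗ₜ m)) := by
  induction m using TensorProduct.induction_on with
  | zero => simp
  | add a b ha hb => simp only [map_add, TensorProduct.tmul_add, ha, hb]
  | tmul u c =>
    have key : ∀ z : L ⊗[ℂ] Chains L k,
        balancedAct (Env L) V (Chains L k) (v ⊗ₜ LinearMap.rTensor _ (rightAct L (Env L))
          ((TensorProduct.assoc ℂ (Env L) L (Chains L k)).symm (u ⊗ₜ z))) =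
        LinearMap.rTensor _ (rightAct L V) ((TensorProduct.assoc ℂ V L (Chains L k)).symm
          ((MulOpposite.op u • v) ⊗ₜ z)) := fun z => by
      induction z with
      | zero => simp
      | add a b ha hb => simp only [map_add, TensorProduct.tmul_add, ha, hb]
      | tmul z c => simp [rightAct, mul_smul]
    rw [stdD_tmul, TensorProduct.tmul_add, map_add, key]
    rfl

variable {N N' : Type w} [AddCommGroup N] [Module ℂ N] [Module (Env L) N]
  [IsScalarTower ℂ (Env L) N] [AddCommGroup N'] [Module ℂ N'] [Module (Env L) N']
  [IsScalarTower ℂ (Env L) N']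

theorem balancedEquiv_balancedMap (k : ℕ) (φ : Koszul L (k + 1) ≃ₗ[Env L] N)
    (φ' : Koszul L k ≃ₗ[Env L] N') (f : N →ₗ[Env L] N')
    (hf : ∀ m, f (φ m) = φ' (koszulD L k m)) (z : BalancedTensor (Env L) V N) :
    balancedEquiv φ' (balancedMap (Env L) V f z) = stdD L V k (balancedEquiv φ z) := by
  obtain ⟨z, rfl⟩ := Submodule.Quotient.mk_surjective _ z
  induction z with
  | zero => simp only [Submodule.Quotient.mk_zero, map_zero]
  | add a b ha hb => simp only [Submodule.Quotient.mk_add, map_add, ha, hb]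
  | tmul v n =>
    obtain ⟨m, rfl⟩ := φ.surjective n
    have h : balancedMap (Env L) V f (Submodule.Quotient.mk (v ⊗ₜ φ m)) =
        Submodule.Quotient.mk (v ⊗ₜ φ' (koszulD L k m)) := by
      rw [← hf]
      rfl
    rw [h, balancedEquiv_mk, balancedEquiv_mk, koszulD_apply, balancedAct_stdD]

variable (V) in
theorem stdD_stdD (k : ℕ) (z : V ⊗[ℂ] Chains L (k + 2)) :
    stdD L V k (stdD L V (k + 1) z) = 0 := by
  induction z using TensorProduct.induction_on with
  | zero => simp
  | add a b ha hb => simp only [map_add, ha, hb, add_zero]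
  | tmul v c =>
    -- Each v ⊗ c comes from the Koszul element 1 ⊗ c, so the square of d is inherited from the
    -- Koszul complex.
    have h : v ⊗ₜ c = balancedAct (Env L) V (Chains L (k + 2)) (v ⊗ₜ (1 ⊗ₜ c)) := by simp
    rw [h, ← balancedAct_stdD, ← balancedAct_stdD, ← koszulD_apply, ← koszulD_apply,
      koszulD_koszulD, TensorProduct.tmul_zero, map_zero]

end Standard

/-! ## The projective resolution and Tor -/

section Resolution

open CategoryTheory
open scoped ModuleCat

/-- The homology of a pair of composable linear maps as a quotient of the cycles. -/
theorem nonempty_homology_equiv {M N P : Type w} [AddCommGroup M] [Module ℂ M] [AddCommGroup N]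
    [Module ℂ N] [AddCommGroup P] [Module ℂ P] (f : M →ₗ[ℂ] N) (g : N →ₗ[ℂ] P)
    (h : ModuleCat.ofHom f ≫ ModuleCat.ofHom g = 0) {Z : Submodule ℂ N}
    (hZ : Z = LinearMap.ker g) :
    Nonempty ((ShortComplex.mk (ModuleCat.ofHom f) (ModuleCat.ofHom g) h).homology ≃ₗ[ℂ]
      (Z ⧸ (LinearMap.range f).submoduleOf Z)) := by
  subst hZ
  refine ⟨(ShortComplex.moduleCatHomologyIso _).toLinearEquiv ≪≫ₗ
    Submodule.quotEquivOfEq _ _ ?_⟩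
  ext z
  simp only [LinearMap.mem_range, Submodule.submoduleOf, Submodule.mem_comap]
  constructor
  · rintro ⟨m, rfl⟩
    exact ⟨m, rfl⟩
  · rintro ⟨m, hm⟩
    exact ⟨m, Subtype.ext hm⟩

/-- The homology of a complex that is isomorphic around degree `j` to a pair of composable linear
maps. -/
theorem nonempty_complex_homology_equiv (K : ChainComplex (ModuleCat.{w} ℂ) ℕ) {i j k : ℕ}
    (hi : (ComplexShape.down ℕ).prev j = i) (hk : (ComplexShape.down ℕ).next j = k)
    {M N P : Type w} [AddCommGroup M] [Module ℂ M] [AddCommGroup N]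
    [Module ℂ N] [AddCommGroup P] [Module ℂ P] (f : M →ₗ[ℂ] N) (g : N →ₗ[ℂ] P)
    (h : ∀ m, g (f m) = 0) (a : K.X i ≅ ModuleCat.of ℂ M) (b : K.X j ≅ ModuleCat.of ℂ N)
    (c : K.X k ≅ ModuleCat.of ℂ P) (hab : a.hom ≫ ModuleCat.ofHom f = K.d i j ≫ b.hom)
    (hbc : b.hom ≫ ModuleCat.ofHom g = K.d j k ≫ c.hom) {Z : Submodule ℂ N}
    (hZ : Z = LinearMap.ker g) :
    Nonempty (K.homology j ≃ₗ[ℂ] (Z ⧸ (LinearMap.range f).submoduleOf Z)) := by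
  have h0 : ModuleCat.ofHom f ≫ ModuleCat.ofHom g = 0 :=
    ModuleCat.hom_ext (LinearMap.ext h)
  obtain ⟨e⟩ := nonempty_homology_equiv f g h0 hZ
  exact ⟨(ShortComplex.homologyMapIso (K.isoSc' i j k hi hk ≪≫
    ShortComplex.isoMk (S₂ := ShortComplex.mk _ _ h0) a b c hab hbc)).toLinearEquiv ≪≫ₗ e⟩

variable (L : Type u) [AddCommGroup L] [Module ℂ L] [LieSuperalgebra L]

/-- The Koszul module `M_k`, lifted to a larger universe. -/
abbrev koszulObj (k : ℕ) : ModuleCat.{max u v} (Env L) :=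
  ModuleCat.of (Env L) (ULift.{v} (Koszul L k))

/-- The Koszul differential, lifted to a larger universe. -/
def koszulHom (k : ℕ) : koszulObj.{u, v} L (k + 1) ⟶ koszulObj.{u, v} L k :=
  ModuleCat.ofHom (ULift.moduleEquiv.symm.toLinearMap ∘ₗ koszulD L k ∘ₗ
    ULift.moduleEquiv.toLinearMap)

theorem koszulHom_comp (k : ℕ) : koszulHom.{u, v} L (k + 1) ≫ koszulHom.{u, v} L k = 0 := by
  ext ⟨m⟩
  exact koszulD_koszulD k m

/-- The Koszul complex. -/
def koszulComplex : ChainComplex (ModuleCat.{max u v} (Env L)) ℕ :=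
  ChainComplex.of (koszulObj.{u, v} L) (koszulHom.{u, v} L) (koszulHom_comp L)

/-- The augmentation of the Koszul complex. -/
def koszulAugHom : koszulObj.{u, v} L 0 ⟶ ModuleCat.of (Env L) TrivialModule.{max u v} :=
  ModuleCat.ofHom (koszulAug L ∘ₗ ULift.moduleEquiv.toLinearMap)

theorem koszulHom_comp_aug : koszulHom.{u, v} L 0 ≫ koszulAugHom.{u, v} L = 0 := by
  ext ⟨m⟩
  exact (exact_koszulAug _).2 ⟨m, rfl⟩

theorem koszulComplex_d (k : ℕ) : (koszulComplex.{u, v} L).d (k + 1) k = koszulHom.{u, v} L k :=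
  ChainComplex.of_d ..

/-- The Koszul complex is a projective resolution of the trivial module. -/
def koszulResolution :
    ProjectiveResolution (ModuleCat.of (Env L) TrivialModule.{max u v}) where
  complex := koszulComplex.{u, v} L
  projective k := by
    have : Module.Free (Env L) (ULift.{v} (Koszul L k)) :=
      Module.Free.of_equiv ULift.moduleEquiv.symm
    exact (IsProjective.iff_projective (R := Env L) (ULift.{v} (Koszul L k))).1 inferInstance
  π := (ChainComplex.toSingle₀Equiv _ _).symm ⟨koszulAugHom.{u, v} L, by
    rw [koszulComplex_d]
    exact koszulHom_comp_aug L⟩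
  quasiIso := ⟨fun n => by
    cases n with
    | zero =>
      -- In degree zero a quasi-isomorphism onto ℂ amounts to exactness of M₁ → M₀ → ℂ together with
      -- surjectivity of the augmentation.
      rw [ChainComplex.quasiIsoAt₀_iff, ShortComplex.quasiIso_iff_of_zeros']
      · refine ⟨?_, ?_⟩
        · rw [ShortComplex.moduleCat_exact_iff]
          intro x hx
          obtain ⟨m', h⟩ := (exact_koszulAug.{u, max u v} x.down).1 hx
          refine ⟨ULift.up m', ?_⟩
          have h2 : (koszulHom.{u, v} L 0).hom ⟨m'⟩ = x := congrArg ULift.up h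
          rw [← koszulComplex_d] at h2
          exact h2
        · rw [ModuleCat.epi_iff_surjective]
          intro z
          obtain ⟨m, h⟩ := koszulAug_surjective.{u, max u v} (L := L) z
          exact ⟨⟨m⟩, h⟩
      all_goals rfl
    | succ n =>
      rw [quasiIsoAt_iff_exactAt']
      · rw [HomologicalComplex.exactAt_iff' _ (n + 1 + 1) (n + 1) n (by simp) (by simp)]
        rw [ShortComplex.moduleCat_exact_iff]
        intro x hx
        have hx' : (koszulHom.{u, v} L n).hom x = 0 := by
          rw [← koszulComplex_d]
          exact hx
        obtain ⟨m', h⟩ := (exact_koszulD n x.down).1 (congrArg ULift.down hx')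
        refine ⟨ULift.up m', ?_⟩
        have h2 : (koszulHom.{u, v} L (n + 1)).hom ⟨m'⟩ = x := congrArg ULift.up h
        rw [← koszulComplex_d] at h2
        exact h2
      · apply ChainComplex.exactAt_succ_single_obj⟩

variable (V : Type v) [AddCommGroup V] [Module ℂ V] [Module (Env L)ᵐᵒᵖ V]
  [IsScalarTower ℂ (Env L)ᵐᵒᵖ V]

variable {L} in
/-- The isomorphism `V ⊗_U N ≅ V ⊗ C_k(L)` for a module `N` isomorphic to `M_k`. -/
def tensorIso {N : ModuleCat.{max u v} (Env L)} {k : ℕ} (φ : Koszul L k ≃ₗ[Env L] N) :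
    (tensorFunctor.{u, v, max u v} (Env L) V).obj N ≅ ModuleCat.of ℂ (V ⊗[ℂ] Chains L k) :=
  LinearEquiv.toModuleIso (X₁ := BalancedTensor (Env L) V N) (balancedEquiv φ)

variable {L} in
theorem tensorIso_naturality {N N' : ModuleCat.{max u v} (Env L)} {k : ℕ}
    (φ : Koszul L (k + 1) ≃ₗ[Env L] N) (φ' : Koszul L k ≃ₗ[Env L] N') (f : N ⟶ N')
    (hf : ∀ m, f.hom (φ m) = φ' (koszulD L k m)) :
    (tensorIso V φ).hom ≫ ModuleCat.ofHom (stdD L V k) =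
      (tensorFunctor.{u, v, max u v} (Env L) V).map f ≫ (tensorIso V φ').hom :=
  ModuleCat.hom_ext (LinearMap.ext fun z =>
    (balancedEquiv_balancedMap L k φ φ' f.hom hf z).symm)

/-- The complex `V ⊗_U M`. -/
abbrev tensorComplex : ChainComplex (ModuleCat.{max u v} ℂ) ℕ :=
  ((tensorFunctor.{u, v, max u v} (Env L) V).mapHomologicalComplex _).obj
    (koszulComplex.{u, v} L)

/-- The isomorphism of `V ⊗_U M_k` with `V ⊗ C_k(L)`. -/
def tensorComplexIso (k : ℕ) :
    (tensorComplex L V).X k ≅ ModuleCat.of ℂ (V ⊗[ℂ] Chains L k) :=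
  tensorIso V (N := koszulObj.{u, v} L k) ULift.moduleEquiv.symm

theorem tensorComplexIso_comm (k : ℕ) :
    (tensorComplexIso L V (k + 1)).hom ≫ ModuleCat.ofHom (stdD L V k) =
      (tensorComplex L V).d (k + 1) k ≫ (tensorComplexIso L V k).hom := by
  have h : (tensorComplex L V).d (k + 1) k =
      (tensorFunctor.{u, v, max u v} (Env L) V).map (koszulHom.{u, v} L k) :=
    congrArg (tensorFunctor.{u, v, max u v} (Env L) V).map (koszulComplex_d L k)
  rw [h]
  exact tensorIso_naturality V _ _ _ fun m => rfl

theorem nonempty_tensorComplex_homology_equiv (k : ℕ) :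
    Nonempty ((tensorComplex L V).homology k ≃ₗ[ℂ] StdHomology L V k) := by
  cases k with
  | zero =>
    -- In this complex shape degree 0 is its own successor, with zero differential. The outgoing map
    -- is therefore taken to be 0, whose kernel is all of V ⊗ C₀.
    exact nonempty_complex_homology_equiv (tensorComplex L V) (i := 1) (k := 0) (by simp)
      (by simp) (stdD L V 0) (0 : V ⊗[ℂ] Chains L 0 →ₗ[ℂ] V ⊗[ℂ] Chains L 0) (fun _ => rfl)
      (tensorComplexIso L V 1) (tensorComplexIso L V 0) (tensorComplexIso L V 0)
      (tensorComplexIso_comm L V 0)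
      (by
        rw [(tensorComplex L V).shape 0 0 (by simp), Limits.zero_comp]
        exact Limits.comp_zero) LinearMap.ker_zero.symm
  | succ k =>
    exact nonempty_complex_homology_equiv (tensorComplex L V) (i := k + 2) (k := k) (by simp)
      (by simp) (stdD L V (k + 1)) (stdD L V k) (stdD_stdD L V k)
      (tensorComplexIso L V (k + 2)) (tensorComplexIso L V (k + 1)) (tensorComplexIso L V k)
      (tensorComplexIso_comm L V (k + 1)) (tensorComplexIso_comm L V k) rfl

theorem nonempty_superHomology_equiv (k : ℕ) :
    Nonempty (superHomology L V k ≃ₗ[ℂ] StdHomology L V k) := by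
  obtain ⟨e⟩ := nonempty_tensorComplex_homology_equiv L V k
  exact ⟨((koszulResolution.{u, v} L).isoLeftDerivedObj
    (tensorFunctor.{u, v, max u v} (Env L) V) k).toLinearEquiv ≪≫ₗ e⟩

end Resolution

end LieSuperalgebra

end

theorem proposition3p1 (L : Type u) [AddCommGroup L] [Module ℂ L] [LieSuperalgebra L] :
    -- the explicit differentials `∂_{k+1} : M_{k+1} → M_k` and the augmentation `∂_0 : M_0 → ℂ`
    (∀ (k : ℕ) (u : Env L) (X : List (L0 L)) (Y : List (L1 L)), X.length + Y.length = k + 1 →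
      koszulD L k (u ⊗ₜ[ℂ] gen (k + 1) X Y) =
        (∑ s : Fin X.length, ∑ t ∈ Finset.Ioi s, ((-1 : ℂ) ^ (s + t : ℕ)) •
          (u ⊗ₜ[ℂ] gen k (br00 X[s] X[t] :: (X.eraseIdx t).eraseIdx s) Y)) +
        (∑ s : Fin X.length, ∑ t : Fin Y.length, ((-1 : ℂ) ^ (s + 1 : ℕ)) •
          (u ⊗ₜ[ℂ] gen k (X.eraseIdx s) (br01 X[s] Y[t] :: Y.eraseIdx t))) -
        (∑ s : Fin Y.length, ∑ t ∈ Finset.Ioi s,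
          u ⊗ₜ[ℂ] gen k (br11 Y[s] Y[t] :: X) ((Y.eraseIdx t).eraseIdx s)) +
        (∑ s : Fin X.length, ((-1 : ℂ) ^ (s : ℕ)) •
          ((u * envι L X[s]) ⊗ₜ[ℂ] gen k (X.eraseIdx s) Y)) +
        ((-1 : ℂ) ^ X.length) • (∑ t : Fin Y.length,
          (u * envι L Y[t]) ⊗ₜ[ℂ] gen k X (Y.eraseIdx t))) ∧
    (∀ u : Env L, koszulAug.{u, 0} L (u ⊗ₜ[ℂ] gen 0 [] []) = ULift.up (envAug L u)) ∧
    -- `M` is a free resolution of the trivial left `U(L)`-module `ℂ`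
    (∀ k : ℕ, Module.Free (Env L) (Koszul L k)) ∧
    (∀ k : ℕ, koszulD L k ∘ₗ koszulD L (k + 1) = 0) ∧
    Function.Surjective (koszulAug.{u, 0} L) ∧
    Function.Exact (koszulD L 0) (koszulAug.{u, 0} L) ∧
    (∀ k : ℕ, Function.Exact (koszulD L (k + 1)) (koszulD L k)) ∧
    -- homology with coefficients in a right `U(L)`-module `V`
    (∀ (V : Type v) [AddCommGroup V] [Module ℂ V] [Module (Env L)ᵐᵒᵖ V]
        [IsScalarTower ℂ (Env L)ᵐᵒᵖ V],
      -- the differentials of the standard complex `V ⊗ C_•(L)`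
      (∀ (k : ℕ) (v : V) (X : List (L0 L)) (Y : List (L1 L)), X.length + Y.length = k + 1 →
        stdD L V k (v ⊗ₜ[ℂ] gen (k + 1) X Y) =
          (∑ s : Fin X.length, ∑ t ∈ Finset.Ioi s, ((-1 : ℂ) ^ (s + t : ℕ)) •
            (v ⊗ₜ[ℂ] gen k (br00 X[s] X[t] :: (X.eraseIdx t).eraseIdx s) Y)) +
          (∑ s : Fin X.length, ∑ t : Fin Y.length, ((-1 : ℂ) ^ (s + 1 : ℕ)) •
            (v ⊗ₜ[ℂ] gen k (X.eraseIdx s) (br01 X[s] Y[t] :: Y.eraseIdx t))) -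
          (∑ s : Fin Y.length, ∑ t ∈ Finset.Ioi s,
            v ⊗ₜ[ℂ] gen k (br11 Y[s] Y[t] :: X) ((Y.eraseIdx t).eraseIdx s)) +
          (∑ s : Fin X.length, ((-1 : ℂ) ^ (s : ℕ)) •
            ((MulOpposite.op (envι L X[s]) • v) ⊗ₜ[ℂ] gen k (X.eraseIdx s) Y)) +
          ((-1 : ℂ) ^ X.length) • (∑ t : Fin Y.length,
            (MulOpposite.op (envι L Y[t]) • v) ⊗ₜ[ℂ] gen k X (Y.eraseIdx t))) ∧
      (∀ k : ℕ, stdD L V k ∘ₗ stdD L V (k + 1) = 0) ∧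
      -- the standard complex is `V ⊗_U M`
      (∃ e : ∀ k : ℕ, BalancedTensor (Env L) V (Koszul L k) ≃ₗ[ℂ] V ⊗[ℂ] Chains L k,
        (∀ (k : ℕ) (v : V) (u : Env L) (c : Chains L k),
          e k (Submodule.Quotient.mk (v ⊗ₜ[ℂ] (u ⊗ₜ[ℂ] c))) = (MulOpposite.op u • v) ⊗ₜ[ℂ] c) ∧
        ∀ (k : ℕ) (z : BalancedTensor (Env L) V (Koszul L (k + 1))),
          e k (balancedMap (Env L) V (koszulD L k) z) = stdD L V k (e (k + 1) z)) ∧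
      -- `H_k(L, V) = Tor_k^U(V, ℂ)` is the homology of the standard complex
      ∀ k : ℕ, Nonempty (superHomology L V k ≃ₗ[ℂ] StdHomology L V k)) := by
  refine ⟨fun k u X Y h => stdD_gen (Env L) k u X Y h, koszulAug_gen, free_koszul L,
    fun k => LinearMap.ext (koszulD_koszulD k), koszulAug_surjective, exact_koszulAug,
    exact_koszulD, fun V _ _ _ _ => ⟨stdD_gen V, fun k => LinearMap.ext (stdD_stdD L V k),
      ⟨fun k => balancedEquiv (LinearEquiv.refl (Env L) (Koszul L k)), fun k v u c => ?_,
        fun k z => ?_⟩, nonempty_superHomology_equiv L V⟩⟩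
  · exact balancedEquiv_mk (LinearEquiv.refl (Env L) (Koszul L k)) v (u ⊗ₜ c)
  · exact balancedEquiv_balancedMap L k (LinearEquiv.refl _ _) (LinearEquiv.refl _ _)
      (koszulD L k) (fun _ => rfl) z
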